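/- Let $p,q\ge 0$, $n=p+q$, let $s=\mathrm{diag}(-I_p,I_q)$ and $\langle v,w\rangle=-\sum_{i\le p}\overline{v_i}w_i+\sum_{i>p}\overline{v_i}w_i$ on $\mathbb C^n$. For a matrix $A$ let $A^*$ be its adjoint with respect to $\langle\cdot,\cdot\rangle$, for a subspace $V$ let $V^\perp$ be its orthogonal complement with respect to $\langle\cdot,\cdot\rangle$; $V$ is isotropic if $\langle\cdot,\cdot\rangle$ vanishes on $V$. Let $\tau(A)=(A^*)^{-1}$, whose fixed point group is $\mathrm U(p,q)$. Let $\mathcal L_-^\tau$ be the group of meromorphic maps $g:\mathbb{CP}^1\to \mathrm{End}(\mathbb C^n)$ (generically invertible, under pointwise multiplication away from finitely many points) with $g(\infty)=\mathrm{Id}$ and $\tau(g(\lambda))=g(\bar\lambda)$. A singularity of $g$ is a pole of $g$ or a point at which $g$ is holomorphic with non-invertible value. Consider the following simple elements, where $\pi$ denotes the projections of the indicated decomposition: * $p_{\alpha,V}(\lambda)=\frac{\lambda-\alpha}{\lambda-\bar\alpha}\,\pi_V+\pi_{V^\perp}$, for $\alpha\in\mathbb C\setminus\mathbb R$ and $\mathbb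 C^n=V\oplus V^\perp$; * $q_{\alpha,\beta,V}(\lambda)=\frac{\lambda-\alpha}{\lambda-\beta}\,\pi_V+\pi_{(V\oplus sV)^\perp}+\frac{\lambda-\bar\beta}{\lambda-\bar\alpha}\,\pi_{sV}$, for $\alpha\ne\beta$ in $\mathbb C$, $V$ isotropic and $\mathbb C^n=V\oplus(V\oplus sV)^\perp\oplus sV$; * $m_{\alpha,k,N}(\lambda)=\mathrm{Id}+(\lambda-\alpha)^{-k}N$, for $\alpha\in\mathbb R$, an integer $k\ge1$, $N^2=0$ and $N^*=-N$; * $n_{\alpha,k,N}(\lambda)=\mathrm{Id}+(\lambda-\alpha)^{-k}N+\frac12(\lambda-\alpha)^{-2k}N^2$, for $\alpha\in\mathbb R$, an integer $k\ge1$ and $N=M-M^*$, where $M:(V\oplus sV)^\perp\to V$ is linear, extended by zero on $V\oplus sV$, and $V$ is a maximal isotropic subspace. All of these belong to $\mathcal L_-^\tau$, and the following holds. 1. If $p=q$, the group $\mathcal L_-^\tau$ is generated by the elements $p_{\alpha,V}$, $q_{\alpha,\beta,V}$ and $m_{\alpha,k,N}$. Moreover, if $\alpha\in\mathbb R$ and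 $g\in\mathcal L_-^\tau$ has no singularity other than $\alpha$, then $g$ is a (finite, possibly empty) product of elements $m_{\alpha,k,N}$. 2. If $p\ne q$, the group $\mathcal L_-^\tau$ is generated by the elements $p_{\alpha,V}$, $q_{\alpha,\beta,V}$, $m_{\alpha,k,N}$ and $n_{\alpha,k,N}$. Moreover, if $\alpha\in\mathbb R$ and $g\in\mathcal L_-^\tau$ has no singularity other than $\alpha$, then $g$ is a (finite, possibly empty) product of elements $m_{\alpha,k,N}$ and $n_{\alpha,k,N}$. -/

import Mathlib

open Filter Topology ComplexConjugate

namespace UpqLoop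

/-- Complex matrices of size `n = p + q`; the first `p` coordinates are the negative ones. -/
abbrev Mat (p q : ℕ) : Type := Matrix (Fin p ⊕ Fin q) (Fin p ⊕ Fin q) ℂ

/-- The complex vector space `ℂⁿ`, `n = p + q`. -/
abbrev Vec (p q : ℕ) : Type := Fin p ⊕ Fin q → ℂ

/-- The matrix `s = diag(-I_p, I_q)`. -/
def sMat (p q : ℕ) : Mat p q := Matrix.fromBlocks (-1) 0 0 1

/-- The indefinite Hermitian inner product
`⟨v, w⟩ = - ∑_{i ≤ p} conj vᵢ wᵢ + ∑_{i > p} conj vᵢ wᵢ`. -/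
def form {p q : ℕ} (v w : Vec p q) : ℂ :=
  -(∑ i : Fin p, conj (v (Sum.inl i)) * w (Sum.inl i)) +
    ∑ j : Fin q, conj (v (Sum.inr j)) * w (Sum.inr j)

/-- The adjoint `A^*` of `A` with respect to `form` (see `form_adj`). -/
def adj {p q : ℕ} (A : Mat p q) : Mat p q := sMat p q * A.conjTranspose * sMat p q

/-- The antiholomorphic involution `τ(A) = (A^*)⁻¹`, with fixed point group `U(p,q)`. -/
noncomputable def tau {p q : ℕ} (A : Mat p q) : Mat p q := (adj A)⁻¹

theorem sMat_mul_sMat (p q : ℕ) : sMat p q * sMat p q = 1 := by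
  simp [sMat, Matrix.fromBlocks_multiply]

theorem form_eq_dotProduct {p q : ℕ} (v w : Vec p q) :
    form v w = star v ⬝ᵥ (sMat p q).mulVec w := by
  simp [form, sMat, dotProduct, Matrix.fromBlocks_mulVec, Matrix.neg_mulVec]

/-- `adj A` is the adjoint of `A` for the indefinite inner product. -/
theorem form_adj {p q : ℕ} (A : Mat p q) (v w : Vec p q) :
    form v ((adj A).mulVec w) = form (A.mulVec v) w := by
  simp only [form_eq_dotProduct, adj, Matrix.mulVec_mulVec, Matrix.star_mulVec, ← mul_assoc,
    sMat_mul_sMat, one_mul, Matrix.dotProduct_mulVec, Matrix.vecMul_vecMul]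

theorem adj_mul {p q : ℕ} (A B : Mat p q) : adj (A * B) = adj B * adj A := by
  have h : adj B * adj A
      = sMat p q * B.conjTranspose * (sMat p q * sMat p q) * A.conjTranspose * sMat p q := by
    simp only [adj, mul_assoc]
  rw [h, sMat_mul_sMat]
  simp only [adj, Matrix.conjTranspose_mul, mul_assoc, mul_one]

theorem adj_one {p q : ℕ} : adj (1 : Mat p q) = 1 := by
  simp [adj, sMat_mul_sMat]

theorem adj_inv {p q : ℕ} (A : Mat p q) : adj A⁻¹ = (adj A)⁻¹ := by
  have hs : (sMat p q)⁻¹ = sMat p q := Matrix.inv_eq_right_inv (sMat_mul_sMat p q)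
  simp only [adj, Matrix.mul_inv_rev, hs, Matrix.conjTranspose_nonsing_inv, mul_assoc]

/-! ### Rational loops -/

/-- Generically invertible matrix functions of `λ ∈ ℂ ⊂ ℂP¹`, where two functions that agree
outside a finite set are identified. -/
abbrev Loop (p q : ℕ) : Type := (Germ (cofinite : Filter ℂ) (Mat p q))ˣ

/-- `f` is meromorphic on `ℂP¹` as an `End(ℂⁿ)`-valued function: at every point of `ℂ`, and,
in the coordinate `w = 1/λ`, at `∞`. -/
def IsMeromorphicOnSphere {p q : ℕ} (f : ℂ → Mat p q) : Prop :=
  (∀ z : ℂ, ∀ i j, MeromorphicAt (fun l => f l i j) z) ∧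
    ∀ i j, MeromorphicAt (fun w : ℂ => f w⁻¹ i j) 0

/-- `f` is normalized at infinity, `f(∞) = Id`. -/
def IsNegative {p q : ℕ} (f : ℂ → Mat p q) : Prop := Tendsto f (cocompact ℂ) (𝓝 1)

/-- The reality condition `τ(f(λ)) = f(conj λ)`. -/
def IsReal {p q : ℕ} (f : ℂ → Mat p q) : Prop :=
  ∀ᶠ l in (cofinite : Filter ℂ), tau (f l) = f (conj l)

theorem meromorphicAt_det {ι : Type*} [Fintype ι] [DecidableEq ι] {f : ℂ → Matrix ι ι ℂ} {z : ℂ}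
    (h : ∀ i j, MeromorphicAt (fun l => f l i j) z) : MeromorphicAt (fun l => (f l).det) z := by
  simp only [Matrix.det_apply']
  refine MeromorphicAt.fun_sum fun σ _ => ?_
  exact (MeromorphicAt.const _ z).fun_mul (MeromorphicAt.fun_prod fun i _ => h _ _)

theorem meromorphicAt_inv {ι : Type*} [Fintype ι] [DecidableEq ι] {f : ℂ → Matrix ι ι ℂ} {z : ℂ}
    (h : ∀ i j, MeromorphicAt (fun l => f l i j) z) (i j : ι) :
    MeromorphicAt (fun l => (f l)⁻¹ i j) z := by
  simp only [Matrix.inv_def, Matrix.smul_apply, Ring.inverse_eq_inv', smul_eq_mul,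
    Matrix.adjugate_apply]
  refine (meromorphicAt_det h).fun_inv.fun_mul (meromorphicAt_det fun a b => ?_)
  simp only [Matrix.updateRow_apply]
  split_ifs
  · exact MeromorphicAt.const _ z
  · exact h a b

theorem meromorphicAt_mul {ι : Type*} [Fintype ι] {f g : ℂ → Matrix ι ι ℂ} {z : ℂ}
    (hf : ∀ i j, MeromorphicAt (fun l => f l i j) z)
    (hg : ∀ i j, MeromorphicAt (fun l => g l i j) z) (i j : ι) :
    MeromorphicAt (fun l => (f l * g l) i j) z := by
  simp only [Matrix.mul_apply]
  exact MeromorphicAt.fun_sum fun k _ => (hf i k).fun_mul (hg k j)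

theorem tendsto_inv_one {ι α : Type*} [Fintype ι] [DecidableEq ι] {f : α → Matrix ι ι ℂ}
    {F : Filter α} (h : Tendsto f F (𝓝 1)) : Tendsto (fun l => (f l)⁻¹) F (𝓝 1) := by
  simp only [Matrix.inv_def, Ring.inverse_eq_inv']
  have hd : Tendsto (fun l => (f l).det) F (𝓝 1) := by
    have := ((continuous_id.matrix_det (n := ι) (R := ℂ)).tendsto 1).comp h
    simpa [Function.comp_def] using this
  have ha : Tendsto (fun l => (f l).adjugate) F (𝓝 1) := by
    have := ((continuous_id.matrix_adjugate (n := ι) (R := ℂ)).tendsto 1).comp h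
    simpa [Function.comp_def] using this
  simpa using (hd.inv₀ one_ne_zero).smul ha

/-- The group of negative rational loops `ℂP¹ → GL(n,ℂ)`, `n = p + q`, that satisfy the
`U(p,q)`-reality condition. The three conditions do not depend on the representative. -/
def negRealLoops (p q : ℕ) : Subgroup (Loop p q) where
  carrier := {g | ∃ f : ℂ → Mat p q, (g : Germ (cofinite : Filter ℂ) (Mat p q)) = (f : Germ _ _) ∧
    IsMeromorphicOnSphere f ∧ IsNegative f ∧ IsReal f}
  one_mem' := by
    refine ⟨fun _ => 1, rfl, ⟨fun z i j => MeromorphicAt.const _ z,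
      fun i j => MeromorphicAt.const _ 0⟩, tendsto_const_nhds, ?_⟩
    exact Eventually.of_forall fun l => by simp [tau, adj_one]
  mul_mem' := by
    rintro a b ⟨f, hf, hfm, hfn, hfr⟩ ⟨g, hg, hgm, hgn, hgr⟩
    refine ⟨fun l => f l * g l, ?_, ⟨fun z => meromorphicAt_mul (hfm.1 z) (hgm.1 z),
      meromorphicAt_mul hfm.2 hgm.2⟩, ?_, ?_⟩
    · rw [Units.val_mul, hf, hg]; rfl
    · simpa [IsNegative] using Tendsto.mul hfn hgn
    · filter_upwards [hfr, hgr] with l h1 h2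
      simp only [tau] at h1 h2 ⊢
      rw [adj_mul, Matrix.mul_inv_rev, h1, h2]
  inv_mem' := by
    rintro a ⟨f, hf, hfm, hfn, hfr⟩
    refine ⟨fun l => (f l)⁻¹, ?_, ⟨fun z => meromorphicAt_inv (hfm.1 z),
      meromorphicAt_inv hfm.2⟩, tendsto_inv_one hfn, ?_⟩
    · have h1 : (a : Germ (cofinite : Filter ℂ) (Mat p q)) * (a⁻¹ : Loop p q) = 1 := a.mul_inv
      rw [hf] at h1
      revert h1
      generalize ((a⁻¹ : Loop p q) : Germ (cofinite : Filter ℂ) (Mat p q)) = b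
      induction b using Germ.inductionOn with
      | _ g =>
        intro h1
        have h2 : ∀ᶠ l in (cofinite : Filter ℂ), f l * g l = 1 := Germ.coe_eq.1 h1
        refine Germ.coe_eq.2 ?_
        filter_upwards [h2] with l hl
        exact (Matrix.inv_eq_right_inv hl).symm
    · filter_upwards [hfr] with l h1
      simp only [tau] at h1 ⊢
      rw [adj_inv, h1]

/-! ### Singularities -/

/-- `α` is a pole of the loop `g`: no representative of `g` is holomorphic at `α`. -/
def IsPole {p q : ℕ} (g : Loop p q) (α : ℂ) : Prop :=
  ¬ ∃ f : ℂ → Mat p q, (g : Germ (cofinite : Filter ℂ) (Mat p q)) = (f : Germ _ _) ∧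
    ∀ i j, AnalyticAt ℂ (fun l => f l i j) α

/-- `α` is a zero of the loop `g`: `g` is holomorphic at `α` and `g(α)` is singular. -/
def IsZero {p q : ℕ} (g : Loop p q) (α : ℂ) : Prop :=
  ∃ f : ℂ → Mat p q, (g : Germ (cofinite : Filter ℂ) (Mat p q)) = (f : Germ _ _) ∧
    (∀ i j, AnalyticAt ℂ (fun l => f l i j) α) ∧ ¬ IsUnit (f α)

/-- A singularity is a pole or a zero. -/
def IsSingularity {p q : ℕ} (g : Loop p q) (α : ℂ) : Prop := IsPole g α ∨ IsZero g α

/-! ### Subspaces and projections -/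

/-- `V^⊥` with respect to the indefinite inner product. -/
def perp {p q : ℕ} (V : Submodule ℂ (Vec p q)) : Submodule ℂ (Vec p q) where
  carrier := {w | ∀ v ∈ V, form v w = 0}
  zero_mem' := by intro v _; simp [form]
  add_mem' := by
    intro a b ha hb v hv
    have h1 := ha v hv
    have h2 := hb v hv
    rw [form_eq_dotProduct] at h1 h2 ⊢
    rw [Matrix.mulVec_add, dotProduct_add, h1, h2, add_zero]
  smul_mem' := by
    intro c a ha v hv
    have h1 := ha v hv
    rw [form_eq_dotProduct] at h1 ⊢
    rw [Matrix.mulVec_smul, dotProduct_smul, h1, smul_zero]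

/-- `V` is isotropic: the inner product vanishes on `V`. -/
def IsIsotropic {p q : ℕ} (V : Submodule ℂ (Vec p q)) : Prop :=
  ∀ v ∈ V, ∀ w ∈ V, form v w = 0

/-- The subspace `sV`. -/
noncomputable def sMap {p q : ℕ} (V : Submodule ℂ (Vec p q)) : Submodule ℂ (Vec p q) :=
  V.map (Matrix.toLin' (sMat p q))

open Classical in
/-- The matrix of the projection onto `V` along `U`, for `ℂⁿ = V ⊕ U`. -/
noncomputable def proj {p q : ℕ} (V U : Submodule ℂ (Vec p q)) : Mat p q :=
  if h : IsCompl V U then LinearMap.toMatrix' (V.projection U h) else 0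

/-! ### Simple elements -/

/-- `p_{α,V}(λ) = ((λ-α)/(λ-conj α)) π_V + π_{V^⊥}`. -/
noncomputable def pElt {p q : ℕ} (α : ℂ) (V : Submodule ℂ (Vec p q)) (l : ℂ) : Mat p q :=
  ((l - α) / (l - conj α)) • proj V (perp V) + proj (perp V) V

/-- `q_{α,β,V}(λ) = ((λ-α)/(λ-β)) π_V + π_{(V⊕sV)^⊥} + ((λ-conj β)/(λ-conj α)) π_{sV}`, with the
projections of the decomposition `ℂⁿ = V ⊕ (V⊕sV)^⊥ ⊕ sV`. -/
noncomputable def qElt {p q : ℕ} (α β : ℂ) (V : Submodule ℂ (Vec p q)) (l : ℂ) : Mat p q :=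
  ((l - α) / (l - β)) • proj V (perp (V ⊔ sMap V) ⊔ sMap V)
    + proj (perp (V ⊔ sMap V)) (V ⊔ sMap V)
    + ((l - conj β) / (l - conj α)) • proj (sMap V) (V ⊔ perp (V ⊔ sMap V))

/-- `m_{α,k,N}(λ) = Id + (λ-α)^{-k} N`. -/
noncomputable def mElt {p q : ℕ} (α : ℝ) (k : ℕ) (N : Mat p q) (l : ℂ) : Mat p q :=
  1 + (1 / (l - (α : ℂ))) ^ k • N

/-- `n_{α,k,N}(λ) = Id + (λ-α)^{-k} N + (1/2) (λ-α)^{-2k} N²`. -/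
noncomputable def nElt {p q : ℕ} (α : ℝ) (k : ℕ) (N : Mat p q) (l : ℂ) : Mat p q :=
  1 + (1 / (l - (α : ℂ))) ^ k • N + ((1 / 2 : ℂ) * (1 / (l - (α : ℂ))) ^ (2 * k)) • N ^ 2

/-- The simple elements `p_{α,V}` with `ℂⁿ = V ⊕ V^⊥`. -/
def pFamily (p q : ℕ) : Set (ℂ → Mat p q) :=
  {f | ∃ (α : ℂ) (V : Submodule ℂ (Vec p q)), α ≠ conj α ∧ IsCompl V (perp V) ∧ f = pElt α V}

/-- The simple elements `q_{α,β,V}` with `V` isotropic. -/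
def qFamily (p q : ℕ) : Set (ℂ → Mat p q) :=
  {f | ∃ (α β : ℂ) (V : Submodule ℂ (Vec p q)), α ≠ β ∧ IsIsotropic V ∧
    DirectSum.IsInternal ![V, perp (V ⊔ sMap V), sMap V] ∧ f = qElt α β V}

/-- The simple elements `m_{α,k,N}` with pole `α`: `k ≥ 1`, `N² = 0` and `N^* = -N`. -/
def mFamily (p q : ℕ) (α : ℝ) : Set (ℂ → Mat p q) :=
  {f | ∃ (k : ℕ) (N : Mat p q), 1 ≤ k ∧ N ^ 2 = 0 ∧ adj N = -N ∧ f = mElt α k N}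

/-- The simple elements `n_{α,k,N}` with pole `α`: `k ≥ 1` and `N = M - M^*`, where
`M : (V⊕sV)^⊥ → V` is linear, extended by zero on `V⊕sV`, and `V` is maximal isotropic. -/
def nFamily (p q : ℕ) (α : ℝ) : Set (ℂ → Mat p q) :=
  {f | ∃ (k : ℕ) (V : Submodule ℂ (Vec p q)) (M : Mat p q), 1 ≤ k ∧ Maximal IsIsotropic V ∧
    (∀ v ∈ V ⊔ sMap V, M.mulVec v = 0) ∧ (∀ w ∈ perp (V ⊔ sMap V), M.mulVec w ∈ V) ∧
    f = nElt α k (M - adj M)}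

/-- The loops that are represented by a function in `S`. -/
def loopsOf {p q : ℕ} (S : Set (ℂ → Mat p q)) : Set (Loop p q) :=
  {g | ∃ f ∈ S, (g : Germ (cofinite : Filter ℂ) (Mat p q)) = (f : Germ _ _)}

end UpqLoop

namespace UpqLoop

/-! ### The indefinite form -/

section Form

variable {p q : ℕ}

/-! Fix a real α and substitute z = 1/(λ - α). Then λ = ∞ becomes z = 0 and complex conjugation is
respected. Meromorphic functions on the sphere are rational, so a loop becomes P(z)/d(z) with a
polynomial matrix P and a polynomial d, P(0) = 1, d(0) = 1 and ⟨Pv, Pw⟩ = d̄ d ⟨v, w⟩, where the bar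
conjugates coefficients (`exists_pairFun`, `IsUnitaryPair.of_loop`). If α is the only pole, d = 1.
The theorem is thus about generators for the unitary group of the form over ℂ(z), or over ℂ[z], with
value 1 at z = 0.

The main tool is the Eichler transvection `transv e x c`, with e isotropic and x orthogonal to e.
For fixed e these form a Heisenberg-type group: composition adds the x up to a central factor.
Central elements and those with x = z^k x₀, x₀ isotropic, are products of elements m. If the
complement of V ⊕ sV contains a nonzero isotropic vector, it is spanned by such vectors and the
elements m suffice; if it is anisotropic, V is maximal isotropic and x = z^k x₀ gives an element n
(`good_transv`).

For polynomial loops, suppose P fixes V ⊕ sV, V isotropic. If the complement is anisotropic then P =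
1, since the leading coefficient of a nonconstant P w would be isotropic. Otherwise take an
isotropic unit vector e₀ in the complement. A Euclidean algorithm by transvections along the leading
coefficient of P e₀ lowers its degree until P e₀ = e₀ (`good_of_natDegree_le`). One more
transvection fixes s e₀ (`good_of_fixes_isotropic`), and V grows.

For rational loops no Euclidean algorithm is needed: the elements q yield the diagonal maps (a, 1,
1/ā) on e, rest, se for every polynomial a with a(0) = 1, and these together with transvections
carry P e and P se back (`good_of_next`, `good_of_fixes_isotropic'`). Over an anisotropic
complement, each root of d is removed by cancelling a common scalar factor or splitting off an
element p (`good_of_isAnisotropic`).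

When p = q, a maximal isotropic V has V ⊕ sV = ℂⁿ, so every element n is trivial and both cases
follow from one argument (`loopsOf_nFamily_subset`). -/

@[simp] theorem sMat_mulVec_inl (v : Vec p q) (i : Fin p) :
    (sMat p q).mulVec v (Sum.inl i) = -v (Sum.inl i) := by
  simp [sMat, Matrix.fromBlocks_mulVec, Matrix.neg_mulVec]

@[simp] theorem sMat_mulVec_inr (v : Vec p q) (i : Fin q) :
    (sMat p q).mulVec v (Sum.inr i) = v (Sum.inr i) := by
  simp [sMat, Matrix.fromBlocks_mulVec]

@[simp] theorem sMat_mul_sMat_mulVec (v : Vec p q) : (sMat p q * sMat p q).mulVec v = v := by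
  rw [sMat_mul_sMat, Matrix.one_mulVec]

theorem sMat_mulVec_sMat_mulVec (v : Vec p q) :
    (sMat p q).mulVec ((sMat p q).mulVec v) = v := by
  rw [Matrix.mulVec_mulVec, sMat_mul_sMat, Matrix.one_mulVec]

theorem form_add_left (u v w : Vec p q) : form (u + v) w = form u w + form v w := by
  simp only [form, Pi.add_apply, map_add, add_mul, Finset.sum_add_distrib]; ring

theorem form_add_right (u v w : Vec p q) : form u (v + w) = form u v + form u w := by
  simp only [form, Pi.add_apply, mul_add, Finset.sum_add_distrib]; ring

theorem form_smul_left (c : ℂ) (v w : Vec p q) : form (c • v) w = conj c * form v w := by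
  simp only [form, Pi.smul_apply, smul_eq_mul, map_mul, mul_assoc, ← Finset.mul_sum]; ring

theorem form_smul_right (c : ℂ) (v w : Vec p q) : form v (c • w) = c * form v w := by
  simp only [form, Pi.smul_apply, smul_eq_mul, mul_left_comm _ c, ← Finset.mul_sum]; ring

theorem form_conj (v w : Vec p q) : conj (form v w) = form w v := by
  simp [form, mul_comm]

@[simp] theorem form_zero_left (v : Vec p q) : form 0 v = 0 := by simp [form]

@[simp] theorem form_zero_right (v : Vec p q) : form v 0 = 0 := by simp [form]

theorem form_neg_right (v w : Vec p q) : form v (-w) = -form v w := by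
  simpa using form_smul_right (-1) v w

theorem form_sub_right (u v w : Vec p q) : form u (v - w) = form u v - form u w := by
  rw [sub_eq_add_neg, form_add_right, form_neg_right, ← sub_eq_add_neg]

theorem form_eq_zero_symm {v w : Vec p q} (h : form v w = 0) : form w v = 0 := by
  rw [← form_conj, h, map_zero]

theorem form_sMat_left (v w : Vec p q) :
    form ((sMat p q).mulVec v) w = form v ((sMat p q).mulVec w) := by
  simp [form]

theorem form_sMat_sMat (v w : Vec p q) :
    form ((sMat p q).mulVec v) ((sMat p q).mulVec w) = form v w := by
  rw [form_sMat_left, sMat_mulVec_sMat_mulVec]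

/-- The Euclidean norm squared. -/
noncomputable def nsq (v : Vec p q) : ℝ := ∑ i, ‖v i‖ ^ 2

theorem form_sMat_self (v : Vec p q) : form v ((sMat p q).mulVec v) = (nsq v : ℂ) := by
  simp [form, nsq, Complex.conj_mul']

theorem nsq_nonneg (v : Vec p q) : 0 ≤ nsq v := Finset.sum_nonneg fun _ _ => by positivity

theorem nsq_eq_zero {v : Vec p q} : nsq v = 0 ↔ v = 0 := by
  rw [nsq, Finset.sum_eq_zero_iff_of_nonneg fun _ _ => by positivity]
  simp [funext_iff]

theorem form_sMat_self_eq_zero {v : Vec p q} (h : form v ((sMat p q).mulVec v) = 0) : v = 0 := by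
  rw [form_sMat_self, Complex.ofReal_eq_zero] at h
  exact nsq_eq_zero.1 h

theorem nondegenerate_form {v : Vec p q} (h : ∀ w, form w v = 0) : v = 0 := by
  refine form_sMat_self_eq_zero ?_
  rw [← form_sMat_left]
  exact h _

/-- Adjoints are determined by the form. -/
theorem adj_eq_of_form {A B : Mat p q}
    (h : ∀ v w, form v (B.mulVec w) = form (A.mulVec v) w) : adj A = B := by
  refine Matrix.mulVec_injective (funext fun w => ?_)
  rw [← sub_eq_zero]
  refine nondegenerate_form fun v => ?_
  rw [form_sub_right, form_adj, h, sub_self]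

theorem adj_add (A B : Mat p q) : adj (A + B) = adj A + adj B := by
  simp [adj, mul_add, add_mul]

theorem adj_neg (A : Mat p q) : adj (-A) = -adj A := by simp [adj]

theorem adj_sub (A B : Mat p q) : adj (A - B) = adj A - adj B := by
  rw [sub_eq_add_neg, adj_add, adj_neg, ← sub_eq_add_neg]

theorem adj_smul (c : ℂ) (A : Mat p q) : adj (c • A) = conj c • adj A := by
  simp [adj, Matrix.conjTranspose_smul]

theorem sMat_conjTranspose : (sMat p q).conjTranspose = sMat p q := by
  simp [sMat, Matrix.fromBlocks_conjTranspose]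

theorem adj_adj (A : Mat p q) : adj (adj A) = A := by
  simp only [adj, Matrix.conjTranspose_mul, Matrix.conjTranspose_conjTranspose,
    sMat_conjTranspose, mul_assoc, sMat_mul_sMat, mul_one]
  rw [← mul_assoc, sMat_mul_sMat, one_mul]

/-- The rank one operator `v ↦ ⟨b, v⟩ a`. -/
def rankOne (a b : Vec p q) : Mat p q := Matrix.vecMulVec a (star ((sMat p q).mulVec b))

theorem rankOne_mulVec (a b v : Vec p q) : (rankOne a b).mulVec v = form b v • a := by
  rw [rankOne, Matrix.vecMulVec_mulVec, form_eq_dotProduct]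
  have : star ((sMat p q).mulVec b) ⬝ᵥ v = star b ⬝ᵥ (sMat p q).mulVec v := by
    rw [Matrix.star_mulVec, sMat_conjTranspose, ← Matrix.dotProduct_mulVec]
  rw [this]
  ext i; simp [mul_comm]

theorem adj_rankOne (a b : Vec p q) : adj (rankOne a b) = rankOne b a := by
  refine adj_eq_of_form fun v w => ?_
  rw [rankOne_mulVec, rankOne_mulVec, form_smul_right, form_smul_left, form_conj, mul_comm]

theorem rankOne_mul_rankOne (a b c d : Vec p q) :
    rankOne a b * rankOne c d = form b c • rankOne a d := by
  refine Matrix.mulVec_injective (funext fun w => ?_)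
  simp only [← Matrix.mulVec_mulVec, rankOne_mulVec, Matrix.mulVec_smul, Matrix.smul_mulVec,
    smul_smul, mul_comm]

end Form

/-! ### Subspaces -/

section Subspaces

variable {p q : ℕ}

theorem mem_sMap {V : Submodule ℂ (Vec p q)} {w : Vec p q} :
    w ∈ sMap V ↔ (sMat p q).mulVec w ∈ V := by
  simp only [sMap, Submodule.mem_map, Matrix.toLin'_apply]
  constructor
  · rintro ⟨v, hv, rfl⟩
    simpa using hv
  · intro h
    exact ⟨_, h, by simp⟩

theorem sMat_mulVec_mem_sMap {V : Submodule ℂ (Vec p q)} {w : Vec p q} (h : w ∈ V) :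
    (sMat p q).mulVec w ∈ sMap V := by
  rw [mem_sMap]; simpa using h

/-- The hyperbolic subspace `V ⊕ sV`. -/
noncomputable abbrev hyp (V : Submodule ℂ (Vec p q)) : Submodule ℂ (Vec p q) := V ⊔ sMap V

theorem sMat_mulVec_mem_hyp {V : Submodule ℂ (Vec p q)} {w : Vec p q} (h : w ∈ hyp V) :
    (sMat p q).mulVec w ∈ hyp V := by
  obtain ⟨a, ha, b, hb, rfl⟩ := Submodule.mem_sup.1 h
  rw [Matrix.mulVec_add]
  exact add_mem (Submodule.mem_sup_right (sMat_mulVec_mem_sMap ha))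
    (Submodule.mem_sup_left (mem_sMap.1 hb))

theorem sMat_mulVec_mem_perp_hyp {V : Submodule ℂ (Vec p q)} {w : Vec p q}
    (h : w ∈ perp (hyp V)) : (sMat p q).mulVec w ∈ perp (hyp V) := by
  intro v hv
  rw [← form_sMat_left]
  exact h _ (sMat_mulVec_mem_hyp hv)

theorem perp_anti {U V : Submodule ℂ (Vec p q)} (h : U ≤ V) : perp V ≤ perp U :=
  fun _ hw v hv => hw v (h hv)

/-- `perp U` contains the kernel of the map pairing a vector with a basis of U, and that map has
rank at most `finrank U`. `isCompl_perp` needs only this inequality. -/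
theorem finrank_perp_ge (U : Submodule ℂ (Vec p q)) :
    p + q ≤ Module.finrank ℂ U + Module.finrank ℂ (perp U) := by
  let b := Module.finBasis ℂ U
  let φ : Vec p q →ₗ[ℂ] (Fin (Module.finrank ℂ U) → ℂ) :=
    { toFun := fun w i => form (b i : Vec p q) w
      map_add' := fun v w => by ext i; simp [form_add_right]
      map_smul' := fun c w => by ext i; simp [form_smul_right] }
  have h1 := φ.finrank_range_add_finrank_ker
  have h2 : LinearMap.ker φ ≤ perp U := by
    intro w hw v hv
    have hw' : ∀ i, form (b i : Vec p q) w = 0 := fun i => congrFun hw i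
    have hv' := b.sum_repr ⟨v, hv⟩
    have : v = ∑ i, b.repr ⟨v, hv⟩ i • (b i : Vec p q) := by
      have := congrArg Subtype.val hv'
      simpa only [Submodule.coe_sum, Submodule.coe_smul] using this.symm
    rw [this, ← form_conj]
    let ψ : Vec p q →ₗ[ℂ] ℂ :=
      { toFun := fun x => form w x
        map_add' := fun v w => by simp [form_add_right]
        map_smul' := fun c w => by simp [form_smul_right] }
    have h3 : form w (∑ i, b.repr ⟨v, hv⟩ i • (b i : Vec p q)) = 0 := by
      change ψ _ = 0
      rw [map_sum]
      refine Finset.sum_eq_zero fun i _ => ?_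
      rw [map_smul]
      change _ • form w (b i : Vec p q) = 0
      rw [form_eq_zero_symm (hw' i), smul_zero]
    rw [h3, map_zero]
  have h3 := Submodule.finrank_mono h2
  have h4 := (LinearMap.range φ).finrank_le
  have h5 : Module.finrank ℂ (Vec p q) = p + q := by simp
  rw [Module.finrank_fin_fun] at h4
  omega

theorem isCompl_perp {U : Submodule ℂ (Vec p q)} (h : ∀ v ∈ U, v ∈ perp U → v = 0) :
    IsCompl U (perp U) := by
  have hd : Disjoint U (perp U) := Submodule.disjoint_def.2 h
  refine ⟨hd, codisjoint_iff.2 (Submodule.eq_top_of_finrank_eq ?_)⟩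
  have h2 := Submodule.finrank_sup_add_finrank_inf_eq U (perp U)
  rw [hd.eq_bot, finrank_bot] at h2
  have h3 := finrank_perp_ge U
  have h5 : Module.finrank ℂ (Vec p q) = p + q := by simp
  have h6 := (U ⊔ perp U).finrank_le
  omega

theorem disjoint_sMap {V : Submodule ℂ (Vec p q)} (hV : IsIsotropic V) :
    Disjoint V (sMap V) := by
  refine Submodule.disjoint_def.2 fun v hv hs => ?_
  exact form_sMat_self_eq_zero (hV v hv _ (mem_sMap.1 hs))

theorem isIsotropic_sMap {V : Submodule ℂ (Vec p q)} (hV : IsIsotropic V) :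
    IsIsotropic (sMap V) := by
  intro v hv w hw
  rw [← form_sMat_sMat]
  exact hV _ (mem_sMap.1 hv) _ (mem_sMap.1 hw)

/-- ⟨v, sv⟩ is the squared Euclidean norm, so V and sV are in perfect duality. If a + b is in the
radical, pairing with sb gives b = 0, and then pairing with sa gives a = 0. -/
theorem isCompl_hyp {V : Submodule ℂ (Vec p q)} (hV : IsIsotropic V) :
    IsCompl (hyp V) (perp (hyp V)) := by
  refine isCompl_perp fun x hx hp => ?_
  obtain ⟨a, ha, b, hb, rfl⟩ := Submodule.mem_sup.1 hx
  have hb' := mem_sMap.1 hb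
  have h1 := hp _ (Submodule.mem_sup_left hb')
  rw [form_add_right, hV _ hb' _ ha, zero_add, form_sMat_left] at h1
  have hb0 := form_sMat_self_eq_zero h1
  have h2 := hp _ (Submodule.mem_sup_right (sMat_mulVec_mem_sMap ha))
  rw [hb0, add_zero, form_sMat_left] at h2
  rw [hb0, form_sMat_self_eq_zero h2, add_zero]

/-- The form is anisotropic on `W`. -/
def IsAnisotropic (W : Submodule ℂ (Vec p q)) : Prop := ∀ w ∈ W, form w w = 0 → w = 0

theorem isIsotropic_sup_span {V : Submodule ℂ (Vec p q)} (hV : IsIsotropic V) {w : Vec p q}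
    (hw : w ∈ perp V) (hw0 : form w w = 0) : IsIsotropic (V ⊔ Submodule.span ℂ {w}) := by
  intro x hx y hy
  obtain ⟨a, ha, b, hb, rfl⟩ := Submodule.mem_sup.1 hx
  obtain ⟨c, hc, d, hd, rfl⟩ := Submodule.mem_sup.1 hy
  obtain ⟨s, rfl⟩ := Submodule.mem_span_singleton.1 hb
  obtain ⟨t, rfl⟩ := Submodule.mem_span_singleton.1 hd
  simp [form_add_left, form_add_right, form_smul_left, form_smul_right, hV a ha c hc, hw a ha,
    hw0, form_eq_zero_symm (hw c hc)]

/-- Let V' ⊇ V be isotropic and a + b + w ∈ V'. Pairing with sb ∈ V kills b, and then w ∈ V' is an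
isotropic vector of an anisotropic space. This is what makes elements n available for V. -/
theorem maximal_of_isAnisotropic {V : Submodule ℂ (Vec p q)} (hV : IsIsotropic V)
    (hW : IsAnisotropic (perp (hyp V))) : Maximal IsIsotropic V := by
  refine ⟨hV, fun V' hV' hle x hx => ?_⟩
  obtain ⟨y, hy, w, hw, rfl⟩ : ∃ y ∈ hyp V, ∃ w ∈ perp (hyp V), y + w = x :=
    Submodule.mem_sup.1 ((isCompl_hyp hV).sup_eq_top ▸ Submodule.mem_top)
  obtain ⟨a, ha, b, hb, rfl⟩ := Submodule.mem_sup.1 hy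
  have hb' := mem_sMap.1 hb
  have h1 := hV' _ (hle hb') _ hx
  rw [form_add_right, form_add_right, hw _ (Submodule.mem_sup_left hb'), hV _ hb' _ ha, zero_add,
    add_zero, form_sMat_left] at h1
  have hb0 := form_sMat_self_eq_zero h1
  subst hb0
  rw [add_zero] at hx ⊢
  have hwV : w ∈ V' := by simpa using sub_mem hx (hle ha)
  rw [hW w hw (hV' _ hwV _ hwV), add_zero]
  exact ha

theorem isAnisotropic_of_maximal {V : Submodule ℂ (Vec p q)} (hV : Maximal IsIsotropic V) :
    IsAnisotropic (perp (hyp V)) := by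
  intro w hw hw0
  have h1 := isIsotropic_sup_span hV.1 (perp_anti le_sup_left hw) hw0
  have h2 : w ∈ V := hV.2 h1 le_sup_left
    (Submodule.mem_sup_right (Submodule.mem_span_singleton_self w))
  exact Submodule.disjoint_def.1 (isCompl_hyp hV.1).disjoint w (Submodule.mem_sup_left h2) hw

theorem form_eq_zero_of_eigen {x y : Vec p q} (hx : (sMat p q).mulVec x = x)
    (hy : (sMat p q).mulVec y = -y) : form x y = 0 := by
  have h := form_sMat_left x y
  rw [hx, hy, form_neg_right] at h
  linear_combination h / 2

theorem sMat_mulVec_plus (u : Vec p q) : (sMat p q).mulVec (u + (sMat p q).mulVec u) =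
    u + (sMat p q).mulVec u := by
  rw [Matrix.mulVec_add, sMat_mulVec_sMat_mulVec, add_comm]

theorem sMat_mulVec_minus (u : Vec p q) : (sMat p q).mulVec (u - (sMat p q).mulVec u) =
    -(u - (sMat p q).mulVec u) := by
  rw [Matrix.mulVec_sub, sMat_mulVec_sMat_mulVec, neg_sub]

theorem exists_real_scale {x y : Vec p q} (hy : y ≠ 0) : ∃ c : ℝ, c ^ 2 * nsq y = nsq x := by
  have h : nsq y ≠ 0 := fun h => hy (nsq_eq_zero.1 h)
  refine ⟨Real.sqrt (nsq x / nsq y), ?_⟩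
  rw [Real.sq_sqrt (div_nonneg (nsq_nonneg x) (nsq_nonneg y)), div_mul_cancel₀ _ h]

theorem isotropic_of_eigen {x y : Vec p q} (hx : (sMat p q).mulVec x = x)
    (hy : (sMat p q).mulVec y = -y) (h : nsq x = nsq y) : form (x + y) (x + y) = 0 := by
  have h1 : form x x = nsq x := by rw [← form_sMat_self, hx]
  have h2 : form y y = -(nsq y : ℂ) := by rw [← form_sMat_self, hy, form_neg_right, neg_neg]
  have h3 := form_eq_zero_of_eigen hx hy
  rw [form_add_left, form_add_right, form_add_right, h1, h2, h3, form_eq_zero_symm h3, h]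
  ring

theorem nsq_smul (c : ℝ) (x : Vec p q) : nsq ((c : ℂ) • x) = c ^ 2 * nsq x := by
  simp only [nsq, Pi.smul_apply, norm_smul, mul_pow, Finset.mul_sum, Complex.norm_real,
    Real.norm_eq_abs, sq_abs]

/-- An indefinite `s`-stable subspace is spanned by its isotropic vectors. -/
theorem mem_closure_isotropic {W : Submodule ℂ (Vec p q)}
    (hs : ∀ w ∈ W, (sMat p q).mulVec w ∈ W) {u : Vec p q} (hu : u ∈ W) (hu0 : u ≠ 0)
    (huu : form u u = 0) {x : Vec p q} (hx : x ∈ W) :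
    x ∈ AddSubmonoid.closure {w : Vec p q | w ∈ W ∧ form w w = 0} := by
  set s := sMat p q
  have hup : u + s.mulVec u ≠ 0 := fun h => hu0 <| form_sMat_self_eq_zero <| by
    rw [show (sMat p q).mulVec u = -u from eq_neg_of_add_eq_zero_right h, form_neg_right, huu,
      neg_zero]
  have hum : u - s.mulVec u ≠ 0 := fun h => hu0 <| form_sMat_self_eq_zero <| by
    rw [show (sMat p q).mulVec u = u from (sub_eq_zero.1 h).symm, huu]
  have hupW : u + s.mulVec u ∈ W := add_mem hu (hs u hu)
  have humW : u - s.mulVec u ∈ W := sub_mem hu (hs u hu)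
  -- The vectors a + b, a - b and -a + b are isotropic, and sums of two of them give 2a and 2b.
  have key : ∀ a ∈ W, ∀ b ∈ W, s.mulVec a = a → s.mulVec b = -b → nsq a = nsq b →
      a + a ∈ AddSubmonoid.closure {w : Vec p q | w ∈ W ∧ form w w = 0} ∧
      b + b ∈ AddSubmonoid.closure {w : Vec p q | w ∈ W ∧ form w w = 0} := by
    intro a ha b hb h1 h2 h3
    have hb' : s.mulVec (-b) = -(-b) := by rw [Matrix.mulVec_neg, h2]
    have ha' : s.mulVec (-a) = (-a) := by rw [Matrix.mulVec_neg, h1]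
    have hn : nsq (-b) = nsq b := by simp [nsq]
    have hn' : nsq (-a) = nsq a := by simp [nsq]
    have m1 := AddSubmonoid.subset_closure (s := {w : Vec p q | w ∈ W ∧ form w w = 0})
      ⟨add_mem ha hb, isotropic_of_eigen h1 h2 h3⟩
    have m2 := AddSubmonoid.subset_closure (s := {w : Vec p q | w ∈ W ∧ form w w = 0})
      ⟨add_mem ha (neg_mem hb), isotropic_of_eigen h1 hb' (h3.trans hn.symm)⟩
    have m3 := AddSubmonoid.subset_closure (s := {w : Vec p q | w ∈ W ∧ form w w = 0})
      ⟨add_mem (neg_mem ha) hb, isotropic_of_eigen ha' h2 (hn'.trans h3)⟩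
    refine ⟨?_, ?_⟩
    · convert add_mem m1 m2 using 1; abel
    · convert add_mem m1 m3 using 1; abel
  -- The factor 1/4 is there because `key` produces doubled vectors: 2(y + sy) + 2(y - sy) = 4y.
  set y := (1 / 4 : ℂ) • x with hy
  have hyW : y ∈ W := W.smul_mem _ hx
  have hyp : y + s.mulVec y ∈ W := add_mem hyW (hs _ hyW)
  have hym : y - s.mulVec y ∈ W := sub_mem hyW (hs _ hyW)
  obtain ⟨c, hc⟩ := exists_real_scale (x := y + s.mulVec y) hum
  obtain ⟨d, hd⟩ := exists_real_scale (x := y - s.mulVec y) hup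
  have k1 := (key _ hyp _ (W.smul_mem (c : ℂ) humW) (sMat_mulVec_plus y)
    (by rw [Matrix.mulVec_smul, sMat_mulVec_minus, smul_neg]) (by rw [nsq_smul, hc])).1
  have k2 := (key _ (W.smul_mem (d : ℂ) hupW) _ hym
    (by rw [Matrix.mulVec_smul, sMat_mulVec_plus]) (sMat_mulVec_minus y) (by rw [nsq_smul, hd])).2
  convert add_mem k1 k2 using 1
  rw [show x = (4 : ℂ) • y by rw [hy, smul_smul]; norm_num]
  module

/-- For `p = q` the complement of a hyperbolic subspace is zero as soon as it is anisotropic. -/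
theorem perp_hyp_eq_bot (hpq : p = q) {V : Submodule ℂ (Vec p q)} (hV : IsIsotropic V)
    (hW : IsAnisotropic (perp (hyp V))) : perp (hyp V) = ⊥ := by
  have hdim : 2 * Module.finrank ℂ V + Module.finrank ℂ (perp (hyp V)) = p + q := by
    have h1 : Module.finrank ℂ (V ⊔ sMap V : Submodule ℂ (Vec p q)) +
        Module.finrank ℂ (perp (hyp V)) = Module.finrank ℂ (Vec p q) :=
      Submodule.finrank_add_eq_of_isCompl (isCompl_hyp hV)
    have h2 := Submodule.finrank_sup_add_finrank_inf_eq V (sMap V)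
    rw [(disjoint_sMap hV).eq_bot, finrank_bot] at h2
    have h3 : Module.finrank ℂ (sMap V) = Module.finrank ℂ V := by
      refine LinearEquiv.finrank_eq (Submodule.equivMapOfInjective _ ?_ V).symm
      intro a b hab
      have := congrArg (sMat p q).mulVec hab
      simpa using this
    have h5 : Module.finrank ℂ (Vec p q) = p + q := by simp
    rw [h5] at h1
    omega
  have hrep : ∀ x : Vec p q, ∃ y ∈ V, ∃ w ∈ perp (hyp V), ∃ y' ∈ V,
      x = y + (sMat p q).mulVec y' + w := by
    intro x
    obtain ⟨y, hy, w, hw, rfl⟩ : ∃ y ∈ hyp V, ∃ w ∈ perp (hyp V), y + w = x :=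
      Submodule.mem_sup.1 ((isCompl_hyp hV).sup_eq_top ▸ Submodule.mem_top)
    obtain ⟨a, ha, b, hb, rfl⟩ := Submodule.mem_sup.1 hy
    exact ⟨a, ha, w, hw, _, mem_sMap.1 hb, by simp⟩
  have hle : p ≤ Module.finrank ℂ V := by
    -- The complement is s-stable and anisotropic, so s acts on it as +1 or as -1. In either case
    -- one block of coordinates vanishes on it, and V maps onto that block.
    by_cases hc : ∀ w ∈ perp (hyp V), (sMat p q).mulVec w = w
    · let φ : V →ₗ[ℂ] (Fin p → ℂ) := (LinearMap.funLeft ℂ ℂ Sum.inl).comp V.subtype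
      have hφ : Function.Surjective φ := by
        intro z
        obtain ⟨y, hy, w, hw, y', hy', h⟩ := hrep (Sum.elim z 0)
        refine ⟨⟨y - y', sub_mem hy hy'⟩, ?_⟩
        ext i
        have h1 := congrFun h (Sum.inl i)
        have h2 := congrFun (hc w hw) (Sum.inl i)
        simp only [Sum.elim_inl, Pi.add_apply, sMat_mulVec_inl] at h1 h2
        simp only [φ, LinearMap.comp_apply, LinearMap.funLeft_apply, Submodule.subtype_apply,
          Pi.sub_apply]
        linear_combination -h1 + h2 / 2
      simpa using LinearMap.finrank_le_finrank_of_surjective hφ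
    -- If both eigenvalues occurred, rescaling one eigenvector to the length of the other would
    -- produce a nonzero isotropic sum.
    · have hc' : ∀ w ∈ perp (hyp V), (sMat p q).mulVec w = -w := by
        push Not at hc
        obtain ⟨w₀, hw₀, hne⟩ := hc
        intro w hw
        by_contra hwne
        have h1 : w₀ - (sMat p q).mulVec w₀ ≠ 0 := fun h => hne (sub_eq_zero.1 h).symm
        have h2 : w + (sMat p q).mulVec w ≠ 0 := fun h =>
          hwne (eq_neg_of_add_eq_zero_right h)
        obtain ⟨c, hcc⟩ := exists_real_scale (x := w + (sMat p q).mulVec w) h1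
        have h3 := isotropic_of_eigen (x := w + (sMat p q).mulVec w)
          (y := (c : ℂ) • (w₀ - (sMat p q).mulVec w₀)) (sMat_mulVec_plus w)
          (by rw [Matrix.mulVec_smul, sMat_mulVec_minus, smul_neg]) (by rw [nsq_smul, hcc])
        have h4 := hW _ (add_mem (add_mem hw (sMat_mulVec_mem_perp_hyp hw))
          (Submodule.smul_mem _ _ (sub_mem hw₀ (sMat_mulVec_mem_perp_hyp hw₀)))) h3
        have h5 := congrArg (sMat p q).mulVec h4
        rw [Matrix.mulVec_add, sMat_mulVec_plus, Matrix.mulVec_smul, sMat_mulVec_minus,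
          Matrix.mulVec_zero] at h5
        apply h2
        have h6 : (2 : ℂ) • (w + (sMat p q).mulVec w) = 0 := by
          rw [smul_neg] at h5
          rw [← add_zero (0 : Vec p q)]
          nth_rw 1 [← h4]
          rw [← h5]
          module
        exact (smul_eq_zero.1 h6).resolve_left two_ne_zero
      let φ : V →ₗ[ℂ] (Fin q → ℂ) := (LinearMap.funLeft ℂ ℂ Sum.inr).comp V.subtype
      have hφ : Function.Surjective φ := by
        intro z
        obtain ⟨y, hy, w, hw, y', hy', h⟩ := hrep (Sum.elim 0 z)
        refine ⟨⟨y + y', add_mem hy hy'⟩, ?_⟩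
        ext i
        have h1 := congrFun h (Sum.inr i)
        have h2 := congrFun (hc' w hw) (Sum.inr i)
        simp only [Sum.elim_inr, Pi.add_apply, Pi.neg_apply, sMat_mulVec_inr] at h1 h2
        simp only [φ, LinearMap.comp_apply, LinearMap.funLeft_apply, Submodule.subtype_apply,
          Pi.add_apply]
        linear_combination -h1 - h2 / 2
      have := LinearMap.finrank_le_finrank_of_surjective hφ
      simp only [Module.finrank_fin_fun] at this
      omega
  apply Submodule.finrank_eq_zero.1
  omega

end Subspaces

/-! ### Projections -/

section Projections

variable {p q : ℕ}

theorem proj_mulVec {V U : Submodule ℂ (Vec p q)} (h : IsCompl V U) (x : Vec p q) :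
    (proj V U).mulVec x = V.projection U h x := by
  rw [proj, dif_pos h, ← Matrix.toLin'_apply, Matrix.toLin'_toMatrix']

theorem proj_mulVec_mem {V U : Submodule ℂ (Vec p q)} (h : IsCompl V U) (x : Vec p q) :
    (proj V U).mulVec x ∈ V := by
  rw [proj_mulVec h]
  exact Submodule.projection_apply_mem h x

theorem proj_mulVec_of_mem {V U : Submodule ℂ (Vec p q)} (h : IsCompl V U) {x : Vec p q}
    (hx : x ∈ V) : (proj V U).mulVec x = x := by
  rw [proj_mulVec h]
  exact Submodule.projection_apply_of_mem_left h hx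

theorem proj_mulVec_eq_zero {V U : Submodule ℂ (Vec p q)} (h : IsCompl V U) {x : Vec p q}
    (hx : x ∈ U) : (proj V U).mulVec x = 0 := by
  rw [proj_mulVec h]
  exact (Submodule.projection_apply_eq_zero_iff h).2 hx

theorem exists_add_of_isCompl {V U : Submodule ℂ (Vec p q)} (h : IsCompl V U) (x : Vec p q) :
    ∃ v ∈ V, ∃ u ∈ U, v + u = x :=
  Submodule.mem_sup.1 (h.sup_eq_top ▸ Submodule.mem_top)

theorem proj_eq_of {V U : Submodule ℂ (Vec p q)} (h : IsCompl V U) {A : Mat p q}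
    (h1 : ∀ v ∈ V, A.mulVec v = v) (h2 : ∀ u ∈ U, A.mulVec u = 0) : proj V U = A := by
  refine Matrix.mulVec_injective (funext fun x => ?_)
  obtain ⟨v, hv, u, hu, rfl⟩ := exists_add_of_isCompl h x
  rw [Matrix.mulVec_add, Matrix.mulVec_add, proj_mulVec_of_mem h hv, proj_mulVec_eq_zero h hu,
    h1 v hv, h2 u hu]

theorem proj_symm {V U : Submodule ℂ (Vec p q)} (h : IsCompl V U) : proj U V = 1 - proj V U := by
  refine proj_eq_of h.symm (fun v hv => ?_) fun u hu => ?_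
  · rw [Matrix.sub_mulVec, Matrix.one_mulVec, proj_mulVec_eq_zero h hv, sub_zero]
  · rw [Matrix.sub_mulVec, Matrix.one_mulVec, proj_mulVec_of_mem h hu, sub_self]

theorem proj_mul_of_le {V U V' U' : Submodule ℂ (Vec p q)} (h : IsCompl V U)
    (h' : IsCompl V' U') (hle : V' ≤ V) : proj V U * proj V' U' = proj V' U' := by
  refine Matrix.mulVec_injective (funext fun x => ?_)
  rw [← Matrix.mulVec_mulVec, proj_mulVec_of_mem h (hle (proj_mulVec_mem h' x))]

theorem proj_mul_eq_zero {V U V' U' : Submodule ℂ (Vec p q)} (h : IsCompl V U)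
    (h' : IsCompl V' U') (hle : V' ≤ U) : proj V U * proj V' U' = 0 := by
  refine Matrix.mulVec_injective (funext fun x => ?_)
  rw [← Matrix.mulVec_mulVec, proj_mulVec_eq_zero h (hle (proj_mulVec_mem h' x)),
    Matrix.zero_mulVec]

theorem adj_proj {V U V' U' : Submodule ℂ (Vec p q)} (h : IsCompl V U) (h' : IsCompl V' U')
    (h1 : ∀ v ∈ V, ∀ u ∈ U', form v u = 0) (h2 : ∀ u ∈ U, ∀ v ∈ V', form u v = 0) :
    adj (proj V U) = proj V' U' := by
  refine adj_eq_of_form fun x y => ?_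
  obtain ⟨v, hv, u, hu, rfl⟩ := exists_add_of_isCompl h x
  obtain ⟨v', hv', u', hu', rfl⟩ := exists_add_of_isCompl h' y
  rw [Matrix.mulVec_add, Matrix.mulVec_add, proj_mulVec_of_mem h hv, proj_mulVec_eq_zero h hu,
    proj_mulVec_of_mem h' hv', proj_mulVec_eq_zero h' hu', add_zero, add_zero, form_add_left,
    form_add_right, h1 v hv u' hu', h2 u hu v' hv']

theorem isCompl_left_hyp {V : Submodule ℂ (Vec p q)} (hV : IsIsotropic V) :
    IsCompl V (perp (hyp V) ⊔ sMap V) := by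
  have h := isCompl_hyp hV
  refine ⟨?_, ?_⟩
  · rw [sup_comm]
    exact (disjoint_sMap hV).disjoint_sup_right_of_disjoint_sup_left h.disjoint
  · rw [codisjoint_iff, sup_comm (perp _), ← sup_assoc, h.sup_eq_top]

theorem isCompl_right_hyp {V : Submodule ℂ (Vec p q)} (hV : IsIsotropic V) :
    IsCompl (sMap V) (V ⊔ perp (hyp V)) := by
  have h := isCompl_hyp hV
  refine ⟨?_, ?_⟩
  · refine (disjoint_sMap hV).symm.disjoint_sup_right_of_disjoint_sup_left ?_
    rw [sup_comm]
    exact h.disjoint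
  · rw [codisjoint_iff, ← sup_assoc, sup_comm (sMap V), h.sup_eq_top]

theorem proj_middle {V : Submodule ℂ (Vec p q)} (hV : IsIsotropic V) :
    proj (perp (hyp V)) (hyp V) = 1 - proj V (perp (hyp V) ⊔ sMap V) -
      proj (sMap V) (V ⊔ perp (hyp V)) := by
  refine proj_eq_of (isCompl_hyp hV).symm (fun w hw => ?_) fun u hu => ?_
  · rw [Matrix.sub_mulVec, Matrix.sub_mulVec, Matrix.one_mulVec,
      proj_mulVec_eq_zero (isCompl_left_hyp hV) (Submodule.mem_sup_left hw),
      proj_mulVec_eq_zero (isCompl_right_hyp hV) (Submodule.mem_sup_right hw), sub_zero, sub_zero]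
  · obtain ⟨a, ha, b, hb, rfl⟩ := Submodule.mem_sup.1 hu
    rw [Matrix.sub_mulVec, Matrix.sub_mulVec, Matrix.one_mulVec, Matrix.mulVec_add,
      Matrix.mulVec_add, proj_mulVec_of_mem (isCompl_left_hyp hV) ha,
      proj_mulVec_eq_zero (isCompl_left_hyp hV) (Submodule.mem_sup_right hb),
      proj_mulVec_of_mem (isCompl_right_hyp hV) hb,
      proj_mulVec_eq_zero (isCompl_right_hyp hV) (Submodule.mem_sup_left ha)]
    abel

end Projections

/-! ### The simple elements are loops -/

section Membership

variable {p q : ℕ}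

theorem tendsto_conj_cofinite : Tendsto (fun l : ℂ => conj l) cofinite cofinite :=
  (star_injective : Function.Injective (star : ℂ → ℂ)).tendsto_cofinite

theorem exists_mem_negRealLoops {f : ℂ → Mat p q} (hm : IsMeromorphicOnSphere f)
    (hn : IsNegative f) (hr : ∀ᶠ l in cofinite, adj (f l) * f (conj l) = 1) :
    ∃ g ∈ negRealLoops p q, g ∈ loopsOf {f} := by
  have hr' : ∀ᶠ l in cofinite, adj (f (conj l)) * f l = 1 := by
    filter_upwards [tendsto_conj_cofinite.eventually hr] with l hl
    simpa using hl
  let g : Loop p q :=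
    { val := ((f : ℂ → Mat p q) : Germ (cofinite : Filter ℂ) (Mat p q))
      inv := ((fun l => adj (f (conj l)) : ℂ → Mat p q) : Germ (cofinite : Filter ℂ) (Mat p q))
      val_inv := by
        refine Germ.coe_eq.2 ?_
        filter_upwards [hr'] with l hl
        exact mul_eq_one_comm.1 hl
      inv_val := by
        refine Germ.coe_eq.2 ?_
        filter_upwards [hr'] with l hl
        exact hl }
  refine ⟨g, ⟨f, rfl, hm, hn, ?_⟩, f, rfl, rfl⟩
  filter_upwards [hr] with l hl
  exact Matrix.inv_eq_right_inv hl

/-- Each simple element is 1 plus at most two scalar functions, vanishing at ∞, times constant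
matrices. Only the reality identity differs between families. -/
theorem exists_mem_negRealLoops_of_sum {a b : ℂ → ℂ} {A B : Mat p q}
    (ha : ∀ z, MeromorphicAt a z) (hb : ∀ z, MeromorphicAt b z)
    (ha' : MeromorphicAt (fun w => a w⁻¹) 0) (hb' : MeromorphicAt (fun w => b w⁻¹) 0)
    (ha0 : Tendsto a (cocompact ℂ) (𝓝 0)) (hb0 : Tendsto b (cocompact ℂ) (𝓝 0))
    (hr : ∀ᶠ l in cofinite,
      adj (1 + a l • A + b l • B) * (1 + a (conj l) • A + b (conj l) • B) = 1) :
    ∃ g ∈ negRealLoops p q, g ∈ loopsOf {fun l => 1 + a l • A + b l • B} := by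
  refine exists_mem_negRealLoops ⟨fun z i j => ?_, fun i j => ?_⟩ ?_ hr
  · have h1 := ha z
    have h2 := hb z
    simp only [Matrix.add_apply, Matrix.smul_apply, smul_eq_mul]
    fun_prop
  · simp only [Matrix.add_apply, Matrix.smul_apply, smul_eq_mul]
    exact ((MeromorphicAt.const _ _).fun_add (ha'.fun_mul (MeromorphicAt.const _ _))).fun_add
      (hb'.fun_mul (MeromorphicAt.const _ _))
  · have h := ((tendsto_const_nhds (x := (1 : Mat p q))).add (ha0.smul_const A)).add
      (hb0.smul_const B)
    simpa [IsNegative] using h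

theorem tendsto_inv_sub_cocompact (β : ℂ) :
    Tendsto (fun l : ℂ => (l - β)⁻¹) (cocompact ℂ) (𝓝 0) := by
  have h1 : Tendsto (fun l : ℂ => l - β) (cocompact ℂ) (cocompact ℂ) :=
    (Homeomorph.subRight β).isClosedEmbedding.tendsto_cocompact
  have h2 := tendsto_inv₀_cobounded (α := ℂ)
  rw [Metric.cobounded_eq_cocompact] at h2
  exact h2.comp h1

theorem tendsto_div_sub_cocompact (α β : ℂ) :
    Tendsto (fun l : ℂ => (l - α) / (l - β) - 1) (cocompact ℂ) (𝓝 0) := by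
  have h : Tendsto (fun l : ℂ => (β - α) * (l - β)⁻¹) (cocompact ℂ) (𝓝 0) := by
    simpa using (tendsto_inv_sub_cocompact β).const_mul (β - α)
  refine h.congr' ?_
  have : ∀ᶠ l in cocompact ℂ, l ≠ β := by
    have := (isCompact_singleton (x := β)).compl_mem_cocompact
    filter_upwards [this] with l hl using hl
  filter_upwards [this] with l hl
  have : l - β ≠ 0 := sub_ne_zero.2 hl
  field_simp
  ring

theorem meromorphicAt_div_sub (α β z : ℂ) :
    MeromorphicAt (fun l : ℂ => (l - α) / (l - β) - 1) z := by fun_prop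

theorem meromorphicAt_div_sub_inv (α β : ℂ) :
    MeromorphicAt (fun w : ℂ => (w⁻¹ - α) / (w⁻¹ - β) - 1) 0 := by fun_prop

theorem eventually_ne_cofinite (α : ℂ) : ∀ᶠ l in cofinite, l ≠ α :=
  (Set.finite_singleton α).compl_mem_cofinite

theorem conj_sub_conj_ne_zero {l α : ℂ} (h : l ≠ α) : conj l - conj α ≠ 0 :=
  sub_ne_zero.2 fun hh => h ((starRingEnd ℂ).injective hh)

theorem pElt_eq {α : ℂ} {V : Submodule ℂ (Vec p q)} (h : IsCompl V (perp V)) (l : ℂ) :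
    pElt α V l = 1 + ((l - α) / (l - conj α) - 1) • proj V (perp V) := by
  rw [pElt, proj_symm h]
  module

theorem adj_proj_perp {V : Submodule ℂ (Vec p q)} (h : IsCompl V (perp V)) :
    adj (proj V (perp V)) = proj V (perp V) :=
  adj_proj h h (fun v hv _ hu => hu v hv) fun _ hu v hv => form_eq_zero_symm (hu v hv)

theorem exists_mem_of_pFamily {f : ℂ → Mat p q} (hf : f ∈ pFamily p q) :
    ∃ g ∈ negRealLoops p q, g ∈ loopsOf {f} := by
  obtain ⟨α, V, -, hc, rfl⟩ := hf
  have hP := proj_mul_of_le hc hc le_rfl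
  have h := exists_mem_negRealLoops_of_sum (a := fun l => (l - α) / (l - conj α) - 1)
    (b := fun _ => 0) (A := proj V (perp V)) (B := 0) (fun z => meromorphicAt_div_sub _ _ z)
    (fun z => MeromorphicAt.const _ z) (meromorphicAt_div_sub_inv _ _)
    (MeromorphicAt.const _ _) (tendsto_div_sub_cocompact _ _) tendsto_const_nhds ?_
  · have e : pElt α V = fun l => 1 + ((l - α) / (l - conj α) - 1) • proj V (perp V) +
        (0 : ℂ) • (0 : Mat p q) := by
      funext l
      rw [pElt_eq hc, smul_zero, add_zero]
    rw [e]
    exact h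
  · filter_upwards [eventually_ne_cofinite α, eventually_ne_cofinite (conj α)] with l h1 h2
    have h3 := conj_sub_conj_ne_zero h1
    have h4 := conj_sub_conj_ne_zero h2
    rw [Complex.conj_conj] at h4
    simp only [smul_zero, add_zero]
    rw [adj_add, adj_one, adj_smul, adj_proj_perp hc]
    simp only [add_mul, mul_add, one_mul, mul_one, smul_mul_smul_comm, hP, map_sub, map_div₀,
      Complex.conj_conj, map_one]
    have : (conj l - conj α) / (conj l - α) * ((conj l - α) / (conj l - conj α)) = 1 := by
      field_simp
    match_scalars
    · ring
    · linear_combination this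

theorem qElt_eq {α β : ℂ} {V : Submodule ℂ (Vec p q)} (hV : IsIsotropic V) (l : ℂ) :
    qElt α β V l = 1 + ((l - α) / (l - β) - 1) • proj V (perp (hyp V) ⊔ sMap V) +
      ((l - conj β) / (l - conj α) - 1) • proj (sMap V) (V ⊔ perp (hyp V)) := by
  rw [qElt, proj_middle hV]
  module

theorem adj_proj_left_hyp {V : Submodule ℂ (Vec p q)} (hV : IsIsotropic V) :
    adj (proj V (perp (hyp V) ⊔ sMap V)) = proj (sMap V) (V ⊔ perp (hyp V)) := by
  refine adj_proj (isCompl_left_hyp hV) (isCompl_right_hyp hV) (fun v hv u hu => ?_)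
    fun u hu v hv => ?_
  · obtain ⟨a, ha, b, hb, rfl⟩ := Submodule.mem_sup.1 hu
    rw [form_add_right, hV v hv a ha, hb v (Submodule.mem_sup_left hv), add_zero]
  · obtain ⟨a, ha, b, hb, rfl⟩ := Submodule.mem_sup.1 hu
    rw [form_add_left, isIsotropic_sMap hV b hb v hv,
      form_eq_zero_symm (ha v (Submodule.mem_sup_right hv)), add_zero]

theorem exists_mem_of_qFamily {f : ℂ → Mat p q} (hf : f ∈ qFamily p q) :
    ∃ g ∈ negRealLoops p q, g ∈ loopsOf {f} := by
  obtain ⟨α, β, V, -, hV, -, rfl⟩ := hf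
  have c1 := isCompl_left_hyp hV
  have c2 := isCompl_right_hyp hV
  have e1 := adj_proj_left_hyp hV
  have e2 : adj (proj (sMap V) (V ⊔ perp (hyp V))) = proj V (perp (hyp V) ⊔ sMap V) := by
    rw [← e1, adj_adj]
  have m11 := proj_mul_of_le c1 c1 le_rfl
  have m22 := proj_mul_of_le c2 c2 le_rfl
  have m12 := proj_mul_eq_zero c1 c2 le_sup_right
  have m21 := proj_mul_eq_zero c2 c1 le_sup_left
  have h := exists_mem_negRealLoops_of_sum (a := fun l => (l - α) / (l - β) - 1)
    (b := fun l => (l - conj β) / (l - conj α) - 1) (A := proj V (perp (hyp V) ⊔ sMap V))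
    (B := proj (sMap V) (V ⊔ perp (hyp V))) (fun z => meromorphicAt_div_sub _ _ z)
    (fun z => meromorphicAt_div_sub _ _ z) (meromorphicAt_div_sub_inv _ _)
    (meromorphicAt_div_sub_inv _ _) (tendsto_div_sub_cocompact _ _)
    (tendsto_div_sub_cocompact _ _) ?_
  · rw [show qElt α β V = _ from funext fun l => qElt_eq hV l]
    exact h
  · filter_upwards [eventually_ne_cofinite α, eventually_ne_cofinite β,
      eventually_ne_cofinite (conj α), eventually_ne_cofinite (conj β)] with l h1 h2 h3 h4
    have k1 := conj_sub_conj_ne_zero h1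
    have k2 := conj_sub_conj_ne_zero h2
    have k3 := conj_sub_conj_ne_zero h3
    have k4 := conj_sub_conj_ne_zero h4
    rw [Complex.conj_conj] at k3 k4
    rw [adj_add, adj_add, adj_one, adj_smul, adj_smul, e1, e2]
    simp only [add_mul, mul_add, one_mul, mul_one, smul_mul_smul_comm, m11, m12, m21, m22, map_sub,
      map_div₀, Complex.conj_conj, map_one, smul_zero]
    have t1 : (conj l - conj α) / (conj l - conj β) *
        ((conj l - conj β) / (conj l - conj α)) = 1 := by
      field_simp
    have t2 : (conj l - β) / (conj l - α) * ((conj l - α) / (conj l - β)) = 1 := by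
      field_simp
    match_scalars
    · ring
    · linear_combination t1
    · linear_combination t2

theorem tendsto_pow_cocompact (α : ℂ) {k : ℕ} (hk : k ≠ 0) :
    Tendsto (fun l : ℂ => (1 / (l - α)) ^ k) (cocompact ℂ) (𝓝 0) := by
  simpa [hk] using (tendsto_inv_sub_cocompact α).pow k

theorem meromorphicAt_pow (α : ℂ) (k : ℕ) (z : ℂ) :
    MeromorphicAt (fun l : ℂ => (1 / (l - α)) ^ k) z := by fun_prop

theorem meromorphicAt_pow_inv (α : ℂ) (k : ℕ) :
    MeromorphicAt (fun w : ℂ => (1 / (w⁻¹ - α)) ^ k) 0 := by fun_prop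

/-- For N³ = 0 the element is exp(tN) with t = (λ - α)^{-k}. As α is real, conjugating λ conjugates
t, and N^* = -N turns the adjoint into the inverse. The case N² = 0 covers `mElt`. -/
theorem exists_mem_of_nElt {α : ℝ} {k : ℕ} {N : Mat p q} (hk : 1 ≤ k) (hN : N ^ 3 = 0)
    (ha : adj N = -N) : ∃ g ∈ negRealLoops p q, g ∈ loopsOf {nElt α k N} := by
  have ha2 : adj (N ^ 2) = N ^ 2 := by rw [pow_two, adj_mul, ha, neg_mul_neg]
  have h := exists_mem_negRealLoops_of_sum (a := fun l => (1 / (l - (α : ℂ))) ^ k)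
    (b := fun l => (1 / 2 : ℂ) * (1 / (l - (α : ℂ))) ^ (2 * k)) (A := N) (B := N ^ 2)
    (fun z => meromorphicAt_pow _ _ z)
    (fun z => by fun_prop) (meromorphicAt_pow_inv _ _)
    (by fun_prop) (tendsto_pow_cocompact _ (by omega))
    (by simpa only [mul_zero] using
      (tendsto_pow_cocompact (α : ℂ) (k := 2 * k) (by omega)).const_mul (1 / 2 : ℂ)) ?_
  · exact h
  · refine Eventually.of_forall fun l => ?_
    have h3 : N ^ 2 * N = 0 := by rw [← pow_succ, hN]
    have h3' : N * N ^ 2 = 0 := by rw [← pow_succ', hN]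
    have h4 : N ^ 2 * N ^ 2 = 0 := by rw [← pow_add, show 2 + 2 = 3 + 1 from rfl, pow_succ, hN,
      zero_mul]
    rw [adj_add, adj_add, adj_one, adj_smul, adj_smul, ha, ha2]
    simp only [add_mul, mul_add, one_mul, mul_one, smul_mul_smul_comm, neg_mul, h3, h3', h4,
      smul_zero, neg_zero, map_mul, map_pow, map_div₀, map_sub, map_one, map_ofNat,
      Complex.conj_ofReal, smul_neg, ← pow_two N]
    have : (1 / (conj l - (α : ℂ))) ^ (2 * k) =
        (1 / (conj l - (α : ℂ))) ^ k * (1 / (conj l - (α : ℂ))) ^ k := by rw [two_mul, pow_add]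
    match_scalars
    · ring
    · ring
    · linear_combination this

theorem nElt_eq_mElt {α : ℝ} {k : ℕ} {N : Mat p q} (hN : N ^ 2 = 0) :
    nElt α k N = mElt α k N := by
  ext1 l
  rw [nElt, mElt, hN, smul_zero, add_zero]

theorem exists_mem_of_mFamily {α : ℝ} {f : ℂ → Mat p q} (hf : f ∈ mFamily p q α) :
    ∃ g ∈ negRealLoops p q, g ∈ loopsOf {f} := by
  obtain ⟨k, N, hk, hN, ha, rfl⟩ := hf
  rw [← nElt_eq_mElt hN]
  exact exists_mem_of_nElt hk (by rw [pow_succ, hN, zero_mul]) ha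

theorem exists_mem_of_nFamily {α : ℝ} {f : ℂ → Mat p q} (hf : f ∈ nFamily p q α) :
    ∃ g ∈ negRealLoops p q, g ∈ loopsOf {f} := by
  obtain ⟨k, V, M, hk, hV, h0, hM, rfl⟩ := hf
  have hc := isCompl_hyp hV.1
  have hr : ∀ x, M.mulVec x ∈ V := by
    intro x
    obtain ⟨v, hv, u, hu, rfl⟩ := exists_add_of_isCompl hc x
    rw [Matrix.mulVec_add, h0 v hv, zero_add]
    exact hM u hu
  have hMM : M * M = 0 := by
    refine Matrix.mulVec_injective (funext fun x => ?_)
    rw [← Matrix.mulVec_mulVec, h0 _ (Submodule.mem_sup_left (hr x)), Matrix.zero_mulVec]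
  have hAA : adj M * adj M = 0 := by rw [← adj_mul, hMM]; simp [adj]
  -- M takes values in the isotropic V, so ⟨Mw, Mx⟩ = 0. With M² = 0 this gives N² = -MM^* and N³ =
  -- 0.
  have hAM : adj M * M = 0 := by
    refine Matrix.mulVec_injective (funext fun x => ?_)
    rw [← Matrix.mulVec_mulVec, Matrix.zero_mulVec]
    refine nondegenerate_form fun w => ?_
    rw [form_adj, hV.1 _ (hr w) _ (hr x)]
  refine exists_mem_of_nElt hk ?_ (by rw [adj_sub, adj_adj, neg_sub])
  rw [pow_succ, pow_two]
  simp only [mul_sub, sub_mul, hMM, hAA, hAM, mul_assoc, mul_zero, sub_zero]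
  simp

end Membership

open scoped Polynomial
open Polynomial (C X eval)

/-! ### Polynomial vectors and matrices -/

/-- Matrices over `ℂ[X]`. -/
abbrev PMat (p q : ℕ) : Type := Matrix (Fin p ⊕ Fin q) (Fin p ⊕ Fin q) ℂ[X]

/-- Vectors over `ℂ[X]`. -/
abbrev PVec (p q : ℕ) : Type := Fin p ⊕ Fin q → ℂ[X]

/-- Conjugation of the coefficients. -/
noncomputable def pconj : ℂ[X] →+* ℂ[X] := Polynomial.mapRingHom (starRingEnd ℂ)

@[simp] theorem pconj_C (c : ℂ) : pconj (C c) = C (conj c) := by simp [pconj]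

@[simp] theorem pconj_X : pconj X = X := by simp [pconj]

@[simp] theorem coeff_pconj (f : ℂ[X]) (n : ℕ) : (pconj f).coeff n = conj (f.coeff n) := by
  simp [pconj]

@[simp] theorem pconj_pconj (f : ℂ[X]) : pconj (pconj f) = f := by
  ext n; simp

theorem eval_pconj (z : ℂ) (f : ℂ[X]) : eval z (pconj f) = conj (eval (conj z) f) := by
  induction f using Polynomial.induction_on' with
  | add f g hf hg => simp [hf, hg]
  | monomial n a => simp [pconj]

@[simp] theorem natDegree_pconj (f : ℂ[X]) : (pconj f).natDegree = f.natDegree :=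
  Polynomial.natDegree_map_eq_of_injective (starRingEnd ℂ).injective f

theorem pconj_ne_zero {f : ℂ[X]} (h : f ≠ 0) : pconj f ≠ 0 := fun h0 => h <| by
  rw [← pconj_pconj f, h0, map_zero]

section

variable {p q : ℕ}

/-- The extension of `form` to polynomial vectors. -/
noncomputable def pform (v w : PVec p q) : ℂ[X] :=
  -(∑ i : Fin p, pconj (v (Sum.inl i)) * w (Sum.inl i)) +
    ∑ j : Fin q, pconj (v (Sum.inr j)) * w (Sum.inr j)

theorem pform_add_left (u v w : PVec p q) : pform (u + v) w = pform u w + pform v w := by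
  simp only [pform, Pi.add_apply, map_add, add_mul, Finset.sum_add_distrib]; ring

theorem pform_add_right (u v w : PVec p q) : pform u (v + w) = pform u v + pform u w := by
  simp only [pform, Pi.add_apply, mul_add, Finset.sum_add_distrib]; ring

theorem pform_smul_left (c : ℂ[X]) (v w : PVec p q) :
    pform (c • v) w = pconj c * pform v w := by
  simp only [pform, Pi.smul_apply, smul_eq_mul, map_mul, mul_assoc, ← Finset.mul_sum]; ring

theorem pform_smul_right (c : ℂ[X]) (v w : PVec p q) : pform v (c • w) = c * pform v w := by
  simp only [pform, Pi.smul_apply, smul_eq_mul, mul_left_comm _ c, ← Finset.mul_sum]; ring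

theorem pconj_pform (v w : PVec p q) : pconj (pform v w) = pform w v := by
  simp [pform, mul_comm]

@[simp] theorem pform_zero_left (v : PVec p q) : pform 0 v = 0 := by simp [pform]

@[simp] theorem pform_zero_right (v : PVec p q) : pform v 0 = 0 := by simp [pform]

theorem pform_neg_left (v w : PVec p q) : pform (-v) w = -pform v w := by
  simpa using pform_smul_left (-1) v w

theorem pform_neg_right (v w : PVec p q) : pform v (-w) = -pform v w := by
  simpa using pform_smul_right (-1) v w

theorem pform_sub_right (u v w : PVec p q) : pform u (v - w) = pform u v - pform u w := by
  rw [sub_eq_add_neg, pform_add_right, pform_neg_right, ← sub_eq_add_neg]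

theorem pform_eq_zero_symm {v w : PVec p q} (h : pform v w = 0) : pform w v = 0 := by
  rw [← pconj_pform, h, map_zero]

/-- The constant polynomial vector. -/
noncomputable def cv (v : Vec p q) : PVec p q := fun i => C (v i)

/-- The constant polynomial matrix. -/
noncomputable def cm (A : Mat p q) : PMat p q := A.map C

theorem cv_add (v w : Vec p q) : cv (v + w) = cv v + cv w := by ext1 i; simp [cv]

theorem cv_sub (v w : Vec p q) : cv (v - w) = cv v - cv w := by ext1 i; simp [cv]

theorem cv_smul (c : ℂ) (v : Vec p q) : cv (c • v) = C c • cv v := by ext1 i; simp [cv]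

@[simp] theorem cv_zero : cv (0 : Vec p q) = 0 := by ext1 i; simp [cv]

theorem pform_cv_cv (v w : Vec p q) : pform (cv v) (cv w) = C (form v w) := by
  simp [pform, form, cv]

theorem cm_mulVec_cv (A : Mat p q) (v : Vec p q) : (cm A).mulVec (cv v) = cv (A.mulVec v) := by
  ext1 i; simp [cm, cv, Matrix.mulVec, dotProduct]

theorem cm_mul (A B : Mat p q) : cm (A * B) = cm A * cm B := Matrix.map_mul

theorem cm_one : cm (1 : Mat p q) = 1 := Matrix.map_one _ (map_zero C) (map_one C)

theorem cm_sub (A B : Mat p q) : cm (A - B) = cm A - cm B := by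
  ext1 i j; simp [cm]

theorem cm_zero : cm (0 : Mat p q) = 0 := by ext1 i j; simp [cm]

/-- Evaluation of a polynomial vector. -/
noncomputable def evv (z : ℂ) (v : PVec p q) : Vec p q := fun i => eval z (v i)

/-- Evaluation of a polynomial matrix. -/
noncomputable def evm (z : ℂ) (P : PMat p q) : Mat p q := P.map (eval z)

@[simp] theorem evv_cv (z : ℂ) (v : Vec p q) : evv z (cv v) = v := by ext i; simp [evv, cv]

@[simp] theorem evm_cm (z : ℂ) (A : Mat p q) : evm z (cm A) = A := by ext i j; simp [evm, cm]

theorem evv_smul (z : ℂ) (c : ℂ[X]) (v : PVec p q) : evv z (c • v) = eval z c • evv z v := by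
  ext i; simp [evv]

theorem evv_add (z : ℂ) (v w : PVec p q) : evv z (v + w) = evv z v + evv z w := by
  ext i; simp [evv]

theorem evv_mulVec (z : ℂ) (P : PMat p q) (v : PVec p q) :
    evv z (P.mulVec v) = (evm z P).mulVec (evv z v) := by
  ext i; simp [evv, evm, Matrix.mulVec, dotProduct, Polynomial.eval_finsetSum]

theorem evm_mul (z : ℂ) (P Q : PMat p q) : evm z (P * Q) = evm z P * evm z Q :=
  (Polynomial.evalRingHom z).mapMatrix.map_mul P Q

@[simp] theorem evm_one (z : ℂ) : evm z (1 : PMat p q) = 1 :=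
  (Polynomial.evalRingHom z).mapMatrix.map_one

theorem evm_smul (z : ℂ) (c : ℂ[X]) (P : PMat p q) : evm z (c • P) = eval z c • evm z P := by
  ext i j; simp [evm]

theorem evm_add (z : ℂ) (P Q : PMat p q) : evm z (P + Q) = evm z P + evm z Q := by
  ext i j; simp [evm]

theorem eval_pform (z : ℂ) (v w : PVec p q) :
    eval z (pform v w) = form (evv (conj z) v) (evv z w) := by
  simp [pform, form, evv, Polynomial.eval_finsetSum, eval_pconj]

theorem PMat.ext_cv {P Q : PMat p q} (h : ∀ v, P.mulVec (cv v) = Q.mulVec (cv v)) : P = Q := by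
  ext1 i j
  have h1 : cv (Pi.single j 1 : Vec p q) = Pi.single j 1 := by
    ext1 k
    by_cases hk : k = j <;> simp [cv, hk]
  have := congrFun (h (Pi.single j 1)) i
  rw [h1] at this
  simpa using this

theorem pform_cm_left (A : Mat p q) (v w : PVec p q) :
    pform ((cm A).mulVec v) w = pform v ((cm (adj A)).mulVec w) := by
  refine Polynomial.funext fun z => ?_
  rw [eval_pform, eval_pform, evv_mulVec, evv_mulVec, evm_cm, evm_cm, form_adj]

/-! ### Loops given by polynomial matrices in `1 / (λ - α)` -/

/-- The loop `P(z) / d(z)`, `z = 1 / (λ - α)`. -/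
noncomputable def pairFun (α : ℝ) (P : PMat p q) (d : ℂ[X]) (l : ℂ) : Mat p q :=
  (eval (l - α)⁻¹ d)⁻¹ • evm (l - α)⁻¹ P

/-- The loop `P / d` belongs to `Γ`. -/
def Good (Γ : Submonoid (Loop p q)) (α : ℝ) (P : PMat p q) (d : ℂ[X]) : Prop :=
  ∃ g ∈ Γ, (g : Germ (cofinite : Filter ℂ) (Mat p q)) = (pairFun α P d : Germ _ _)

theorem eventually_eval_ne_zero (α : ℝ) {f : ℂ[X]} (hf : f ≠ 0) :
    ∀ᶠ l : ℂ in cofinite, eval (l - α)⁻¹ f ≠ 0 := by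
  have hi : Function.Injective fun l : ℂ => (l - α)⁻¹ := fun a b h => by
    simpa using h
  have hfin : {z | Polynomial.IsRoot f z}.Finite := Polynomial.finite_setOfPred_isRoot hf
  exact hi.tendsto_cofinite.eventually hfin.compl_mem_cofinite

theorem poly_eq_of_eventually (α : ℝ) {f g : ℂ[X]}
    (h : ∀ᶠ l : ℂ in cofinite, eval (l - α)⁻¹ f = eval (l - α)⁻¹ g) : f = g := by
  by_contra hne
  obtain ⟨l, h1, h2⟩ := (h.and (eventually_eval_ne_zero α (sub_ne_zero.2 hne))).exists
  simp [h1] at h2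

theorem Good.one (Γ : Submonoid (Loop p q)) (α : ℝ) : Good Γ α 1 1 := by
  refine ⟨1, Γ.one_mem, ?_⟩
  refine Germ.coe_eq.2 (Eventually.of_forall fun l => ?_)
  simp [pairFun]

theorem Good.mul {Γ : Submonoid (Loop p q)} {α : ℝ} {P Q : PMat p q} {d e : ℂ[X]}
    (h1 : Good Γ α P d) (h2 : Good Γ α Q e) : Good Γ α (P * Q) (d * e) := by
  obtain ⟨g, hg, hge⟩ := h1
  obtain ⟨h, hh, hhe⟩ := h2
  refine ⟨g * h, Γ.mul_mem hg hh, ?_⟩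
  rw [Units.val_mul, hge, hhe]
  refine Germ.coe_eq.2 (Eventually.of_forall fun l => ?_)
  simp [pairFun, evm_mul, smul_smul, mul_comm]

theorem Good.cancel {Γ : Submonoid (Loop p q)} {α : ℝ} {P : PMat p q} {d r : ℂ[X]} (hr : r ≠ 0)
    (h : Good Γ α (r • P) (r * d)) : Good Γ α P d := by
  obtain ⟨g, hg, hge⟩ := h
  refine ⟨g, hg, hge.trans (Germ.coe_eq.2 ?_)⟩
  filter_upwards [eventually_eval_ne_zero α hr] with l hl
  rw [pairFun, pairFun, evm_smul, smul_smul, Polynomial.eval_mul, mul_inv]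
  rw [mul_right_comm, inv_mul_cancel₀ hl, one_mul]

theorem Good.scale {Γ : Submonoid (Loop p q)} {α : ℝ} {P : PMat p q} {d r : ℂ[X]} (hr : r ≠ 0)
    (h : Good Γ α P d) : Good Γ α (r • P) (r * d) := by
  obtain ⟨g, hg, hge⟩ := h
  refine ⟨g, hg, hge.trans (Germ.coe_eq.2 ?_)⟩
  filter_upwards [eventually_eval_ne_zero α hr] with l hl
  rw [pairFun, pairFun, evm_smul, smul_smul, Polynomial.eval_mul, mul_inv]
  rw [mul_right_comm, inv_mul_cancel₀ hl, one_mul]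

/-- A'/δ' is the inverse of A/δ, so multiplying by it is undone by A/δ ∈ Γ. Since A'/δ' itself need
not lie in Γ, reductions work inside a submonoid, as the one-point statements require. -/
theorem Good.of_mul {Γ : Submonoid (Loop p q)} {α : ℝ} {A A' P : PMat p q} {d δ δ' : ℂ[X]}
    (hA : Good Γ α A δ) (hAA : A * A' = (δ * δ') • 1) (h0 : δ * δ' ≠ 0)
    (h : Good Γ α (A' * P) (δ' * d)) : Good Γ α P d := by
  have h1 := hA.mul h
  rw [← mul_assoc, hAA, ← mul_assoc, smul_mul_assoc, one_mul] at h1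
  exact h1.cancel h0

/-- `P / d` is unitary. -/
def IsUnitaryPair (P : PMat p q) (d : ℂ[X]) : Prop :=
  ∀ v w, pform (P.mulVec v) (P.mulVec w) = pconj d * d * pform v w

theorem IsUnitaryPair.mul {P Q : PMat p q} {d e : ℂ[X]} (h1 : IsUnitaryPair P d)
    (h2 : IsUnitaryPair Q e) : IsUnitaryPair (P * Q) (d * e) := by
  intro v w
  rw [← Matrix.mulVec_mulVec, ← Matrix.mulVec_mulVec, h1, h2, map_mul]
  ring

/-- Since α is real, conjugating λ conjugates z. The reality condition then gives the identity for
all but finitely many z, hence as an identity of polynomials. -/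
theorem IsUnitaryPair.of_loop {α : ℝ} {P : PMat p q} {d : ℂ[X]} (hd : d ≠ 0) {g : Loop p q}
    (hg : g ∈ negRealLoops p q)
    (he : (g : Germ (cofinite : Filter ℂ) (Mat p q)) = (pairFun α P d : Germ _ _)) :
    IsUnitaryPair P d := by
  obtain ⟨f, hf, -, -, hr⟩ := hg
  have h1 : ∀ᶠ l in cofinite, f l = pairFun α P d l := Germ.coe_eq.1 (hf.symm.trans he)
  -- A unit in the ring of germs is invertible at all but finitely many points.
  have h2 : ∀ᶠ l in cofinite, IsUnit (f l) := by
    have h1 : (g : Germ (cofinite : Filter ℂ) (Mat p q)) * (g⁻¹ : Loop p q) = 1 := g.mul_inv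
    rw [hf] at h1
    revert h1
    generalize ((g⁻¹ : Loop p q) : Germ (cofinite : Filter ℂ) (Mat p q)) = b
    induction b using Germ.inductionOn with
    | _ b =>
      intro h1
      have h2 : ∀ᶠ l in (cofinite : Filter ℂ), f l * b l = 1 := Germ.coe_eq.1 h1
      filter_upwards [h2] with l hl
      exact IsUnit.of_mul_eq_one _ hl
  have h3 := eventually_eval_ne_zero α hd
  intro v w
  have key : ∀ᶠ l : ℂ in cofinite, eval (conj l - α)⁻¹ (pform (P.mulVec v) (P.mulVec w)) =
      eval (conj l - α)⁻¹ (pconj d * d * pform v w) := by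
    filter_upwards [h1, tendsto_conj_cofinite.eventually h1, h2, h3,
      tendsto_conj_cofinite.eventually h3, hr] with l e1 e2 e3 e4 e5 e6
    obtain ⟨u, hu⟩ := e3
    -- `tau` uses the total matrix inverse, so invertibility of f(l) is what turns the condition
    -- into a product.
    have e7 : adj (f l) * f (conj l) = 1 := by
      rw [← e6, tau, Matrix.mul_nonsing_inv]
      rw [← Matrix.isUnit_iff_isUnit_det]
      refine IsUnit.of_mul_eq_one (adj (f l)⁻¹) ?_
      rw [← adj_mul, Matrix.nonsing_inv_mul _ ((Matrix.isUnit_iff_isUnit_det _).1 ⟨u, hu⟩), adj_one]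
    rw [e1, e2, pairFun, pairFun, adj_smul, smul_mul_smul_comm] at e7
    have hz : conj ((conj l - (α : ℂ))⁻¹) = (l - α)⁻¹ := by simp
    set z := (conj l - (α : ℂ))⁻¹
    set w' := (l - (α : ℂ))⁻¹
    have e8 : adj (evm w' P) * evm z P = (conj (eval w' d) * eval z d) • 1 := by
      rw [← e7, smul_smul, map_inv₀]
      rw [show conj (eval w' d) * eval z d * ((conj (eval w' d))⁻¹ * (eval z d)⁻¹) = 1 by
        have : conj (eval w' d) ≠ 0 := (map_ne_zero _).2 e4
        field_simp, one_smul]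
    rw [eval_pform, evv_mulVec, evv_mulVec, hz, ← form_adj, Matrix.mulVec_mulVec, e8,
      Matrix.smul_mulVec, Matrix.one_mulVec, form_smul_right, Polynomial.eval_mul,
      Polynomial.eval_mul, eval_pform, eval_pconj, hz]
  refine poly_eq_of_eventually α ?_
  filter_upwards [tendsto_conj_cofinite.eventually key] with l hl
  simpa using hl

theorem evm_zero_of_loop {α : ℝ} {P : PMat p q} {d : ℂ[X]} (hd : d.eval 0 = 1) {g : Loop p q}
    (hg : g ∈ negRealLoops p q)
    (he : (g : Germ (cofinite : Filter ℂ) (Mat p q)) = (pairFun α P d : Germ _ _)) :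
    evm 0 P = 1 := by
  obtain ⟨f, hf, -, hn, -⟩ := hg
  have h1 : ∀ᶠ l in cofinite, f l = pairFun α P d l := Germ.coe_eq.1 (hf.symm.trans he)
  have h2 : Tendsto (pairFun α P d) (cocompact ℂ) (𝓝 1) :=
    (show Tendsto f _ _ from hn).congr' (h1.filter_mono cocompact_le_cofinite)
  have hz := tendsto_inv_sub_cocompact (α : ℂ)
  have h3 : Tendsto (pairFun α P d) (cocompact ℂ) (𝓝 ((eval 0 d)⁻¹ • evm 0 P)) := by
    refine Tendsto.smul ?_ ?_
    · exact ((d.continuous.tendsto 0).comp hz).inv₀ (by rw [hd]; exact one_ne_zero)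
    · refine tendsto_pi_nhds.2 fun i => tendsto_pi_nhds.2 fun j => ?_
      exact ((P i j).continuous.tendsto 0).comp hz
  have h4 := tendsto_nhds_unique h2 h3
  rw [hd, inv_one, one_smul] at h4
  exact h4.symm

theorem Good.isUnitaryPair {Γ : Submonoid (Loop p q)} (hΓ : Γ ≤ (negRealLoops p q).toSubmonoid)
    {α : ℝ} {P : PMat p q} {d : ℂ[X]} (hd : d ≠ 0) (h : Good Γ α P d) : IsUnitaryPair P d :=
  let ⟨_, hg, e⟩ := h
  IsUnitaryPair.of_loop hd (hΓ hg) e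

theorem Good.evm_zero {Γ : Submonoid (Loop p q)} (hΓ : Γ ≤ (negRealLoops p q).toSubmonoid)
    {α : ℝ} {P : PMat p q} {d : ℂ[X]} (hd : d.eval 0 = 1) (h : Good Γ α P d) : evm 0 P = 1 :=
  let ⟨_, hg, e⟩ := h
  evm_zero_of_loop hd (hΓ hg) e

end

/-! ### Transvections -/

section Transvections

variable {p q : ℕ}

/-- The rank one operator `v ↦ ⟨b, v⟩ a` on polynomial vectors. -/
noncomputable def prank (a b : PVec p q) : PMat p q :=
  Matrix.vecMulVec a
    (Sum.elim (fun i => -pconj (b (Sum.inl i))) fun j => pconj (b (Sum.inr j)))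

theorem prank_mulVec (a b v : PVec p q) : (prank a b).mulVec v = pform b v • a := by
  ext1 i
  rw [prank, Matrix.vecMulVec_mulVec]
  simp [pform, dotProduct, mul_comm]

theorem prank_cv_cv (a b : Vec p q) : prank (cv a) (cv b) = cm (rankOne a b) := by
  refine PMat.ext_cv fun v => ?_
  rw [prank_mulVec, cm_mulVec_cv, rankOne_mulVec, pform_cv_cv, cv_smul]

/-- The transvection `v ↦ v + ⟨x, v⟩ e - ⟨e, v⟩ x + (c - ⟨x, x⟩ / 2) ⟨e, v⟩ e`. -/
noncomputable def transv (e x : PVec p q) (c : ℂ[X]) : PMat p q :=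
  1 + prank e x - prank x e + (c - C (1 / 2) * pform x x) • prank e e

theorem transv_mulVec (e x : PVec p q) (c : ℂ[X]) (v : PVec p q) :
    (transv e x c).mulVec v = v + pform x v • e - pform e v • x +
      ((c - C (1 / 2) * pform x x) * pform e v) • e := by
  rw [transv, Matrix.add_mulVec, Matrix.sub_mulVec, Matrix.add_mulVec, Matrix.one_mulVec,
    Matrix.smul_mulVec, prank_mulVec, prank_mulVec, prank_mulVec, smul_smul]

theorem C_half_add : (C (1 / 2) : ℂ[X]) + C (1 / 2) = 1 := by
  rw [← map_add, add_halves, map_one]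

/-- The Heisenberg group law. The cocycle is skew under `pconj`, so it is absorbed by a central
factor `transv e 0 c` with skew c. -/
theorem transv_mul_transv {e x y : PVec p q} (he : pform e e = 0) (hx : pform e x = 0)
    (hy : pform e y = 0) (c d : ℂ[X]) : transv e x c * transv e y d =
      transv e (x + y) (c + d + C (1 / 2) * (pform y x - pform x y)) := by
  refine Matrix.mulVec_injective (funext fun v => ?_)
  have hx' := pform_eq_zero_symm hx
  rw [← Matrix.mulVec_mulVec]
  simp only [transv_mulVec, pform_add_right, pform_add_left, pform_sub_right, pform_smul_right,
    he, hy, hx', mul_zero, add_zero, sub_zero]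
  have := C_half_add
  match_scalars
  · ring
  · linear_combination (pform x y * pform e v) * this
  · ring
  · ring

@[simp] theorem transv_zero_zero (e : PVec p q) : transv e 0 0 = 1 := by
  refine Matrix.mulVec_injective (funext fun v => ?_)
  simp [transv_mulVec]

theorem transv_mul_transv_neg {e x : PVec p q} (he : pform e e = 0) (hx : pform e x = 0)
    (c : ℂ[X]) : transv e x c * transv e (-x) (-c) = 1 := by
  rw [transv_mul_transv he hx (by rw [pform_neg_right, hx, neg_zero]), add_neg_cancel,
    add_neg_cancel, pform_neg_left, pform_neg_right, sub_self, mul_zero, add_zero,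
    transv_zero_zero]

/-- The vector of the `n`-th coefficients. -/
def pcoeff (v : PVec p q) (n : ℕ) : Vec p q := fun i => (v i).coeff n

theorem coeff_pform_cv (f : Vec p q) (v : PVec p q) (n : ℕ) :
    (pform (cv f) v).coeff n = form f (pcoeff v n) := by
  simp [pform, form, cv, pcoeff, Polynomial.finsetSum_coeff]

theorem evv_zero_eq_pcoeff (v : PVec p q) : evv 0 v = pcoeff v 0 := by
  ext i; simp [evv, pcoeff, Polynomial.coeff_zero_eq_eval_zero]

theorem exists_natDegree_le (v : PVec p q) : ∃ k, ∀ i, (v i).natDegree ≤ k :=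
  ⟨Finset.univ.sup fun i => (v i).natDegree, fun i =>
    Finset.le_sup (f := fun i => (v i).natDegree) (Finset.mem_univ i)⟩

theorem eq_sum_pcoeff {v : PVec p q} {k : ℕ} (hk : ∀ i, (v i).natDegree ≤ k) :
    v = ∑ n ∈ Finset.range (k + 1), (X ^ n : ℂ[X]) • cv (pcoeff v n) := by
  ext1 i
  rw [Finset.sum_apply]
  refine ((v i).as_sum_range_C_mul_X_pow' (Nat.lt_succ_of_le (hk i))).trans ?_
  refine Finset.sum_congr rfl fun n _ => ?_
  simp only [Pi.smul_apply, smul_eq_mul, cv, pcoeff]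
  rw [mul_comm]

/-! ### Transvections as products of simple elements. -/

variable {Γ : Submonoid (Loop p q)} {α : ℝ}

theorem good_of_family {S : Set (ℂ → Mat p q)} (hS : loopsOf S ⊆ (Γ : Set (Loop p q)))
    {f : ℂ → Mat p q} (hf : f ∈ S) (hex : ∃ g ∈ negRealLoops p q, g ∈ loopsOf {f})
    {P : PMat p q} {d : ℂ[X]} (he : ∀ᶠ l in cofinite, f l = pairFun α P d l) : Good Γ α P d := by
  obtain ⟨g, -, f', rfl, hg⟩ := hex
  exact ⟨g, hS ⟨f', hf, hg⟩, hg.trans (Germ.coe_eq.2 he)⟩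

theorem nElt_eq_pairFun (k : ℕ) (N : Mat p q) (l : ℂ) : nElt α k N l =
    pairFun α (1 + (X ^ k : ℂ[X]) • cm N + (C (1 / 2) * X ^ (2 * k) : ℂ[X]) • cm (N ^ 2)) 1 l := by
  simp [nElt, pairFun, evm_add, evm_smul]

theorem good_mElt (hm : loopsOf (mFamily p q α) ⊆ (Γ : Set (Loop p q))) {k : ℕ} (hk : 1 ≤ k)
    {N : Mat p q} (hN : N ^ 2 = 0) (ha : adj N = -N) :
    Good Γ α (1 + (X ^ k : ℂ[X]) • cm N) 1 := by
  have hf : mElt α k N ∈ mFamily p q α := ⟨k, N, hk, hN, ha, rfl⟩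
  refine good_of_family hm hf (exists_mem_of_mFamily hf) (Eventually.of_forall fun l => ?_)
  rw [← nElt_eq_mElt hN, nElt_eq_pairFun, hN, cm_zero, smul_zero, add_zero]

theorem good_nElt (hn : loopsOf (nFamily p q α) ⊆ (Γ : Set (Loop p q))) {k : ℕ}
    {N : Mat p q} (hf : nElt α k N ∈ nFamily p q α) :
    Good Γ α (1 + (X ^ k : ℂ[X]) • cm N + (C (1 / 2) * X ^ (2 * k) : ℂ[X]) • cm (N ^ 2)) 1 :=
  good_of_family hn hf (exists_mem_of_nFamily hf)
    (Eventually.of_forall fun l => nElt_eq_pairFun k N l)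

theorem sq_rankOne_sub {e x : Vec p q} (he : form e e = 0) (hx : form e x = 0) :
    (rankOne e x - rankOne x e) ^ 2 = -(form x x • rankOne e e) := by
  rw [pow_two, sub_mul, mul_sub, mul_sub]
  simp only [rankOne_mul_rankOne, he, hx, form_eq_zero_symm hx, zero_smul]
  simp

theorem cv_neg (v : Vec p q) : cv (-v) = -cv v := by ext1 i; simp [cv]

/-- This is exp(z^k N) for the skew-adjoint N built from e and x; N² = -⟨x, x⟩ `rankOne e e`
accounts for the term -⟨x, x⟩/2 in `transv`. -/
theorem transv_monomial {e x : Vec p q} (he : form e e = 0) (hx : form e x = 0) (k : ℕ) :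
    transv (cv e) ((X ^ k : ℂ[X]) • cv x) 0 =
      1 + (X ^ k : ℂ[X]) • cm (rankOne e x - rankOne x e) +
        (C (1 / 2) * X ^ (2 * k) : ℂ[X]) • cm ((rankOne e x - rankOne x e) ^ 2) := by
  rw [sq_rankOne_sub he hx]
  refine PMat.ext_cv fun v => ?_
  simp only [transv_mulVec, Matrix.add_mulVec, Matrix.one_mulVec, Matrix.smul_mulVec,
    cm_mulVec_cv, Matrix.sub_mulVec, Matrix.neg_mulVec, rankOne_mulVec, cv_sub, cv_smul, cv_neg,
    pform_smul_left, pform_smul_right, pform_cv_cv, map_pow, pconj_X]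
  match_scalars <;> ring

theorem transv_center_monomial (e : Vec p q) (c : ℂ) (k : ℕ) :
    transv (cv e) 0 (C c * X ^ k) = 1 + (X ^ k : ℂ[X]) • cm (c • rankOne e e) := by
  refine PMat.ext_cv fun v => ?_
  rw [transv_mulVec, Matrix.add_mulVec, Matrix.one_mulVec, Matrix.smul_mulVec, cm_mulVec_cv,
    Matrix.smul_mulVec, rankOne_mulVec, smul_smul, cv_smul]
  simp only [pform_zero_left, pform_cv_cv, map_mul]
  match_scalars
  · ring
  · ring

/-- Central elements multiply by adding c, so c splits into monomials. A skew c has purely imaginary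
coefficients c_k, and N = c_k `rankOne e e` is skew-adjoint of square zero: an element m. -/
theorem good_transv_center (hm : loopsOf (mFamily p q α) ⊆ (Γ : Set (Loop p q))) {e : Vec p q}
    (he : form e e = 0) {c : ℂ[X]} (hc : pconj c = -c) (hc0 : c.coeff 0 = 0) :
    Good Γ α (transv (cv e) 0 c) 1 := by
  have hee : pform (cv e) (cv e) = 0 := by rw [pform_cv_cv, he, map_zero]
  have key : ∀ s : Finset ℕ, Good Γ α (transv (cv e) 0 (∑ k ∈ s, C (c.coeff k) * X ^ k)) 1 := by
    intro s
    induction s using Finset.induction_on with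
    | empty => simpa using Good.one Γ α
    | insert k s hk ih =>
      have h1 : Good Γ α (transv (cv e) 0 (C (c.coeff k) * X ^ k)) 1 := by
        rcases Nat.eq_zero_or_pos k with rfl | hk
        · simpa [hc0] using Good.one Γ α
        · rw [transv_center_monomial]
          refine good_mElt hm hk ?_ ?_
          · rw [pow_two, smul_mul_smul_comm, rankOne_mul_rankOne, he, zero_smul, smul_zero]
          · have h2 := congrArg (fun f => f.coeff k) hc
            simp only [coeff_pconj, Polynomial.coeff_neg] at h2
            rw [adj_smul, adj_rankOne, h2, neg_smul]
      have h2 := h1.mul ih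
      rw [transv_mul_transv hee (pform_zero_right _) (pform_zero_right _)] at h2
      simpa [Finset.sum_insert hk] using h2
  have h := key (Finset.range (c.natDegree + 1))
  rwa [← Polynomial.as_sum_range_C_mul_X_pow] at h

theorem good_transv_add (hm : loopsOf (mFamily p q α) ⊆ (Γ : Set (Loop p q))) {e : Vec p q}
    (he : form e e = 0) {x y : PVec p q} {c d : ℂ[X]} (hx : pform (cv e) x = 0)
    (hy : pform (cv e) y = 0) (hx0 : evv 0 x = 0) (hy0 : evv 0 y = 0) (hc : pconj c = -c)
    (hd : pconj d = -d) (hc0 : c.coeff 0 = 0) (hd0 : d.coeff 0 = 0)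
    (h1 : Good Γ α (transv (cv e) x 0) 1) (h2 : Good Γ α (transv (cv e) y d) 1) :
    Good Γ α (transv (cv e) (x + y) c) 1 := by
  have hee : pform (cv e) (cv e) = 0 := by rw [pform_cv_cv, he, map_zero]
  have e1 : (pform y x).coeff 0 = 0 := by
    rw [Polynomial.coeff_zero_eq_eval_zero, eval_pform, hx0, form_zero_right]
  have e2 : (pform x y).coeff 0 = 0 := by
    rw [Polynomial.coeff_zero_eq_eval_zero, eval_pform, hy0, form_zero_right]
  -- The central parameter is the difference between c and what the product of the two transvections
  -- already carries. It is skew and vanishes at 0 because x and y do.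
  have h3 := good_transv_center (α := α) hm he
    (c := c - d - C (1 / 2) * (pform y x - pform x y))
    (by simp only [map_sub, map_mul, pconj_pform, hc, hd, pconj_C, map_div₀, map_one, map_ofNat]
        ring)
    (by simp [hc0, hd0, e1, e2, Polynomial.mul_coeff_zero])
  have h4 := (h1.mul h2).mul h3
  rw [transv_mul_transv hee hx hy, transv_mul_transv hee (by rw [pform_add_right, hx, hy, add_zero])
    (pform_zero_right _), add_zero, pform_zero_left, pform_zero_right, sub_zero, mul_zero,
    mul_one, mul_one] at h4
  convert h4 using 2
  ring

/-- The dichotomy that separates m from n. Over an anisotropic complement the monomial is itself an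
element n; otherwise x is a sum of isotropic vectors y, each giving N² = 0 and so an element m. -/
theorem good_transv_monomial (hm : loopsOf (mFamily p q α) ⊆ (Γ : Set (Loop p q)))
    (hn : loopsOf (nFamily p q α) ⊆ (Γ : Set (Loop p q))) {V : Submodule ℂ (Vec p q)}
    (hV : IsIsotropic V) {e : Vec p q} (he : e ∈ V) {x : Vec p q} (hx : x ∈ perp (hyp V))
    {k : ℕ} (hk : 1 ≤ k) : Good Γ α (transv (cv e) ((X ^ k : ℂ[X]) • cv x) 0) 1 := by
  have hee := hV e he e he
  have hex : ∀ y ∈ perp (hyp V), form e y = 0 := fun y hy => hy e (Submodule.mem_sup_left he)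
  by_cases hW : IsAnisotropic (perp (hyp V))
  · rw [transv_monomial hee (hex x hx)]
    -- M = `rankOne e x` kills V ⊕ sV as x is orthogonal to it, and has values in V as e ∈ V.
    refine good_nElt hn ⟨k, V, rankOne e x, hk, maximal_of_isAnisotropic hV hW, fun v hv => ?_,
      fun w _ => ?_, ?_⟩
    · rw [rankOne_mulVec, form_eq_zero_symm (hx v hv), zero_smul]
    · rw [rankOne_mulVec]
      exact V.smul_mem _ he
    · rw [adj_rankOne]
  · simp only [IsAnisotropic, not_forall] at hW
    obtain ⟨u, hu, huu, hu0⟩ := hW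
    have hcl := mem_closure_isotropic (fun w hw => sMat_mulVec_mem_perp_hyp hw) hu hu0 huu hx
    have h0 : ∀ y : Vec p q, evv 0 ((X ^ k : ℂ[X]) • cv y) = 0 := fun y => by
      rw [evv_smul]; simp [show k ≠ 0 by omega]
    have hp : ∀ y ∈ perp (hyp V), pform (cv e) ((X ^ k : ℂ[X]) • cv y) = 0 := fun y hy => by
      rw [pform_smul_right, pform_cv_cv, hex y hy]; simp
    clear hx
    -- Membership is carried through the induction, since adding two terms needs both orthogonal to
    -- e.
    suffices h : x ∈ perp (hyp V) ∧ Good Γ α (transv (cv e) ((X ^ k : ℂ[X]) • cv x) 0) 1 from h.2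
    induction hcl using AddSubmonoid.closure_induction with
    | mem y hy =>
      refine ⟨hy.1, ?_⟩
      have hN := sq_rankOne_sub hee (hex y hy.1)
      rw [hy.2, zero_smul, neg_zero] at hN
      rw [transv_monomial hee (hex y hy.1), hN, cm_zero, smul_zero, add_zero]
      exact good_mElt hm hk hN (by rw [adj_sub, adj_rankOne, adj_rankOne, neg_sub])
    | zero => exact ⟨zero_mem _, by simpa using Good.one Γ α⟩
    | add y z _ _ hy hz =>
      refine ⟨add_mem hy.1 hz.1, ?_⟩
      rw [cv_add, smul_add]
      exact good_transv_add hm hee (hp y hy.1) (hp z hz.1) (h0 y) (h0 z) (by simp) (by simp)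
        rfl rfl hy.2 hz.2

theorem good_transv (hm : loopsOf (mFamily p q α) ⊆ (Γ : Set (Loop p q)))
    (hn : loopsOf (nFamily p q α) ⊆ (Γ : Set (Loop p q))) {V : Submodule ℂ (Vec p q)}
    (hV : IsIsotropic V) {e : Vec p q} (he : e ∈ V) {x : PVec p q}
    (hx : ∀ f ∈ hyp V, pform (cv f) x = 0) (hx0 : evv 0 x = 0) {c : ℂ[X]} (hc : pconj c = -c)
    (hc0 : c.coeff 0 = 0) : Good Γ α (transv (cv e) x c) 1 := by
  have hee := hV e he e he
  have hco : ∀ n, pcoeff x n ∈ perp (hyp V) := fun n f hf => by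
    rw [← coeff_pform_cv, hx f hf, Polynomial.coeff_zero]
  have hco0 : pcoeff x 0 = 0 := by rw [← evv_zero_eq_pcoeff, hx0]
  have h0 : ∀ n, evv 0 ((X ^ n : ℂ[X]) • cv (pcoeff x n)) = 0 := fun n => by
    rw [evv_smul, evv_cv]
    rcases Nat.eq_zero_or_pos n with rfl | hn
    · rw [hco0, smul_zero]
    · simp [show n ≠ 0 by omega]
  have hp : ∀ n, pform (cv e) ((X ^ n : ℂ[X]) • cv (pcoeff x n)) = 0 := fun n => by
    rw [pform_smul_right, pform_cv_cv, hco n e (Submodule.mem_sup_left he)]; simp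
  have key : ∀ s : Finset ℕ, Good Γ α
      (transv (cv e) (∑ n ∈ s, (X ^ n : ℂ[X]) • cv (pcoeff x n)) 0) 1 ∧
      pform (cv e) (∑ n ∈ s, (X ^ n : ℂ[X]) • cv (pcoeff x n)) = 0 ∧
      evv 0 (∑ n ∈ s, (X ^ n : ℂ[X]) • cv (pcoeff x n)) = 0 := by
    intro s
    induction s using Finset.induction_on with
    | empty => exact ⟨by simpa using Good.one Γ α, by simp, by ext i; simp [evv]⟩
    | insert n s hns ih =>
      obtain ⟨i1, i2, i3⟩ := ih
      rw [Finset.sum_insert hns]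
      refine ⟨?_, by rw [pform_add_right, hp, i2, add_zero], by rw [evv_add, h0, i3, add_zero]⟩
      refine good_transv_add hm hee (hp n) i2 (h0 n) i3 (by simp) (by simp) rfl rfl ?_ i1
      rcases Nat.eq_zero_or_pos n with rfl | hn'
      · rw [hco0]; simpa using Good.one Γ α
      · exact good_transv_monomial hm hn hV he (hco n) hn'
  obtain ⟨k, hk⟩ := exists_natDegree_le x
  obtain ⟨i1, i2, i3⟩ := key (Finset.range (k + 1))
  rw [← eq_sum_pcoeff hk] at i1 i2 i3
  have h := good_transv_add hm hee i2 (pform_zero_right _) i3 (by ext i; simp [evv]) hc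
    (d := 0) (by simp) hc0 rfl i1 (by simpa using Good.one Γ α)
  rwa [add_zero] at h

end Transvections

/-! ### Loops that are trivial off an anisotropic subspace -/

section Anisotropic

variable {p q : ℕ}

theorem PVec.smul_cancel {r : ℂ[X]} (hr : r ≠ 0) {v w : PVec p q} (h : r • v = r • w) : v = w :=
  funext fun i => mul_left_cancel₀ hr (congrFun h i)

theorem PMat.smul_cancel {r : ℂ[X]} (hr : r ≠ 0) {P Q : PMat p q} (h : r • P = r • Q) : P = Q :=
  Matrix.ext fun i j => mul_left_cancel₀ hr (congrFun (congrFun h i) j)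

/-- A vector fixed by P/d has the same pairing with w as with (P/d)w. This keeps images of the
complement inside the complement. -/
theorem IsUnitaryPair.pform_fixed {P : PMat p q} {d : ℂ[X]} (hP : IsUnitaryPair P d) (hd : d ≠ 0)
    {f : PVec p q} (hf : P.mulVec f = d • f) (w : PVec p q) :
    pform f (P.mulVec w) = d * pform f w := by
  have h := hP f w
  rw [hf, pform_smul_left, mul_assoc] at h
  exact mul_left_cancel₀ (pconj_ne_zero hd) h

theorem coeff_pform_top {v w : PVec p q} {m n : ℕ} (hv : ∀ i, (v i).natDegree ≤ m)
    (hw : ∀ i, (w i).natDegree ≤ n) :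
    (pform v w).coeff (m + n) = form (pcoeff v m) (pcoeff w n) := by
  have h : ∀ i, (pconj (v i) * w i).coeff (m + n) = conj ((v i).coeff m) * (w i).coeff n :=
    fun i => by
      rw [Polynomial.coeff_mul_add_eq_of_natDegree_le (by rw [natDegree_pconj]; exact hv i) (hw i),
        coeff_pconj]
  simp [pform, form, pcoeff, Polynomial.finsetSum_coeff, h]

theorem natDegree_pform_le {v w : PVec p q} {m n : ℕ} (hv : ∀ i, (v i).natDegree ≤ m)
    (hw : ∀ i, (w i).natDegree ≤ n) : (pform v w).natDegree ≤ m + n := by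
  have h : ∀ i, (pconj (v i) * w i).natDegree ≤ m + n := fun i =>
    Polynomial.natDegree_mul_le_of_le (by rw [natDegree_pconj]; exact hv i) (hw i)
  refine Polynomial.natDegree_add_le_of_degree_le ?_ ?_
  · rw [Polynomial.natDegree_neg]
    exact Polynomial.natDegree_sum_le_of_forall_le _ _ fun i _ => h _
  · exact Polynomial.natDegree_sum_le_of_forall_le _ _ fun i _ => h _

theorem natDegree_le_pred {v : PVec p q} {k : ℕ} (hv : ∀ i, (v i).natDegree ≤ k + 1)
    (h0 : pcoeff v (k + 1) = 0) (i) : (v i).natDegree ≤ k := by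
  refine Polynomial.natDegree_le_iff_coeff_eq_zero.2 fun n hn => ?_
  rcases Nat.lt_or_ge (k + 1) n with h | h
  · exact Polynomial.coeff_eq_zero_of_natDegree_lt ((hv i).trans_lt h)
  · rw [show n = k + 1 by omega]
    exact congrFun h0 i

theorem eq_cv_of_natDegree {v : PVec p q} (hv : ∀ i, (v i).natDegree ≤ 0) : v = cv (evv 0 v) := by
  ext1 i
  conv_lhs => rw [Polynomial.eq_C_of_natDegree_le_zero (hv i)]
  rw [cv, evv, Polynomial.coeff_zero_eq_eval_zero]

theorem pcoeff_mem_perp {U : Submodule ℂ (Vec p q)} {v : PVec p q}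
    (h : ∀ f ∈ U, pform (cv f) v = 0) (n : ℕ) : pcoeff v n ∈ perp U := fun f hf => by
  rw [← coeff_pform_cv, h f hf, Polynomial.coeff_zero]

/-- In positive degree the top coefficient of ⟨v, v⟩ is the norm of the leading coefficient of v,
which lies in `perp U`. As ⟨v, v⟩ is constant, that coefficient is isotropic, hence zero. -/
theorem eq_cv_of_isAnisotropic {U : Submodule ℂ (Vec p q)} (hW : IsAnisotropic (perp U))
    {v : PVec p q} (hv : ∀ f ∈ U, pform (cv f) v = 0) {c : ℂ} (hc : pform v v = C c) :
    v = cv (evv 0 v) := by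
  obtain ⟨k, hk⟩ := exists_natDegree_le v
  induction k with
  | zero => exact eq_cv_of_natDegree hk
  | succ k ih =>
    refine ih (natDegree_le_pred hk (hW _ (pcoeff_mem_perp hv _) ?_))
    rw [← coeff_pform_top hk hk, hc, Polynomial.coeff_C_of_ne_zero (by omega)]

variable {V : Submodule ℂ (Vec p q)}

theorem eq_one_of_isAnisotropic (hV : IsIsotropic V) (hW : IsAnisotropic (perp (hyp V)))
    {P : PMat p q} (hP : IsUnitaryPair P 1) (h0 : evm 0 P = 1)
    (hF : ∀ f ∈ hyp V, P.mulVec (cv f) = cv f) : P = 1 := by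
  refine PMat.ext_cv fun f => ?_
  obtain ⟨a, ha, w, hw, rfl⟩ := exists_add_of_isCompl (isCompl_hyp hV) f
  rw [cv_add, Matrix.mulVec_add, hF a ha, Matrix.one_mulVec]
  congr 1
  have h1 := eq_cv_of_isAnisotropic hW (v := P.mulVec (cv w)) (c := form w w)
    (fun f hf => by
      rw [hP.pform_fixed one_ne_zero (by rw [hF f hf, one_smul]), pform_cv_cv, hw f hf]; simp)
    (by rw [hP, pform_cv_cv]; simp)
  rw [h1, evv_mulVec, h0, evv_cv, Matrix.one_mulVec]

/-- The polynomial `1 - X / r`. -/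
noncomputable def lin (r : ℂ) : ℂ[X] := 1 - C r⁻¹ * X

@[simp] theorem pconj_lin (r : ℂ) : pconj (lin r) = lin (conj r) := by simp [lin]

@[simp] theorem eval_lin (r z : ℂ) : eval z (lin r) = 1 - r⁻¹ * z := by simp [lin]

theorem lin_ne_zero (r : ℂ) : lin r ≠ 0 := fun h => by
  have := congrArg (eval 0) h
  simp at this

theorem X_sub_C_eq {r : ℂ} (hr : r ≠ 0) : X - C r = C (-r) * lin r := by
  rw [lin, mul_sub, ← mul_assoc, ← C.map_mul, neg_mul, mul_inv_cancel₀ hr]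
  simp [sub_eq_add_neg, add_comm]

theorem lin_dvd {r : ℂ} (hr : r ≠ 0) {f : ℂ[X]} (hf : eval r f = 0) : ∃ g, f = lin r * g := by
  obtain ⟨g, rfl⟩ := Polynomial.dvd_iff_isRoot.2 hf
  exact ⟨C (-r) * g, by rw [X_sub_C_eq hr]; ring⟩

theorem natDegree_lin {r : ℂ} (hr : r ≠ 0) : (lin r).natDegree = 1 := by
  have h := congrArg Polynomial.natDegree (X_sub_C_eq hr)
  rw [Polynomial.natDegree_X_sub_C, Polynomial.natDegree_C_mul (neg_ne_zero.2 hr)] at h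
  exact h.symm

theorem PMat.exists_eq_lin_smul {r : ℂ} (hr : r ≠ 0) {P : PMat p q} (hP : evm r P = 0) :
    ∃ Q, P = lin r • Q := by
  choose Q hQ using fun i j => lin_dvd hr (f := P i j) (congrFun (congrFun hP i) j)
  exact ⟨Matrix.of Q, Matrix.ext fun i j => hQ i j⟩

/-! ### Splitting off elements p over an anisotropic complement. -/

variable {Γ : Submonoid (Loop p q)} {α : ℝ}

theorem pElt_eq_pairFun {r : ℂ} {U : Submodule ℂ (Vec p q)} (hU : IsCompl U (perp U))
    {l : ℂ} (h1 : l ≠ α) (h2 : l ≠ α + r⁻¹) : pElt (α + conj r⁻¹) U l =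
      pairFun α (lin (conj r) • cm (proj U (perp U)) + lin r • cm (1 - proj U (perp U))) (lin r)
        l := by
  have k1 : l - α ≠ 0 := sub_ne_zero.2 h1
  have k2 : l - α - r⁻¹ ≠ 0 := by rw [sub_sub]; exact sub_ne_zero.2 h2
  have e1 : eval (l - α)⁻¹ (lin r) = (l - α - r⁻¹) / (l - α) := by
    rw [eval_lin, ← div_eq_mul_inv, sub_div, div_self k1]
  have e2 : eval (l - α)⁻¹ (lin (conj r)) = (l - α - conj r⁻¹) / (l - α) := by
    rw [eval_lin, ← div_eq_mul_inv, sub_div, div_self k1, map_inv₀]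
  rw [pElt_eq hU, pairFun, evm_add, evm_smul, evm_smul, evm_cm, evm_cm, e1, e2]
  have e3 : l - conj (α + conj r⁻¹) = l - α - r⁻¹ := by
    rw [map_add, Complex.conj_conj, Complex.conj_ofReal]; ring
  rw [e3]
  clear e1 e2 e3
  revert k2
  generalize r⁻¹ = s
  intro k2
  match_scalars
  · field_simp
  · field_simp
    ring

/-- Let r be a root of d. Either P vanishes at r and the factor cancels, or U = im P(r) lies in the
anisotropic complement, so ℂⁿ = U ⊕ U^⊥, and the element p with subspace U and pole at z = r splits
off on the left. Either way the degree of d drops. -/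
theorem good_of_isAnisotropic (hΓ : loopsOf (pFamily p q) ⊆ (Γ : Set (Loop p q)))
    (hV : IsIsotropic V) (hW : IsAnisotropic (perp (hyp V))) :
    ∀ (n : ℕ) {P : PMat p q} {d : ℂ[X]}, d.natDegree ≤ n → IsUnitaryPair P d → eval 0 d = 1 →
      evm 0 P = 1 → (∀ f ∈ hyp V, P.mulVec (cv f) = d • cv f) → Good Γ α P d := by
  intro n
  induction n with
  | zero =>
    intro P d hn hP hd0 hP0 hF
    have hd : d = 1 := by
      rw [Polynomial.eq_C_of_natDegree_le_zero hn, Polynomial.coeff_zero_eq_eval_zero, hd0, map_one]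
    subst hd
    rw [eq_one_of_isAnisotropic hV hW hP hP0 fun f hf => by rw [hF f hf, one_smul]]
    exact Good.one Γ α
  | succ n ih =>
    intro P d hn hP hd0 hP0 hF
    rcases Nat.lt_or_ge n d.natDegree with hlt | hle
    swap
    · exact ih hle hP hd0 hP0 hF
    have hdne : d ≠ 0 := fun h => by simp [h] at hd0
    obtain ⟨r, hr⟩ := IsAlgClosed.exists_root d fun h => by
      have := Polynomial.natDegree_eq_zero_iff_degree_le_zero.2 h.le
      omega
    have hr : eval r d = 0 := hr
    have hr0 : r ≠ 0 := by
      rintro rfl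
      rw [hd0] at hr
      exact one_ne_zero hr
    obtain ⟨d', rfl⟩ := lin_dvd hr0 hr
    have hd' : d' ≠ 0 := right_ne_zero_of_mul hdne
    have hdeg : d'.natDegree ≤ n := by
      rw [Polynomial.natDegree_mul (lin_ne_zero r) hd', natDegree_lin hr0] at hn
      omega
    have hd'0 : eval 0 d' = 1 := by simpa using hd0
    have hl := lin_ne_zero r
    have hl' := lin_ne_zero (conj r)
    by_cases hPr : evm r P = 0
    · obtain ⟨Q, rfl⟩ := PMat.exists_eq_lin_smul hr0 hPr
      refine (ih hdeg ?_ hd'0 ?_ ?_).scale hl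
      · intro v w
        have h := hP v w
        rw [Matrix.smul_mulVec, Matrix.smul_mulVec, pform_smul_left, pform_smul_right, map_mul,
          pconj_lin] at h
        refine mul_left_cancel₀ (mul_ne_zero hl' hl) ?_
        linear_combination h
      · simpa [evm_smul] using hP0
      · intro f hf
        refine PVec.smul_cancel hl ?_
        rw [← Matrix.smul_mulVec, hF f hf, smul_smul]
    -- the value at the root spans a nondegenerate subspace
    set U : Submodule ℂ (Vec p q) := LinearMap.range (Matrix.toLin' (evm r P)) with hUdef
    have hUm : ∀ x, (evm r P).mulVec x ∈ U := fun x => ⟨x, rfl⟩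
    have hUW : U ≤ perp (hyp V) := by
      rintro _ ⟨x, rfl⟩ f hf
      have h := congrArg (eval r) (hP.pform_fixed hdne (hF f hf) (cv x))
      rw [eval_pform, evv_cv, evv_mulVec, evv_cv, Polynomial.eval_mul, hr, zero_mul] at h
      exact h
    have hU : IsCompl U (perp U) := isCompl_perp fun v hv hv' => hW v (hUW hv) (hv' v hv)
    have hval : ∀ z x y, form ((evm (conj z) P).mulVec x) ((evm z P).mulVec y) =
        conj (eval (conj z) (lin r * d')) * eval z (lin r * d') * form x y := by
      intro z x y
      have h := congrArg (eval z) (hP (cv x) (cv y))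
      rwa [eval_pform, evv_mulVec, evv_mulVec, evv_cv, evv_cv, pform_cv_cv, Polynomial.eval_mul,
        Polynomial.eval_C, Polynomial.eval_mul, eval_pconj] at h
    -- For real r every P(r)x would have norm zero in an anisotropic space, forcing P(r) = 0.
    have hrr : conj r ≠ r := by
      intro h
      refine hPr (Matrix.mulVec_injective (funext fun x => ?_))
      rw [Matrix.zero_mulVec]
      refine hW _ (hUW (hUm x)) ?_
      have h1 := hval r x x
      rwa [h, hr, mul_zero, zero_mul] at h1
    set π := proj U (perp U) with hπ
    have hππ : π * π = π := proj_mul_of_le hU hU le_rfl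
    have hπa : adj π = π := adj_proj_perp hU
    obtain ⟨Q1, hQ1⟩ : ∃ Q1, cm (1 - π) * P = lin r • Q1 := by
      refine PMat.exists_eq_lin_smul hr0 ?_
      rw [evm_mul, evm_cm]
      refine Matrix.mulVec_injective (funext fun x => ?_)
      rw [← Matrix.mulVec_mulVec, Matrix.sub_mulVec, Matrix.one_mulVec,
        proj_mulVec_of_mem hU (hUm x), sub_self, Matrix.zero_mulVec]
    -- ⟨P(r)y, P(r̄)x⟩ = 0 because d(r) = 0, so P(r̄) maps into U^⊥ and πP vanishes at r̄; dually (1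
    -- - π)P vanishes at r.
    obtain ⟨Q2, hQ2⟩ : ∃ Q2, cm π * P = lin (conj r) • Q2 := by
      refine PMat.exists_eq_lin_smul ((map_ne_zero _).2 hr0) ?_
      rw [evm_mul, evm_cm]
      refine Matrix.mulVec_injective (funext fun x => ?_)
      rw [← Matrix.mulVec_mulVec, Matrix.zero_mulVec]
      refine proj_mulVec_eq_zero hU ?_
      rintro _ ⟨y, rfl⟩
      have h := hval (conj r) y x
      rwa [Complex.conj_conj, hr, map_zero, zero_mul, zero_mul] at h
    have h1 : cm π * Q1 = 0 := by
      refine PMat.smul_cancel hl ?_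
      rw [← mul_smul_comm, ← hQ1, ← mul_assoc, ← cm_mul, mul_sub, mul_one, hππ, sub_self, cm_zero,
        zero_mul, smul_zero]
    have h2 : cm π * Q2 = Q2 := by
      refine PMat.smul_cancel hl' ?_
      rw [← mul_smul_comm, ← hQ2, ← mul_assoc, ← cm_mul, hππ]
    have hsum : P = lin (conj r) • Q2 + lin r • Q1 := by
      rw [← hQ1, ← hQ2, cm_sub, cm_one, sub_mul, one_mul, add_sub_cancel]
    have horth : ∀ v w, pform (Q2.mulVec v) (Q1.mulVec w) = 0 := by
      intro v w
      rw [← h2, ← Matrix.mulVec_mulVec, pform_cm_left, hπa, Matrix.mulVec_mulVec, h1,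
        Matrix.zero_mulVec, pform_zero_right]
    have hgood : Good Γ α (Q1 + Q2) d' := by
      refine ih hdeg ?_ hd'0 ?_ ?_
      · intro v w
        have h := hP v w
        have o1 := horth v w
        have o2 := pform_eq_zero_symm (horth w v)
        simp only [hsum, Matrix.add_mulVec, Matrix.smul_mulVec, pform_add_left, pform_add_right,
          pform_smul_left, pform_smul_right, o1, o2, map_mul, pconj_lin, Complex.conj_conj] at h
        refine mul_left_cancel₀ (mul_ne_zero hl' hl) ?_
        rw [Matrix.add_mulVec, Matrix.add_mulVec, pform_add_left, pform_add_right,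
          pform_add_right, o1, o2]
        linear_combination h
      · rw [hsum, evm_add, evm_smul, evm_smul] at hP0
        rw [evm_add, add_comm]
        simpa using hP0
      · intro f hf
        have hπf : π.mulVec f = 0 :=
          proj_mulVec_eq_zero hU fun u hu => form_eq_zero_symm (hUW hu f hf)
        have e1 : Q2.mulVec (cv f) = 0 := by
          refine PVec.smul_cancel hl' ?_
          rw [← Matrix.smul_mulVec, ← hQ2, ← Matrix.mulVec_mulVec, hF f hf, Matrix.mulVec_smul,
            cm_mulVec_cv, hπf, cv_zero, smul_zero, smul_zero]
        have e2 : Q1.mulVec (cv f) = d' • cv f := by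
          refine PVec.smul_cancel hl ?_
          rw [← Matrix.smul_mulVec, ← hQ1, ← Matrix.mulVec_mulVec, hF f hf, Matrix.mulVec_smul,
            cm_mulVec_cv, Matrix.sub_mulVec, hπf, Matrix.one_mulVec, sub_zero, smul_smul]
        rw [Matrix.add_mulVec, e1, e2, add_zero]
    have hpe : Good Γ α (lin (conj r) • cm π + lin r • cm (1 - π)) (lin r) := by
      have hf : pElt (α + conj r⁻¹) U ∈ pFamily p q := by
        refine ⟨_, U, ?_, hU, rfl⟩
        rw [map_add, Complex.conj_conj, Complex.conj_ofReal]
        intro h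
        have h3 := add_left_cancel h
        rw [map_inv₀, inv_inj] at h3
        exact hrr h3
      refine good_of_family hΓ hf (exists_mem_of_pFamily hf) ?_
      filter_upwards [eventually_ne_cofinite (α : ℂ), eventually_ne_cofinite (α + r⁻¹ : ℂ)]
        with l k1 k2
      exact pElt_eq_pairFun hU k1 k2
    have h := hpe.mul hgood
    convert h using 1
    have h3 : cm (1 - π) * Q1 = Q1 := by rw [cm_sub, cm_one, sub_mul, one_mul, h1, sub_zero]
    have h4 : cm (1 - π) * Q2 = 0 := by rw [cm_sub, cm_one, sub_mul, one_mul, h2, sub_self]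
    rw [add_mul, mul_add, mul_add, smul_mul_assoc, smul_mul_assoc, smul_mul_assoc, smul_mul_assoc,
      h1, h2, h3, h4, smul_zero, smul_zero, zero_add, add_zero, hsum]

end Anisotropic

/-! ### Division with prescribed remainder degree -/

/-- Division with a multiplier vanishing at 0, as the loop normalization demands. Its constant term
stays in the remainder, so the bound is ≤ and not <. -/
theorem exists_natDegree_add_mul_le (b : ℂ[X]) {g : ℂ[X]} (hg : g ≠ 0) :
    ∃ f : ℂ[X], f.coeff 0 = 0 ∧ (b + f * g).natDegree ≤ g.natDegree := by
  refine ⟨-(b / g - C ((b / g).coeff 0)), by simp, ?_⟩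
  have h := EuclideanDomain.div_add_mod b g
  have h1 : b + -(b / g - C ((b / g).coeff 0)) * g = b % g + C ((b / g).coeff 0) * g := by
    linear_combination -h
  rw [h1]
  refine Polynomial.natDegree_add_le_of_degree_le ?_ (Polynomial.natDegree_C_mul_le _ _)
  exact Polynomial.natDegree_le_natDegree (EuclideanDomain.mod_lt b hg).le

/-- Write b = aq + r. Then b̄a + āb = (q̄ + q)āa + (terms of degree ≤ 2 deg a), so the hypothesis
makes q̄ + q constant: q is skew up to a constant. Subtracting its skew part, minus the constant
term, is therefore enough. -/
theorem exists_skew_natDegree_add_mul_le {a b : ℂ[X]} (ha : a ≠ 0)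
    (h : (pconj b * a + pconj a * b).natDegree ≤ a.natDegree + a.natDegree) :
    ∃ c : ℂ[X], pconj c = -c ∧ c.coeff 0 = 0 ∧ (b + c * a).natDegree ≤ a.natDegree := by
  set q := b / a
  set r := b % a
  have hb : a * q + r = b := EuclideanDomain.div_add_mod b a
  have hr : r.natDegree ≤ a.natDegree :=
    Polynomial.natDegree_le_natDegree (EuclideanDomain.mod_lt b ha).le
  have h1 : ((pconj q + q) * (pconj a * a)).natDegree ≤ a.natDegree + a.natDegree := by
    have e : (pconj q + q) * (pconj a * a) =
        (pconj b * a + pconj a * b) - (pconj r * a + pconj a * r) := by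
      rw [← hb]; simp only [map_add, map_mul]; ring
    rw [e]
    refine (Polynomial.natDegree_sub_le_of_le h
      (Polynomial.natDegree_add_le_of_degree_le ?_ ?_)).trans (max_self _).le
    · exact Polynomial.natDegree_mul_le_of_le (by rwa [natDegree_pconj]) le_rfl
    · exact Polynomial.natDegree_mul_le_of_le (by rw [natDegree_pconj]) hr
  have h2 : (pconj q + q).natDegree ≤ 0 := by
    by_cases h0 : pconj q + q = 0
    · simp [h0]
    · rw [Polynomial.natDegree_mul h0 (mul_ne_zero (pconj_ne_zero ha) ha),
        Polynomial.natDegree_mul (pconj_ne_zero ha) ha, natDegree_pconj] at h1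
      omega
  refine ⟨-(C (1 / 2) * (q - pconj q) - C (1 / 2 * (q.coeff 0 - conj (q.coeff 0)))), ?_, ?_, ?_⟩
  · simp only [map_neg, map_sub, map_mul, pconj_pconj, pconj_C, Complex.conj_conj, map_div₀,
      map_one, map_ofNat]
    ring
  · simp [Polynomial.mul_coeff_zero]
  · have e : b + -(C (1 / 2) * (q - pconj q) - C (1 / 2 * (q.coeff 0 - conj (q.coeff 0)))) * a =
        (C (1 / 2) * (pconj q + q) + C (1 / 2 * (q.coeff 0 - conj (q.coeff 0)))) * a + r := by
      linear_combination -hb - a * q * C_half_add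
    rw [e]
    refine Polynomial.natDegree_add_le_of_degree_le ?_ hr
    refine (Polynomial.natDegree_mul_le_of_le (m := 0) ?_ le_rfl).trans (by simp)
    refine Polynomial.natDegree_add_le_of_degree_le ?_ (Polynomial.natDegree_C _).le
    exact (Polynomial.natDegree_C_mul_le _ _).trans h2

section

variable {p q : ℕ}

/-- Vector division by a, one leading coefficient at a time. Only powers z^{m+1} are used, so x
vanishes at 0 and the remainder may reach degree deg a. -/
theorem exists_natDegree_sub_smul_le {U : Submodule ℂ (Vec p q)} {a : ℂ[X]} (ha : a ≠ 0) :
    ∀ (m : ℕ) (w : PVec p q), (∀ f ∈ U, pform (cv f) w = 0) →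
      (∀ i, (w i).natDegree ≤ a.natDegree + m) →
      ∃ x : PVec p q, (∀ f ∈ U, pform (cv f) x = 0) ∧ evv 0 x = 0 ∧
        ∀ i, ((w - a • x) i).natDegree ≤ a.natDegree := by
  intro m
  induction m with
  | zero =>
    intro w _ hd
    exact ⟨0, by simp, by ext i; simp [evv], by simpa using hd⟩
  | succ m ih =>
    intro w hw hd
    set x₀ : PVec p q :=
      (C a.leadingCoeff⁻¹ * X ^ (m + 1) : ℂ[X]) • cv (pcoeff w (a.natDegree + m + 1)) with hx₀
    have hx₀U : ∀ f ∈ U, pform (cv f) x₀ = 0 := fun f hf => by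
      rw [hx₀, pform_smul_right, pform_cv_cv, pcoeff_mem_perp hw _ f hf, map_zero, mul_zero]
    have hlc : a.leadingCoeff ≠ 0 := Polynomial.leadingCoeff_ne_zero.2 ha
    have hx₀d : ∀ i, (x₀ i).natDegree ≤ m + 1 := fun i => by
      simp only [hx₀, Pi.smul_apply, smul_eq_mul, cv]
      refine (Polynomial.natDegree_mul_C_le _ _).trans ?_
      exact Polynomial.natDegree_C_mul_X_pow_le _ _
    have hdeg : ∀ i, ((w - a • x₀) i).natDegree ≤ a.natDegree + m + 1 := fun i =>
      (Polynomial.natDegree_sub_le_of_le (hd i)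
        (Polynomial.natDegree_mul_le_of_le le_rfl (hx₀d i))).trans (max_self _).le
    have htop : pcoeff (w - a • x₀) (a.natDegree + m + 1) = 0 := by
      ext i
      have h1 := Polynomial.coeff_mul_add_eq_of_natDegree_le (le_refl a.natDegree) (hx₀d i)
      have h2 : (x₀ i).coeff (m + 1) =
          a.leadingCoeff⁻¹ * (w i).coeff (a.natDegree + m + 1) := by
        simp only [hx₀, Pi.smul_apply, smul_eq_mul, cv, pcoeff, Polynomial.coeff_mul_C]
        rw [Polynomial.coeff_C_mul_X_pow, if_pos rfl]
      simp only [pcoeff, Pi.sub_apply, Pi.smul_apply, smul_eq_mul, Polynomial.coeff_sub,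
        Pi.zero_apply]
      rw [add_assoc, h1, h2, Polynomial.coeff_natDegree, mul_inv_cancel_left₀ hlc, add_assoc,
        sub_self]
    obtain ⟨x₁, h1, h2, h3⟩ := ih (w - a • x₀)
      (fun f hf => by rw [pform_sub_right, pform_smul_right, hw f hf, hx₀U f hf]; simp)
      (natDegree_le_pred hdeg htop)
    refine ⟨x₀ + x₁, fun f hf => by rw [pform_add_right, hx₀U f hf, h1 f hf, add_zero], ?_, ?_⟩
    · rw [evv_add, h2, hx₀, evv_smul]
      simp
    · rw [smul_add, ← sub_sub]
      exact h3

/-! ### Hyperbolic pairs -/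

/-- `e` is an isotropic unit vector that is orthogonal to `V ⊕ sV`. -/
structure IsNext (V : Submodule ℂ (Vec p q)) (e : Vec p q) : Prop where
  mem_perp : e ∈ perp (hyp V)
  isotropic : form e e = 0
  nsq_eq_one : nsq e = 1

/-- Unit length makes (e, se) a hyperbolic pair with ⟨e, se⟩ = 1. -/
theorem exists_isNext {V : Submodule ℂ (Vec p q)} {u : Vec p q} (hu : u ∈ perp (hyp V))
    (huu : form u u = 0) (hu0 : u ≠ 0) : ∃ e, ∃ c : ℂ, IsNext V e ∧ u = c • e := by
  have h0 : nsq u ≠ 0 := fun h => hu0 (nsq_eq_zero.1 h)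
  have h1 : Real.sqrt (nsq u) ≠ 0 := fun h => h0 ((Real.sqrt_eq_zero (nsq_nonneg u)).1 h)
  refine ⟨((Real.sqrt (nsq u))⁻¹ : ℝ) • u, Real.sqrt (nsq u), ⟨?_, ?_, ?_⟩, ?_⟩
  · exact Submodule.smul_mem _ (((Real.sqrt (nsq u))⁻¹ : ℝ) : ℂ) hu
  · change form ((((Real.sqrt (nsq u))⁻¹ : ℝ) : ℂ) • u) ((((Real.sqrt (nsq u))⁻¹ : ℝ) : ℂ) • u) = 0
    rw [form_smul_left, form_smul_right, huu, mul_zero, mul_zero]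
  · change nsq ((((Real.sqrt (nsq u))⁻¹ : ℝ) : ℂ) • u) = 1
    rw [nsq_smul, inv_pow, Real.sq_sqrt (nsq_nonneg u), inv_mul_cancel₀ h0]
  · change u = (Real.sqrt (nsq u) : ℂ) • ((((Real.sqrt (nsq u))⁻¹ : ℝ) : ℂ) • u)
    rw [smul_smul, ← Complex.ofReal_mul, mul_inv_cancel₀ h1, Complex.ofReal_one, one_smul]

section

variable {V : Submodule ℂ (Vec p q)} {e : Vec p q}

theorem IsNext.form_self_sMat (h : IsNext V e) : form e ((sMat p q).mulVec e) = 1 := by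
  rw [form_sMat_self, h.nsq_eq_one, Complex.ofReal_one]

theorem IsNext.form_sMat_self' (h : IsNext V e) : form ((sMat p q).mulVec e) e = 1 := by
  rw [form_sMat_left, h.form_self_sMat]

theorem IsNext.form_sMat_sMat' (h : IsNext V e) :
    form ((sMat p q).mulVec e) ((sMat p q).mulVec e) = 0 := by
  rw [form_sMat_sMat, h.isotropic]

theorem IsNext.isIsotropic (h : IsNext V e) (hV : IsIsotropic V) :
    IsIsotropic (V ⊔ Submodule.span ℂ {e}) :=
  isIsotropic_sup_span hV (perp_anti le_sup_left h.mem_perp) h.isotropic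

theorem IsNext.mem (_h : IsNext V e) : e ∈ V ⊔ Submodule.span ℂ {e} :=
  Submodule.mem_sup_right (Submodule.mem_span_singleton_self e)

theorem IsNext.ne_zero (h : IsNext V e) : e ≠ 0 := fun h0 => by
  have := h.nsq_eq_one
  rw [nsq_eq_zero.2 h0] at this
  exact zero_ne_one this

theorem IsNext.finrank_lt (h : IsNext V e) (hV : IsIsotropic V) :
    Module.finrank ℂ V < Module.finrank ℂ (V ⊔ Submodule.span ℂ {e} : Submodule ℂ (Vec p q)) := by
  refine Submodule.finrank_lt_finrank_of_lt (lt_of_le_of_ne le_sup_left fun heq => h.ne_zero ?_)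
  have h1 : e ∈ V := by rw [heq]; exact h.mem
  exact Submodule.disjoint_def.1 (isCompl_hyp hV).disjoint e (Submodule.mem_sup_left h1) h.mem_perp

theorem exists_of_mem_hyp_sup_span {f : Vec p q}
    (hf : f ∈ hyp (V ⊔ Submodule.span ℂ {e})) :
    ∃ g ∈ hyp V, ∃ s t : ℂ, f = g + s • e + t • (sMat p q).mulVec e := by
  obtain ⟨x, hx, y, hy, rfl⟩ := Submodule.mem_sup.1 hf
  obtain ⟨a, ha, b, hb, rfl⟩ := Submodule.mem_sup.1 hx
  obtain ⟨c, hc, d, hd, h⟩ := Submodule.mem_sup.1 (mem_sMap.1 hy)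
  obtain ⟨s, rfl⟩ := Submodule.mem_span_singleton.1 hb
  obtain ⟨t, rfl⟩ := Submodule.mem_span_singleton.1 hd
  refine ⟨a + (sMat p q).mulVec c, add_mem (Submodule.mem_sup_left ha)
    (Submodule.mem_sup_right (sMat_mulVec_mem_sMap hc)), s, t, ?_⟩
  have hy' : y = (sMat p q).mulVec c + t • (sMat p q).mulVec e := by
    rw [← Matrix.mulVec_smul, ← Matrix.mulVec_add, h, sMat_mulVec_sMat_mulVec]
  rw [hy']
  abel

theorem pform_hyp_sup_span {w : PVec p q} (h0 : ∀ f ∈ hyp V, pform (cv f) w = 0)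
    (h1 : pform (cv e) w = 0) (h2 : pform (cv ((sMat p q).mulVec e)) w = 0) :
    ∀ f ∈ hyp (V ⊔ Submodule.span ℂ {e}), pform (cv f) w = 0 := by
  intro f hf
  obtain ⟨g, hg, s, t, rfl⟩ := exists_of_mem_hyp_sup_span hf
  rw [cv_add, cv_add, cv_smul, cv_smul, pform_add_left, pform_add_left, pform_smul_left,
    pform_smul_left, h0 g hg, h1, h2]
  simp

theorem mulVec_hyp_sup_span {P : PMat p q} {d : ℂ[X]}
    (h0 : ∀ f ∈ hyp V, P.mulVec (cv f) = d • cv f) (h1 : P.mulVec (cv e) = d • cv e)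
    (h2 : P.mulVec (cv ((sMat p q).mulVec e)) = d • cv ((sMat p q).mulVec e)) :
    ∀ f ∈ hyp (V ⊔ Submodule.span ℂ {e}), P.mulVec (cv f) = d • cv f := by
  intro f hf
  obtain ⟨g, hg, s, t, rfl⟩ := exists_of_mem_hyp_sup_span hf
  rw [cv_add, cv_add, cv_smul, cv_smul, Matrix.mulVec_add, Matrix.mulVec_add, Matrix.mulVec_smul,
    Matrix.mulVec_smul, h0 g hg, h1, h2]
  module

end

/-- The component of `v` orthogonal to the hyperbolic pair `(e, se)`. -/
noncomputable def rest (e : Vec p q) (v : PVec p q) : PVec p q :=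
  v - pform (cv ((sMat p q).mulVec e)) v • cv e - pform (cv e) v • cv ((sMat p q).mulVec e)

theorem eq_add_rest (e : Vec p q) (v : PVec p q) :
    v = pform (cv ((sMat p q).mulVec e)) v • cv e + rest e v +
      pform (cv e) v • cv ((sMat p q).mulVec e) := by
  rw [rest]; abel

theorem IsNext.pform_rest {V : Submodule ℂ (Vec p q)} {e : Vec p q} (h : IsNext V e)
    {v : PVec p q} (hv : ∀ f ∈ hyp V, pform (cv f) v = 0) :
    ∀ f ∈ hyp (V ⊔ Submodule.span ℂ {e}), pform (cv f) (rest e v) = 0 := by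
  refine pform_hyp_sup_span (fun f hf => ?_) ?_ ?_
  · rw [rest, pform_sub_right, pform_sub_right, pform_smul_right, pform_smul_right, pform_cv_cv,
      pform_cv_cv, hv f hf, h.mem_perp f hf, sMat_mulVec_mem_perp_hyp h.mem_perp f hf]
    simp
  · rw [rest, pform_sub_right, pform_sub_right, pform_smul_right, pform_smul_right, pform_cv_cv,
      pform_cv_cv, h.isotropic, h.form_self_sMat]
    simp
  · rw [rest, pform_sub_right, pform_sub_right, pform_smul_right, pform_smul_right, pform_cv_cv,
      pform_cv_cv, h.form_sMat_self', h.form_sMat_sMat']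
    simp

theorem sMat_mulVec_mem_hyp_of_mem {V : Submodule ℂ (Vec p q)} {e : Vec p q} (h : e ∈ V) :
    (sMat p q).mulVec e ∈ hyp V := Submodule.mem_sup_right (sMat_mulVec_mem_sMap h)

/-- The norm of a vector in terms of its components. -/
theorem IsNext.pform_combination {V : Submodule ℂ (Vec p q)} {e : Vec p q} (h : IsNext V e)
    {w : PVec p q} (hw : ∀ f ∈ hyp (V ⊔ Submodule.span ℂ {e}), pform (cv f) w = 0) (a b : ℂ[X]) :
    pform (b • cv e + w + a • cv ((sMat p q).mulVec e))
      (b • cv e + w + a • cv ((sMat p q).mulVec e)) =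
      pconj b * a + pconj a * b + pform w w := by
  have h1 := hw e (Submodule.mem_sup_left h.mem)
  have h2 := hw _ (sMat_mulVec_mem_hyp_of_mem h.mem)
  simp only [pform_add_left, pform_add_right, pform_smul_left, pform_smul_right, pform_cv_cv,
    h.isotropic, h.form_sMat_sMat', h.form_self_sMat, h.form_sMat_self', h1, h2,
    pform_eq_zero_symm h1, pform_eq_zero_symm h2, map_zero, map_one]
  ring

variable {Γ : Submonoid (Loop p q)} {α : ℝ}

theorem good_of_transv_mul (hm : loopsOf (mFamily p q α) ⊆ (Γ : Set (Loop p q)))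
    (hn : loopsOf (nFamily p q α) ⊆ (Γ : Set (Loop p q))) {V : Submodule ℂ (Vec p q)}
    (hV : IsIsotropic V) {e : Vec p q} (he : e ∈ V) {x : PVec p q}
    (hx : ∀ f ∈ hyp V, pform (cv f) x = 0) (hx0 : evv 0 x = 0) {c : ℂ[X]} (hc : pconj c = -c)
    (hc0 : c.coeff 0 = 0) {P : PMat p q} {d : ℂ[X]} (h : Good Γ α (transv (cv e) x c * P) d) :
    Good Γ α P d := by
  have h1 : Good Γ α (transv (cv e) (-x) (-c)) 1 := by
    refine good_transv hm hn hV he (fun f hf => by rw [pform_neg_right, hx f hf, neg_zero]) ?_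
      (by rw [map_neg, hc]) (by rw [Polynomial.coeff_neg, hc0, neg_zero])
    rw [show -x = (-1 : ℂ[X]) • x by simp, evv_smul, hx0, smul_zero]
  have h2 := transv_mul_transv_neg (e := cv e) (x := -x)
    (by rw [pform_cv_cv, hV e he e he, map_zero])
    (by rw [pform_neg_right, hx e (Submodule.mem_sup_left he), neg_zero]) (-c)
  rw [neg_neg, neg_neg] at h2
  have h3 := h1.mul h
  rwa [← mul_assoc, h2, one_mul, one_mul] at h3

end

/-! ### Polynomial loops -/

section PolynomialLoops

variable {p q : ℕ} {Γ : Submonoid (Loop p q)} {α : ℝ}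

theorem natDegree_combination_le {e : Vec p q} {w : PVec p q} {a b : ℂ[X]} {l : ℕ}
    (ha : a.natDegree ≤ l) (hb : b.natDegree ≤ l) (hw : ∀ i, (w i).natDegree ≤ l) (i) :
    ((b • cv e + w + a • cv ((sMat p q).mulVec e)) i).natDegree ≤ l := by
  refine Polynomial.natDegree_add_le_of_degree_le
    (Polynomial.natDegree_add_le_of_degree_le ?_ (hw i)) ?_
  · exact (Polynomial.natDegree_mul_C_le _ _).trans hb
  · exact (Polynomial.natDegree_mul_C_le _ _).trans ha

theorem transv_combination {V : Submodule ℂ (Vec p q)} {e : Vec p q} (h : IsNext V e)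
    {x w : PVec p q} (hx : ∀ f ∈ hyp (V ⊔ Submodule.span ℂ {e}), pform (cv f) x = 0)
    (hw : ∀ f ∈ hyp (V ⊔ Submodule.span ℂ {e}), pform (cv f) w = 0) (a b c : ℂ[X]) :
    (transv (cv e) x c).mulVec (b • cv e + w + a • cv ((sMat p q).mulVec e)) =
      (b + pform x w + (c - C (1 / 2) * pform x x) * a) • cv e + (w - a • x) +
        a • cv ((sMat p q).mulVec e) := by
  have h1 := hx e (Submodule.mem_sup_left h.mem)
  have h2 := hx _ (sMat_mulVec_mem_hyp_of_mem h.mem)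
  have h3 := hw e (Submodule.mem_sup_left h.mem)
  rw [transv_mulVec]
  simp only [pform_add_right, pform_smul_right, pform_cv_cv, h.isotropic, h.form_self_sMat,
    pform_eq_zero_symm h1, pform_eq_zero_symm h2, h3, map_zero, map_one, mul_zero, mul_one,
    zero_add, add_zero]
  module

theorem evv_mulVec_cv_of_evm {P : PMat p q} (h : evm 0 P = 1) (e : Vec p q) :
    evv 0 (P.mulVec (cv e)) = e := by
  rw [evv_mulVec, h, evv_cv, Matrix.one_mulVec]

theorem coeff_zero_pform (v w : PVec p q) :
    (pform v w).coeff 0 = form (evv 0 v) (evv 0 w) := by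
  rw [Polynomial.coeff_zero_eq_eval_zero, eval_pform, map_zero]

theorem IsNext.evv_rest_eq_zero {V : Submodule ℂ (Vec p q)} {e : Vec p q} (h : IsNext V e)
    {v : PVec p q} {s t : ℂ} (hv : evv 0 v = s • e + t • (sMat p q).mulVec e) :
    evv 0 (rest e v) = 0 := by
  have h1 : evv 0 v = eval 0 (pform (cv ((sMat p q).mulVec e)) v) • e + evv 0 (rest e v) +
      eval 0 (pform (cv e) v) • (sMat p q).mulVec e := by
    conv_lhs => rw [eq_add_rest e v]
    rw [evv_add, evv_add, evv_smul, evv_smul, evv_cv, evv_cv]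
  rw [eval_pform, eval_pform, evv_cv, evv_cv, hv, form_add_right, form_add_right,
    form_smul_right, form_smul_right, form_smul_right, form_smul_right, h.isotropic,
    h.form_self_sMat, h.form_sMat_self', h.form_sMat_sMat'] at h1
  simpa [add_right_comm] using h1

theorem hyp_mono {V V' : Submodule ℂ (Vec p q)} (h : V ≤ V') : hyp V ≤ hyp V' :=
  sup_le_sup h (Submodule.map_mono h)

theorem transv_fixes {e : Vec p q} {x : PVec p q} {c : ℂ[X]} {f : Vec p q}
    (h1 : pform (cv f) x = 0) (h2 : form e f = 0) :
    (transv (cv e) x c).mulVec (cv f) = cv f := by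
  rw [transv_mulVec, pform_eq_zero_symm h1, pform_cv_cv, h2]
  simp

/-- As e is fixed, ⟨e, Pe'⟩ = ⟨e, e'⟩ = 1 and Pe' = ae + w + e'. The transvection along e with x = w
carries this back to e' while still fixing e and V ⊕ sV, so the induction passes to V + ℂe. -/
theorem good_of_fixes_isotropic (hΓ : Γ ≤ (negRealLoops p q).toSubmonoid)
    (hm : loopsOf (mFamily p q α) ⊆ (Γ : Set (Loop p q)))
    (hn : loopsOf (nFamily p q α) ⊆ (Γ : Set (Loop p q))) {V : Submodule ℂ (Vec p q)}
    (hV : IsIsotropic V) {e : Vec p q} (he : IsNext V e)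
    (ih : ∀ {P : PMat p q}, IsUnitaryPair P 1 → evm 0 P = 1 →
      (∀ f ∈ hyp (V ⊔ Submodule.span ℂ {e}), P.mulVec (cv f) = cv f) → Good Γ α P 1)
    {P : PMat p q} (hP : IsUnitaryPair P 1) (hP0 : evm 0 P = 1)
    (hF : ∀ f ∈ hyp V, P.mulVec (cv f) = cv f) (hPe : P.mulVec (cv e) = cv e) :
    Good Γ α P 1 := by
  have hV₁ := he.isIsotropic hV
  have hee : form e e = 0 := he.isotropic
  set e' := (sMat p q).mulVec e with he'
  set v := P.mulVec (cv e') with hv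
  have hev : pform (cv e) v = 1 := by
    rw [hv, hP.pform_fixed one_ne_zero (by rw [hPe, one_smul]), pform_cv_cv, he.form_self_sMat,
      map_one, mul_one]
  have hFv : ∀ f ∈ hyp V, pform (cv f) v = 0 := fun f hf => by
    rw [hv, hP.pform_fixed one_ne_zero (by rw [hF f hf, one_smul]), pform_cv_cv,
      sMat_mulVec_mem_perp_hyp he.mem_perp f hf, map_zero, mul_zero]
  have hv0 : evv 0 v = e' := evv_mulVec_cv_of_evm hP0 e'
  set a := pform (cv e') v with ha
  set w := rest e v with hw
  have hwU := he.pform_rest hFv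
  have hw0 : evv 0 w = 0 := he.evv_rest_eq_zero (s := 0) (t := 1) (by rw [hv0]; simp [he'])
  have hdec : v = a • cv e + w + (1 : ℂ[X]) • cv e' := by
    conv_lhs => rw [eq_add_rest e v, hev]
  have hnorm : pconj a + a + pform w w = 0 := by
    have h1 := hP (cv e') (cv e')
    rw [← hv, pform_cv_cv, he.form_sMat_sMat', hdec, he.pform_combination hwU] at h1
    simpa using h1
  have ha0 : a.coeff 0 = 0 := by
    rw [ha, coeff_zero_pform, hv0, evv_cv, he.form_sMat_sMat']
  have hww0 : (pform w w).coeff 0 = 0 := by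
    rw [coeff_zero_pform, hw0, form_zero_left]
  -- The e-component of the image is a + ⟨w, w⟩/2 + c, which dictates c. It is skew because ⟨v, v⟩ =
  -- 0 reads ā + a + ⟨w, w⟩ = 0.
  have hc : pconj (-a - C (1 / 2) * pform w w) = -(-a - C (1 / 2) * pform w w) := by
    simp only [map_sub, map_neg, map_mul, pconj_pform, pconj_C, map_div₀, map_one, map_ofNat]
    linear_combination -hnorm - pform w w * C_half_add
  have hc0 : (-a - C (1 / 2) * pform w w).coeff 0 = 0 := by
    simp [ha0, hww0, Polynomial.mul_coeff_zero]
  have hT := good_transv (Γ := Γ) (α := α) hm hn hV₁ he.mem hwU hw0 hc hc0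
  refine good_of_transv_mul hm hn hV₁ he.mem hwU hw0 hc hc0 (ih ?_ ?_ ?_)
  · simpa using (hT.isUnitaryPair hΓ one_ne_zero).mul hP
  · rw [evm_mul, hT.evm_zero hΓ (by simp), hP0, one_mul]
  · have h1 : ∀ f ∈ hyp V, (transv (cv e) w (-a - C (1 / 2) * pform w w) * P).mulVec (cv f) =
        (1 : ℂ[X]) • cv f := fun f hf => by
      rw [← Matrix.mulVec_mulVec, hF f hf, one_smul, transv_fixes
        (hwU f (hyp_mono le_sup_left hf))
        (form_eq_zero_symm (he.mem_perp f hf))]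
    have h2 : (transv (cv e) w (-a - C (1 / 2) * pform w w) * P).mulVec (cv e) =
        (1 : ℂ[X]) • cv e := by
      rw [← Matrix.mulVec_mulVec, hPe, one_smul, transv_fixes
        (hwU e (Submodule.mem_sup_left he.mem)) hee]
    have h3 : (transv (cv e) w (-a - C (1 / 2) * pform w w) * P).mulVec (cv e') =
        (1 : ℂ[X]) • cv e' := by
      rw [← Matrix.mulVec_mulVec, ← hv, hdec, transv_combination he hwU hwU]
      have h4 : a + pform w w + (-a - C (1 / 2) * pform w w - C (1 / 2) * pform w w) * 1 = 0 := by
        linear_combination -pform w w * C_half_add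
      rw [h4, one_smul, sub_self, zero_smul, zero_add, zero_add]
    intro f hf
    rw [mulVec_hyp_sup_span h1 h2 h3 f hf, one_smul]

/-- Euclidean algorithm on v = Pe₀. Its leading coefficient is isotropic, since ⟨v, v⟩ = 0; let e be
its unit multiple and v = be + w + ae'. Then only b reaches the top degree, and transvections along
e preserve a, replace w by w - ax and change b by ⟨x, w⟩ + (c - ⟨x, x⟩/2)a. Their parameters are
chosen to lower the degree of b without letting a or w regain the top degree. -/
theorem good_of_natDegree_le (hΓ : Γ ≤ (negRealLoops p q).toSubmonoid)
    (hm : loopsOf (mFamily p q α) ⊆ (Γ : Set (Loop p q)))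
    (hn : loopsOf (nFamily p q α) ⊆ (Γ : Set (Loop p q))) {V : Submodule ℂ (Vec p q)}
    (hV : IsIsotropic V) {e₀ : Vec p q} (he₀ : IsNext V e₀)
    (ih : ∀ {P : PMat p q}, IsUnitaryPair P 1 → evm 0 P = 1 →
      (∀ f ∈ hyp V, P.mulVec (cv f) = cv f) → P.mulVec (cv e₀) = cv e₀ → Good Γ α P 1) :
    ∀ (k : ℕ) {P : PMat p q}, IsUnitaryPair P 1 → evm 0 P = 1 →
      (∀ f ∈ hyp V, P.mulVec (cv f) = cv f) → (∀ i, (P.mulVec (cv e₀) i).natDegree ≤ k) →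
      Good Γ α P 1 := by
  intro k
  induction k using Nat.strong_induction_on with
  | _ k ihk =>
  intro P hP hP0 hF hdeg
  rcases k with _ | k
  · refine ih hP hP0 hF ?_
    rw [eq_cv_of_natDegree hdeg, evv_mulVec_cv_of_evm hP0]
  set v := P.mulVec (cv e₀) with hv
  by_cases hu0 : pcoeff v (k + 1) = 0
  · exact ihk k (by omega) hP hP0 hF (natDegree_le_pred hdeg hu0)
  have hFv : ∀ f ∈ hyp V, pform (cv f) v = 0 := fun f hf => by
    rw [hv, hP.pform_fixed one_ne_zero (by rw [hF f hf, one_smul]), pform_cv_cv,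
      he₀.mem_perp f hf, map_zero, mul_zero]
  have hvv : pform v v = 0 := by
    rw [hv, hP, pform_cv_cv, he₀.isotropic, map_zero, mul_zero]
  have huu : form (pcoeff v (k + 1)) (pcoeff v (k + 1)) = 0 := by
    rw [← coeff_pform_top hdeg hdeg, hvv, Polynomial.coeff_zero]
  obtain ⟨e, t, he, hut⟩ := exists_isNext (pcoeff_mem_perp hFv _) huu hu0
  have hV₁ := he.isIsotropic hV
  -- reduction to a smaller degree by a transvection in the direction of the leading coefficient
  have hred : ∀ (x : PVec p q) (c : ℂ[X]),
      (∀ f ∈ hyp (V ⊔ Submodule.span ℂ {e}), pform (cv f) x = 0) → evv 0 x = 0 → pconj c = -c →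
      c.coeff 0 = 0 → ∀ {Q : PMat p q}, IsUnitaryPair Q 1 → evm 0 Q = 1 →
      (∀ f ∈ hyp V, Q.mulVec (cv f) = cv f) →
      IsUnitaryPair (transv (cv e) x c * Q) 1 ∧ evm 0 (transv (cv e) x c * Q) = 1 ∧
        ∀ f ∈ hyp V, (transv (cv e) x c * Q).mulVec (cv f) = cv f := by
    intro x c hx hx0 hc hc0 Q hQ hQ0 hQF
    have hT := good_transv (Γ := Γ) (α := α) hm hn hV₁ he.mem hx hx0 hc hc0
    refine ⟨by simpa using (hT.isUnitaryPair hΓ one_ne_zero).mul hQ,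
      by rw [evm_mul, hT.evm_zero hΓ (by simp), hQ0, one_mul], fun f hf => ?_⟩
    rw [← Matrix.mulVec_mulVec, hQF f hf, transv_fixes
      (hx f (hyp_mono le_sup_left hf))
      (form_eq_zero_symm (he.mem_perp f hf))]
  set e' := (sMat p q).mulVec e with he'
  set a := pform (cv e) v with ha
  set b := pform (cv e') v with hb
  set w := rest e v with hw
  have hwU := he.pform_rest hFv
  have hdec : v = b • cv e + w + a • cv e' := eq_add_rest e v
  -- The coefficient of degree k + 1 is a multiple of ⟨e, e⟩ = 0.
  have hadeg : a.natDegree ≤ k := by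
    refine Polynomial.natDegree_le_iff_coeff_eq_zero.2 fun n hn => ?_
    rw [ha, coeff_pform_cv]
    rcases Nat.lt_or_ge (k + 1) n with h | h
    · have : pcoeff v n = 0 := funext fun i =>
        Polynomial.coeff_eq_zero_of_natDegree_lt ((hdeg i).trans_lt h)
      rw [this, form_zero_right]
    · rw [show n = k + 1 by omega, hut, form_smul_right, he.isotropic, mul_zero]
  have hbdeg : b.natDegree ≤ k + 1 := by
    refine Polynomial.natDegree_le_iff_coeff_eq_zero.2 fun n hn => ?_
    have : pcoeff v n = 0 := funext fun i =>
      Polynomial.coeff_eq_zero_of_natDegree_lt ((hdeg i).trans_lt hn)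
    rw [hb, coeff_pform_cv, this, form_zero_right]
  have hwco : ∀ n, pcoeff w n = pcoeff v n - b.coeff n • e - a.coeff n • e' := fun n => by
    ext i
    simp [hw, rest, pcoeff, cv, ← hb, ← ha, ← he']
  have hwdeg : ∀ i, (w i).natDegree ≤ k := by
    refine natDegree_le_pred (fun i => ?_) ?_
    · refine Polynomial.natDegree_le_iff_coeff_eq_zero.2 fun n hn => ?_
      have h1 := congrFun (hwco n) i
      have h2 := Polynomial.coeff_eq_zero_of_natDegree_lt ((hdeg i).trans_lt hn)
      have h3 := Polynomial.coeff_eq_zero_of_natDegree_lt (hbdeg.trans_lt hn)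
      have h4 := Polynomial.coeff_eq_zero_of_natDegree_lt (hadeg.trans_lt (show k < n by omega))
      simpa [pcoeff, h2, h3, h4] using h1
    · rw [hwco, Polynomial.coeff_eq_zero_of_natDegree_lt (hadeg.trans_lt (Nat.lt_succ_self k)),
        hb, coeff_pform_cv, hut, form_smul_right, he.form_sMat_self']
      simp
  by_cases ha0 : a = 0
  · have hvw : v = b • cv e + w := by
      conv_lhs => rw [hdec, ha0, zero_smul, add_zero]
    have hww : pform w w = 0 := by
      have h1 := hvv
      rw [hdec, he.pform_combination hwU, ha0] at h1
      simpa using h1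
    by_cases hw0 : w = 0
    · -- the vector is a multiple of a constant one
      refine ihk 0 (Nat.succ_pos k) hP hP0 hF fun i => ?_
      -- Pairing v = be with the image of se₀ gives b̄ times a polynomial equal to 1, so b is
      -- constant.
      have h1 := hP (cv e₀) (cv ((sMat p q).mulVec e₀))
      rw [← hv, hvw, hw0, add_zero, pform_smul_left, pform_cv_cv, he₀.form_self_sMat] at h1
      simp only [map_one, mul_one] at h1
      have h2 := congrArg Polynomial.natDegree h1
      have h3 : pconj b ≠ 0 := left_ne_zero_of_mul_eq_one h1
      rw [Polynomial.natDegree_mul h3 (right_ne_zero_of_mul_eq_one h1), Polynomial.natDegree_one,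
        natDegree_pconj] at h2
      rw [← hv, hvw, hw0, add_zero]
      refine (Polynomial.natDegree_mul_C_le _ _).trans ?_
      omega
    · obtain ⟨l, hl, hlk, hltop⟩ : ∃ l, (∀ i, (w i).natDegree ≤ l) ∧ l ≤ k ∧ pcoeff w l ≠ 0 := by
        classical
        let H : ∃ l, ∀ i, (w i).natDegree ≤ l := ⟨k, hwdeg⟩
        refine ⟨Nat.find H, Nat.find_spec H, Nat.find_min' H hwdeg, fun h0 => ?_⟩
        rcases hf : Nat.find H with _ | l
        · have h1 := Nat.find_spec H
          rw [hf] at h1 h0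
          apply hw0
          rw [eq_cv_of_natDegree h1, evv_zero_eq_pcoeff, h0, cv_zero]
        · have h1 := Nat.find_spec H
          rw [hf] at h1 h0
          have h2 := Nat.find_min' H (natDegree_le_pred h1 h0)
          omega
      set u := pcoeff w l with hu
      have huW : u ∈ perp (hyp (V ⊔ Submodule.span ℂ {e})) := pcoeff_mem_perp hwU l
      -- Here a = 0, so b can change only through ⟨x, w⟩. Pairing w with s applied to its leading
      -- coefficient u gives degree exactly l, as ⟨su, u⟩ = |u|² ≠ 0; taking x = f̄ su adds fg to b.
      set g := pform (cv ((sMat p q).mulVec u)) w with hg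
      have hgl : g.coeff l ≠ 0 := by
        rw [hg, coeff_pform_cv, ← hu, form_sMat_left]
        exact fun h0 => hltop (form_sMat_self_eq_zero h0)
      have hgdeg : g.natDegree ≤ l := by
        refine Polynomial.natDegree_le_iff_coeff_eq_zero.2 fun n hn => ?_
        have : pcoeff w n = 0 := funext fun i =>
          Polynomial.coeff_eq_zero_of_natDegree_lt ((hl i).trans_lt hn)
        rw [hg, coeff_pform_cv, this, form_zero_right]
      obtain ⟨f, hf0, hfdeg⟩ := exists_natDegree_add_mul_le b (g := g)
        (fun h0 => hgl (by rw [h0, Polynomial.coeff_zero]))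
      have hxU : ∀ y ∈ hyp (V ⊔ Submodule.span ℂ {e}),
          pform (cv y) (pconj f • cv ((sMat p q).mulVec u)) = 0 := fun y hy => by
        rw [pform_smul_right, pform_cv_cv, sMat_mulVec_mem_perp_hyp huW y hy, map_zero, mul_zero]
      have hx0 : evv 0 (pconj f • cv ((sMat p q).mulVec u)) = 0 := by
        rw [evv_smul, ← Polynomial.coeff_zero_eq_eval_zero, coeff_pconj, hf0, map_zero, zero_smul]
      obtain ⟨r1, r2, r3⟩ := hred _ 0 hxU hx0 (by simp) rfl hP hP0 hF
      refine good_of_transv_mul hm hn hV₁ he.mem hxU hx0 (c := 0) (by simp) rfl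
        (ihk l (by omega) r1 r2 r3 fun i => ?_)
      rw [← Matrix.mulVec_mulVec, ← hv, hdec, transv_combination he hxU hwU, ha0]
      refine natDegree_combination_le (by simp) ?_ (by simpa using hl) i
      rw [pform_smul_left, pconj_pconj, mul_zero, add_zero]
      exact hfdeg.trans hgdeg
  · obtain ⟨x, hxU, hx0, hxdeg⟩ := exists_natDegree_sub_smul_le ha0 k w hwU
      (fun i => (hwdeg i).trans (Nat.le_add_left _ _))
    obtain ⟨r1, r2, r3⟩ := hred x 0 hxU hx0 (by simp) rfl hP hP0 hF
    have hv₁ : (transv (cv e) x 0 * P).mulVec (cv e₀) =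
        (b + pform x w + (0 - C (1 / 2) * pform x x) * a) • cv e + (w - a • x) + a • cv e' := by
      rw [← Matrix.mulVec_mulVec, ← hv]
      conv_lhs => rw [hdec]
      exact transv_combination he hxU hwU _ _ _
    set b₁ := b + pform x w + (0 - C (1 / 2) * pform x x) * a with hb₁
    have hw₁U : ∀ f ∈ hyp (V ⊔ Submodule.span ℂ {e}), pform (cv f) (w - a • x) = 0 :=
      fun f hf => by rw [pform_sub_right, pform_smul_right, hwU f hf, hxU f hf]; simp
    have hnorm : pconj b₁ * a + pconj a * b₁ + pform (w - a • x) (w - a • x) = 0 := by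
      rw [← he.pform_combination hw₁U, ← he', ← hv₁, r1, pform_cv_cv, he₀.isotropic, map_zero,
        mul_zero]
    -- With the degree of w - ax at most deg a, the norm relation bounds b̄₁a + āb₁ by 2 deg a, so a
    -- central transvection brings b₁ down to degree deg a ≤ k.
    obtain ⟨c, hc, hc0, hcdeg⟩ := exists_skew_natDegree_add_mul_le (b := b₁) ha0 (by
      rw [eq_neg_of_add_eq_zero_left hnorm, Polynomial.natDegree_neg]
      exact natDegree_pform_le hxdeg hxdeg)
    have h0U : ∀ f ∈ hyp (V ⊔ Submodule.span ℂ {e}), pform (cv f) (0 : PVec p q) = 0 :=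
      fun f _ => pform_zero_right _
    have h00 : evv 0 (0 : PVec p q) = 0 := by ext i; simp [evv]
    obtain ⟨s1, s2, s3⟩ := hred 0 c h0U h00 hc hc0 r1 r2 r3
    refine good_of_transv_mul hm hn hV₁ he.mem hxU hx0 (c := 0) (by simp) rfl
      (good_of_transv_mul hm hn hV₁ he.mem h0U h00 hc hc0
        (ihk k (Nat.lt_succ_self k) s1 s2 s3 fun i => ?_))
    rw [← Matrix.mulVec_mulVec, hv₁, transv_combination he h0U hw₁U]
    refine natDegree_combination_le hadeg ?_ (fun j => ?_) i
    · rw [pform_zero_left, pform_zero_left, mul_zero, sub_zero, add_zero]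
      exact hcdeg.trans hadeg
    · rw [smul_zero, sub_zero]
      exact (hxdeg j).trans hadeg

/-- Induction on the room left for V: each isotropic e in the complement enlarges V, and the process
stops at an anisotropic complement, where P = 1. -/
theorem good_polynomial_of_finrank (hΓ : Γ ≤ (negRealLoops p q).toSubmonoid)
    (hm : loopsOf (mFamily p q α) ⊆ (Γ : Set (Loop p q)))
    (hn : loopsOf (nFamily p q α) ⊆ (Γ : Set (Loop p q))) :
    ∀ (m : ℕ) {V : Submodule ℂ (Vec p q)}, IsIsotropic V → p + q ≤ Module.finrank ℂ V + m →
      ∀ {P : PMat p q}, IsUnitaryPair P 1 → evm 0 P = 1 →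
      (∀ f ∈ hyp V, P.mulVec (cv f) = cv f) → Good Γ α P 1 := by
  intro m
  induction m with
  | zero =>
    intro V hV hdim P hP hP0 hF
    by_cases hW : IsAnisotropic (perp (hyp V))
    · rw [eq_one_of_isAnisotropic hV hW hP hP0 hF]
      exact Good.one Γ α
    · simp only [IsAnisotropic, not_forall] at hW
      -- Impossible here: V already has full dimension, but e would enlarge it.
      obtain ⟨u, hu, huu, hu0⟩ := hW
      obtain ⟨e, -, he, -⟩ := exists_isNext hu huu hu0
      have h1 := he.finrank_lt hV
      have h2 := (V ⊔ Submodule.span ℂ {e} : Submodule ℂ (Vec p q)).finrank_le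
      have h3 : Module.finrank ℂ (Vec p q) = p + q := by simp
      omega
  | succ m ih =>
    intro V hV hdim P hP hP0 hF
    by_cases hW : IsAnisotropic (perp (hyp V))
    · rw [eq_one_of_isAnisotropic hV hW hP hP0 hF]
      exact Good.one Γ α
    · simp only [IsAnisotropic, not_forall] at hW
      obtain ⟨u, hu, huu, hu0⟩ := hW
      obtain ⟨e, -, he, -⟩ := exists_isNext hu huu hu0
      have h1 := he.finrank_lt hV
      obtain ⟨k, hk⟩ := exists_natDegree_le (P.mulVec (cv e))
      refine good_of_natDegree_le hΓ hm hn hV he (fun hP hP0 hF hPe => ?_) k hP hP0 hF hk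
      refine good_of_fixes_isotropic hΓ hm hn hV he (fun hP hP0 hF => ?_) hP hP0 hF hPe
      exact ih (he.isIsotropic hV) (by omega) hP hP0 hF

theorem good_polynomial (hΓ : Γ ≤ (negRealLoops p q).toSubmonoid)
    (hm : loopsOf (mFamily p q α) ⊆ (Γ : Set (Loop p q)))
    (hn : loopsOf (nFamily p q α) ⊆ (Γ : Set (Loop p q)))
    {P : PMat p q} (hP : IsUnitaryPair P 1) (hP0 : evm 0 P = 1) : Good Γ α P 1 := by
  refine good_polynomial_of_finrank hΓ hm hn (p + q) (V := ⊥) ?_ (by omega) hP hP0 ?_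
  · rintro v rfl w rfl
    simp
  · intro f hf
    have : f = 0 := by simpa [hyp, sMap] using hf
    simp [this]

end PolynomialLoops

/-! ### Torus elements -/

section Torus

variable {p q : ℕ}

/-- `a a^* π_e + π_{se} + a^* (1 - π_e - π_{se})` for a hyperbolic pair `(e, se)`. -/
noncomputable def torus (e : Vec p q) (a : ℂ[X]) : PMat p q :=
  (a * pconj a) • cm (rankOne e ((sMat p q).mulVec e)) + cm (rankOne ((sMat p q).mulVec e) e) +
    pconj a • cm (1 - rankOne e ((sMat p q).mulVec e) - rankOne ((sMat p q).mulVec e) e)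

theorem torus_mulVec (e : Vec p q) (a : ℂ[X]) (v : PVec p q) : (torus e a).mulVec v =
    (a * pconj a * pform (cv ((sMat p q).mulVec e)) v) • cv e + pconj a • rest e v +
      pform (cv e) v • cv ((sMat p q).mulVec e) := by
  rw [torus, cm_sub, cm_sub, cm_one, ← prank_cv_cv, ← prank_cv_cv]
  simp only [Matrix.add_mulVec, Matrix.smul_mulVec, Matrix.sub_mulVec, Matrix.one_mulVec,
    prank_mulVec, rest, smul_smul]
  module

theorem IsNext.sMat {V : Submodule ℂ (Vec p q)} {e : Vec p q} (h : IsNext V e) :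
    IsNext V ((sMat p q).mulVec e) where
  mem_perp := sMat_mulVec_mem_perp_hyp h.mem_perp
  isotropic := h.form_sMat_sMat'
  nsq_eq_one := by
    rw [← h.nsq_eq_one]
    simp [nsq]

variable {V : Submodule ℂ (Vec p q)} {e : Vec p q}

theorem torus_combination (h : IsNext V e) {w : PVec p q} (h1 : pform (cv e) w = 0)
    (h2 : pform (cv ((sMat p q).mulVec e)) w = 0) (a x y : ℂ[X]) :
    (torus e a).mulVec (x • cv e + w + y • cv ((sMat p q).mulVec e)) =
      (a * pconj a * x) • cv e + pconj a • w + y • cv ((sMat p q).mulVec e) := by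
  rw [torus_mulVec, rest]
  simp only [pform_add_right, pform_smul_right, pform_cv_cv, h.isotropic, h.form_self_sMat,
    h.form_sMat_self', h.form_sMat_sMat', h1, h2, map_zero, map_one, mul_zero, mul_one, add_zero,
    zero_add]
  module

theorem torus_combination' (h : IsNext V e) {w : PVec p q} (h1 : pform (cv e) w = 0)
    (h2 : pform (cv ((sMat p q).mulVec e)) w = 0) (a x y : ℂ[X]) :
    (torus ((sMat p q).mulVec e) a).mulVec (x • cv e + w + y • cv ((sMat p q).mulVec e)) =
      x • cv e + pconj a • w + (a * pconj a * y) • cv ((sMat p q).mulVec e) := by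
  have h3 := torus_combination h.sMat h2 (by rwa [sMat_mulVec_sMat_mulVec]) a y x
  rw [sMat_mulVec_sMat_mulVec] at h3
  rw [show x • cv e + w + y • cv ((UpqLoop.sMat p q).mulVec e) =
    y • cv ((UpqLoop.sMat p q).mulVec e) + w + x • cv e by abel, h3]
  abel

theorem torus_fixes (h : IsNext V e) {f : Vec p q} (hf : f ∈ hyp V) (a : ℂ[X]) :
    (torus e a).mulVec (cv f) = pconj a • cv f := by
  have h1 : pform (cv e) (cv f) = 0 := by
    rw [pform_cv_cv, form_eq_zero_symm (h.mem_perp f hf), map_zero]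
  have h2 : pform (cv ((UpqLoop.sMat p q).mulVec e)) (cv f) = 0 := by
    rw [pform_cv_cv, form_eq_zero_symm (h.sMat.mem_perp f hf), map_zero]
  have h3 := torus_combination h h1 h2 a 0 0
  simpa using h3

theorem IsNext.rest_orthogonal (h : IsNext V e) (v : PVec p q) :
    pform (cv e) (rest e v) = 0 ∧ pform (cv ((UpqLoop.sMat p q).mulVec e)) (rest e v) = 0 := by
  constructor <;>
  · simp only [rest, pform_sub_right, pform_smul_right, pform_cv_cv, h.isotropic,
      h.form_self_sMat, h.form_sMat_self', h.form_sMat_sMat', map_zero, map_one]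
    ring

theorem torus_mul_torus (h : IsNext V e) (a b : ℂ[X]) :
    torus e a * torus e b = torus e (a * b) := by
  refine Matrix.mulVec_injective (funext fun v => ?_)
  obtain ⟨h1, h2⟩ := h.rest_orthogonal v
  rw [← Matrix.mulVec_mulVec]
  conv_lhs => rw [eq_add_rest e v]
  conv_rhs => rw [eq_add_rest e v]
  rw [torus_combination h h1 h2, torus_combination h h1 h2, torus_combination h
    (by rw [pform_smul_right, h1, mul_zero]) (by rw [pform_smul_right, h2, mul_zero]), smul_smul,
    map_mul]
  congr 3
  ring

/-- After division by ā, `torus e a` is (a, 1, 1/ā) on e, rest, se. Interchanging e and se and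
conjugating a gives its inverse. -/
theorem torus_mul_torus_inv (h : IsNext V e) (a : ℂ[X]) :
    torus e a * torus ((UpqLoop.sMat p q).mulVec e) (pconj a) = (pconj a * a) • 1 := by
  refine Matrix.mulVec_injective (funext fun v => ?_)
  obtain ⟨h1, h2⟩ := h.rest_orthogonal v
  rw [← Matrix.mulVec_mulVec, Matrix.smul_mulVec, Matrix.one_mulVec]
  conv_lhs => rw [eq_add_rest e v]
  conv_rhs => rw [eq_add_rest e v]
  rw [torus_combination' h h1 h2, torus_combination h
    (by rw [pform_smul_right, h1, mul_zero]) (by rw [pform_smul_right, h2, mul_zero]), pconj_pconj]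
  module

theorem torus_one (h : IsNext V e) : torus e 1 = 1 := by
  refine Matrix.mulVec_injective (funext fun v => ?_)
  obtain ⟨h1, h2⟩ := h.rest_orthogonal v
  rw [Matrix.one_mulVec]
  conv_lhs => rw [eq_add_rest e v]
  conv_rhs => rw [eq_add_rest e v]
  rw [torus_combination h h1 h2]
  simp

theorem isInternal_hyp {L : Submodule ℂ (Vec p q)} (hL : IsIsotropic L) :
    DirectSum.IsInternal ![L, perp (L ⊔ sMap L), sMap L] := by
  rw [DirectSum.isInternal_submodule_iff_iSupIndep_and_iSup_eq_top]
  refine ⟨fun i => ?_, ?_⟩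
  · fin_cases i
    · refine (isCompl_left_hyp hL).disjoint.mono_right (iSup₂_le fun j hj => ?_)
      fin_cases j
      · exact absurd rfl hj
      · exact le_sup_left
      · exact le_sup_right
    · refine (isCompl_hyp hL).symm.disjoint.mono_right (iSup₂_le fun j hj => ?_)
      fin_cases j
      · exact le_sup_left
      · exact absurd rfl hj
      · exact le_sup_right
    · refine (isCompl_right_hyp hL).disjoint.mono_right (iSup₂_le fun j hj => ?_)
      fin_cases j
      · exact le_sup_left
      · exact le_sup_right
      · exact absurd rfl hj
  · refine top_le_iff.1 ((isCompl_left_hyp hL).sup_eq_top.ge.trans (sup_le ?_ (sup_le ?_ ?_)))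
    · exact le_iSup (![L, perp (L ⊔ sMap L), sMap L]) 0
    · exact le_iSup (![L, perp (L ⊔ sMap L), sMap L]) 1
    · exact le_iSup (![L, perp (L ⊔ sMap L), sMap L]) 2

theorem proj_span (h : IsNext V e) (hL : IsIsotropic (Submodule.span ℂ {e})) :
    proj (Submodule.span ℂ {e}) (perp (hyp (Submodule.span ℂ {e})) ⊔ sMap (Submodule.span ℂ {e})) =
      rankOne e ((UpqLoop.sMat p q).mulVec e) := by
  refine proj_eq_of (isCompl_left_hyp hL) (fun v hv => ?_) fun u hu => ?_
  · obtain ⟨t, rfl⟩ := Submodule.mem_span_singleton.1 hv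
    rw [rankOne_mulVec, form_smul_right, h.form_sMat_self', mul_one]
  · obtain ⟨w, hw, y, hy, rfl⟩ := Submodule.mem_sup.1 hu
    obtain ⟨t, ht⟩ := Submodule.mem_span_singleton.1 (mem_sMap.1 hy)
    have he := Submodule.mem_span_singleton_self (R := ℂ) e
    rw [rankOne_mulVec, form_add_right, hw _ (sMat_mulVec_mem_hyp_of_mem he), form_sMat_left, ← ht,
      form_smul_right, h.isotropic]
    simp

variable {Γ : Submonoid (Loop p q)} {α : ℝ}

/-- For q with zero α + 1/r and pole α on the line of e, (λ - α - 1/r)/(λ - α) = 1 - z/r, which is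
`lin r`; on se the factor is the inverse of its conjugate. -/
theorem good_torus_lin (hq : loopsOf (qFamily p q) ⊆ (Γ : Set (Loop p q))) (h : IsNext V e)
    {r : ℂ} (hr : r ≠ 0) : Good Γ α (torus e (lin r)) (pconj (lin r)) := by
  set L := Submodule.span ℂ {e} with hLdef
  have hL : IsIsotropic L := by
    intro x hx y hy
    obtain ⟨s, rfl⟩ := Submodule.mem_span_singleton.1 hx
    obtain ⟨t, rfl⟩ := Submodule.mem_span_singleton.1 hy
    rw [form_smul_left, form_smul_right, h.isotropic, mul_zero, mul_zero]
  have hf : qElt (α + r⁻¹) α L ∈ qFamily p q :=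
    ⟨α + r⁻¹, α, L, by simpa using hr, hL, isInternal_hyp hL, rfl⟩
  refine good_of_family hq hf (exists_mem_of_qFamily hf) ?_
  filter_upwards [eventually_ne_cofinite (α : ℂ), eventually_ne_cofinite (α + conj r⁻¹ : ℂ)]
    with l h1 h2
  have k1 : l - α ≠ 0 := sub_ne_zero.2 h1
  have k2 : l - α - conj r⁻¹ ≠ 0 := by rw [sub_sub]; exact sub_ne_zero.2 h2
  have e1 : (l - (α + r⁻¹)) / (l - α) = eval (l - α)⁻¹ (lin r) := by
    rw [eval_lin, ← div_eq_mul_inv, ← sub_sub, sub_div, div_self k1]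
  have e2 : (l - conj (α : ℂ)) / (l - conj (α + r⁻¹)) = (eval (l - α)⁻¹ (pconj (lin r)))⁻¹ := by
    rw [pconj_lin, eval_lin, ← div_eq_mul_inv, map_add, Complex.conj_ofReal, ← sub_sub,
      ← map_inv₀, ← div_self k1, ← sub_div, inv_div]
  have e3 : eval (l - α)⁻¹ (pconj (lin r)) ≠ 0 := by
    rw [pconj_lin, eval_lin, ← div_eq_mul_inv, ← map_inv₀, ← div_self k1, ← sub_div]
    exact div_ne_zero k2 k1
  rw [qElt_eq hL, e1, e2, ← adj_proj_left_hyp hL, proj_span h hL, adj_rankOne, pairFun, torus,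
    evm_add, evm_add, evm_smul, evm_smul, evm_cm, evm_cm, evm_cm, Polynomial.eval_mul]
  generalize eval (l - α)⁻¹ (pconj (lin r)) = y at e3
  generalize eval (l - α)⁻¹ (lin r) = x
  match_scalars
  · field_simp
  · field_simp
    ring
  · field_simp
    ring

theorem good_torus (hq : loopsOf (qFamily p q) ⊆ (Γ : Set (Loop p q))) (h : IsNext V e) :
    ∀ (n : ℕ) {a : ℂ[X]}, a.natDegree ≤ n → eval 0 a = 1 → Good Γ α (torus e a) (pconj a) := by
  intro n
  induction n with
  | zero =>
    intro a hn h0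
    have ha : a = 1 := by
      rw [Polynomial.eq_C_of_natDegree_le_zero hn, Polynomial.coeff_zero_eq_eval_zero, h0, map_one]
    rw [ha, torus_one h, map_one]
    exact Good.one Γ α
  | succ n ih =>
    intro a hn h0
    rcases Nat.lt_or_ge n a.natDegree with hlt | hle
    swap
    · exact ih hle h0
    obtain ⟨r, hr⟩ := IsAlgClosed.exists_root a fun hd => by
      have := Polynomial.natDegree_eq_zero_iff_degree_le_zero.2 hd.le
      omega
    have hr : eval r a = 0 := hr
    have hr0 : r ≠ 0 := by
      rintro rfl
      rw [h0] at hr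
      exact one_ne_zero hr
    obtain ⟨a', rfl⟩ := lin_dvd hr0 hr
    have ha' : a' ≠ 0 := by
      rintro rfl
      simp at h0
    rw [Polynomial.natDegree_mul (lin_ne_zero r) ha', natDegree_lin hr0] at hn
    have h1 := (good_torus_lin (α := α) hq h hr0).mul
      (ih (a := a') (by omega) (by simpa using h0))
    rwa [torus_mul_torus h, ← map_mul] at h1

theorem good_torus' (hq : loopsOf (qFamily p q) ⊆ (Γ : Set (Loop p q))) (h : IsNext V e)
    {a : ℂ[X]} (h0 : eval 0 a = 1) : Good Γ α (torus e a) (pconj a) :=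
  good_torus hq h a.natDegree le_rfl h0

end Torus

/-! ### Rational loops -/

section RationalLoops

variable {p q : ℕ} {Γ : Submonoid (Loop p q)} {α : ℝ} {V : Submodule ℂ (Vec p q)} {e : Vec p q}

theorem eval_zero_pconj {a : ℂ[X]} (h : eval 0 a = 1) : eval 0 (pconj a) = 1 := by
  rw [eval_pconj, map_zero, h, map_one]

theorem ne_zero_of_eval {a : ℂ[X]} (h : eval 0 a = 1) : a ≠ 0 := fun h0 => by
  simp [h0] at h

/-- `P / d` is normalized, unitary, and trivial on `V ⊕ sV`. -/
structure IsTrivialOn (V : Submodule ℂ (Vec p q)) (P : PMat p q) (d : ℂ[X]) : Prop where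
  unitary : IsUnitaryPair P d
  eval_den : eval 0 d = 1
  evm_num : evm 0 P = 1
  fixes : ∀ f ∈ hyp V, P.mulVec (cv f) = d • cv f

theorem IsTrivialOn.mul {P Q : PMat p q} {d d' : ℂ[X]} (h : IsTrivialOn V P d)
    (h' : IsTrivialOn V Q d') : IsTrivialOn V (P * Q) (d * d') where
  unitary := h.unitary.mul h'.unitary
  eval_den := by rw [Polynomial.eval_mul, h.eval_den, h'.eval_den, one_mul]
  evm_num := by rw [evm_mul, h.evm_num, h'.evm_num, one_mul]
  fixes f hf := by
    rw [← Matrix.mulVec_mulVec, h'.fixes f hf, Matrix.mulVec_smul, h.fixes f hf, smul_smul,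
      mul_comm]

theorem IsTrivialOn.of_good (hΓ : Γ ≤ (negRealLoops p q).toSubmonoid) {P : PMat p q} {d : ℂ[X]}
    (h : Good Γ α P d) (hd : eval 0 d = 1) (hF : ∀ f ∈ hyp V, P.mulVec (cv f) = d • cv f) :
    IsTrivialOn V P d :=
  ⟨h.isUnitaryPair hΓ (ne_zero_of_eval hd), hd, h.evm_zero hΓ hd, hF⟩

theorem isTrivialOn_torus (hΓ : Γ ≤ (negRealLoops p q).toSubmonoid)
    (hq : loopsOf (qFamily p q) ⊆ (Γ : Set (Loop p q))) (he : IsNext V e) {a : ℂ[X]}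
    (ha : eval 0 a = 1) : IsTrivialOn V (torus e a) (pconj a) :=
  .of_good (α := 0) hΓ (good_torus' hq he ha) (eval_zero_pconj ha) fun _ hf => torus_fixes he hf a

theorem IsTrivialOn.pform_eq_zero {P : PMat p q} {d : ℂ[X]} (h : IsTrivialOn V P d) {x : Vec p q}
    (hx : x ∈ perp (hyp V)) : ∀ f ∈ hyp V, pform (cv f) (P.mulVec (cv x)) = 0 := fun f hf => by
  rw [h.unitary.pform_fixed (ne_zero_of_eval h.eval_den) (h.fixes f hf), pform_cv_cv, hx f hf,
    map_zero, mul_zero]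

/-- As e is fixed, the e'-component of Pe' is d. A torus element clears d from it, a transvection
along e removes the remaining components, and a torus element along e' restores the scale. -/
theorem good_of_fixes_isotropic' (hΓ : Γ ≤ (negRealLoops p q).toSubmonoid)
    (hm : loopsOf (mFamily p q α) ⊆ (Γ : Set (Loop p q)))
    (hn : loopsOf (nFamily p q α) ⊆ (Γ : Set (Loop p q)))
    (hq : loopsOf (qFamily p q) ⊆ (Γ : Set (Loop p q)))
    (hV : IsIsotropic V) (he : IsNext V e)
    (ih : ∀ {P : PMat p q} {d : ℂ[X]}, IsTrivialOn (V ⊔ Submodule.span ℂ {e}) P d → Good Γ α P d)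
    {P : PMat p q} {d : ℂ[X]} (hP : IsTrivialOn V P d) (hPe : P.mulVec (cv e) = d • cv e) :
    Good Γ α P d := by
  have hV₁ := he.isIsotropic hV
  have hd := hP.eval_den
  have hd' := eval_zero_pconj hd
  have hdne := ne_zero_of_eval hd
  have hdne' := ne_zero_of_eval hd'
  set e' := (sMat p q).mulVec e with he'
  set v := P.mulVec (cv e') with hv
  have hev : pform (cv e) v = d := by
    rw [hv, hP.unitary.pform_fixed hdne hPe, pform_cv_cv, he.form_self_sMat, map_one, mul_one]
  have hFv := hP.pform_eq_zero he.sMat.mem_perp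
  have hv0 : evv 0 v = e' := evv_mulVec_cv_of_evm hP.evm_num e'
  set a := pform (cv e') v with ha
  set w := rest e v with hw
  have hwU := he.pform_rest hFv
  have hw0 : evv 0 w = 0 := he.evv_rest_eq_zero (s := 0) (t := 1) (by rw [hv0]; simp [he'])
  obtain ⟨hw1, hw2⟩ := he.rest_orthogonal v
  have hdec : v = a • cv e + w + d • cv e' := by
    conv_lhs => rw [eq_add_rest e v, hev]
  have hnorm : pconj a * d + pconj d * a + pform w w = 0 := by
    have h1 := hP.unitary (cv e') (cv e')
    rw [← hv, pform_cv_cv, he.form_sMat_sMat', hdec, he.pform_combination hwU] at h1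
    simpa using h1
  have ha0 : a.coeff 0 = 0 := by
    rw [ha, coeff_zero_pform, hv0, evv_cv, he.form_sMat_sMat']
  have hww0 : (pform w w).coeff 0 = 0 := by
    rw [coeff_zero_pform, hw0, form_zero_left]
  -- After the first torus element v is d times d̄a e + w + e', so the transvection must cancel d̄a
  -- + ⟨w, w⟩/2. Isotropy of v makes c skew.
  set c : ℂ[X] := -(a * pconj d + C (1 / 2) * pform w w) with hcdef
  have hc : pconj c = -c := by
    simp only [hcdef, map_add, map_neg, map_mul, pconj_pform, pconj_pconj, pconj_C, map_div₀,
      map_one, map_ofNat]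
    linear_combination -hnorm - pform w w * C_half_add
  have hc0 : c.coeff 0 = 0 := by
    simp [hcdef, ha0, hww0, Polynomial.mul_coeff_zero]
  have hT := good_transv (Γ := Γ) (α := α) hm hn hV₁ he.mem hwU hw0 hc hc0
  have hTF : ∀ f ∈ hyp V, (transv (cv e) w c).mulVec (cv f) = (1 : ℂ[X]) • cv f := fun f hf => by
    rw [one_smul, transv_fixes (hwU f (hyp_mono le_sup_left hf))
      (form_eq_zero_symm (he.mem_perp f hf))]
  have hTt := IsTrivialOn.of_good hΓ hT (by simp) hTF
  have hA := good_torus' (Γ := Γ) (α := α) hq he hd'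
  have hAt := isTrivialOn_torus (Γ := Γ) hΓ hq he hd'
  have hB := good_torus' (Γ := Γ) (α := α) hq he.sMat hd
  have hBt := isTrivialOn_torus (Γ := Γ) hΓ hq he.sMat hd
  have hAB : torus e (pconj d) * torus e' d = (d * pconj d) • 1 := by
    have := torus_mul_torus_inv he (pconj d)
    rwa [pconj_pconj] at this
  have hBA : torus e' d * torus e (pconj d) = (pconj d * d) • 1 := by
    have := torus_mul_torus_inv he.sMat d
    rwa [sMat_mulVec_sMat_mulVec] at this
  rw [pconj_pconj] at hA hAt
  refine Good.of_mul hB hBA (mul_ne_zero hdne' hdne) ?_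
  refine good_of_transv_mul hm hn hV₁ he.mem hwU hw0 hc hc0 ?_
  refine Good.of_mul hA hAB (mul_ne_zero hdne hdne') ?_
  have htot := hBt.mul (hTt.mul (hAt.mul hP))
  rw [one_mul] at htot
  refine ih ⟨htot.unitary, htot.eval_den, htot.evm_num, mulVec_hyp_sup_span htot.fixes ?_ ?_⟩
  · have t1 : (torus e (pconj d)).mulVec (cv e) = (pconj d * d) • cv e := by
      have := torus_combination he (w := 0) (pform_zero_right _) (pform_zero_right _) (pconj d) 1 0
      simpa using this
    have t2 : (torus e' d).mulVec (cv e) = cv e := by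
      have := torus_combination' he (w := 0) (pform_zero_right _) (pform_zero_right _) d 1 0
      simpa using this
    rw [← Matrix.mulVec_mulVec, ← Matrix.mulVec_mulVec, ← Matrix.mulVec_mulVec, hPe,
      Matrix.mulVec_smul, t1, Matrix.mulVec_smul, Matrix.mulVec_smul, Matrix.mulVec_smul,
      transv_fixes hw1 he.isotropic, Matrix.mulVec_smul, t2]
    module
  · have t1 : (torus e (pconj d)).mulVec v =
        d • ((pconj d * a) • cv e + w + (1 : ℂ[X]) • cv e') := by
      conv_lhs => rw [hdec]
      rw [torus_combination he hw1 hw2, pconj_pconj]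
      module
    have t2 : (torus e' d).mulVec (cv e') = (d * pconj d) • cv e' := by
      have := torus_combination' he (w := 0) (pform_zero_right _) (pform_zero_right _) d 0 1
      simpa using this
    have t3 : pconj d * a + pform w w + (c - C (1 / 2) * pform w w) * 1 = 0 := by
      rw [hcdef]
      linear_combination -pform w w * C_half_add
    rw [← Matrix.mulVec_mulVec, ← Matrix.mulVec_mulVec, ← Matrix.mulVec_mulVec, ← hv, t1,
      Matrix.mulVec_smul, transv_combination he hwU hwU, t3, one_smul, sub_self, zero_smul,
      zero_add, zero_add, one_smul, Matrix.mulVec_smul, t2]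
    module

/-- The e-component a of Pe has a(0) = 1, so a torus element can divide by it. A transvection along
e' then removes w and the e'-component, and a last torus element matches the scale d. -/
theorem good_of_next (hΓ : Γ ≤ (negRealLoops p q).toSubmonoid)
    (hm : loopsOf (mFamily p q α) ⊆ (Γ : Set (Loop p q)))
    (hn : loopsOf (nFamily p q α) ⊆ (Γ : Set (Loop p q)))
    (hq : loopsOf (qFamily p q) ⊆ (Γ : Set (Loop p q)))
    (hV : IsIsotropic V) (he : IsNext V e)
    (ih : ∀ {P : PMat p q} {d : ℂ[X]}, IsTrivialOn V P d → P.mulVec (cv e) = d • cv e →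
      Good Γ α P d) {P : PMat p q} {d : ℂ[X]} (hP : IsTrivialOn V P d) : Good Γ α P d := by
  have hV₁ := he.sMat.isIsotropic hV
  have hd := hP.eval_den
  have hd' := eval_zero_pconj hd
  have hdne := ne_zero_of_eval hd
  have hdne' := ne_zero_of_eval hd'
  set e' := (sMat p q).mulVec e with he'
  have hse' : (sMat p q).mulVec e' = e := sMat_mulVec_sMat_mulVec e
  set v := P.mulVec (cv e) with hv
  have hFv := hP.pform_eq_zero he.mem_perp
  have hv0 : evv 0 v = e := evv_mulVec_cv_of_evm hP.evm_num e
  set a := pform (cv e') v with ha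
  set b := pform (cv e) v with hb
  set w := rest e v with hw
  have hwU₀ := he.pform_rest hFv
  obtain ⟨hw1, hw2⟩ := he.rest_orthogonal v
  have hwU : ∀ f ∈ hyp (V ⊔ Submodule.span ℂ {e'}), pform (cv f) w = 0 :=
    pform_hyp_sup_span (fun f hf => hwU₀ f (hyp_mono le_sup_left hf)) hw2 (by rw [hse']; exact hw1)
  have hw0 : evv 0 w = 0 := he.evv_rest_eq_zero (s := 1) (t := 0) (by rw [hv0]; simp)
  have hdec : v = a • cv e + w + b • cv e' := eq_add_rest e v
  have hnorm : pconj a * b + pconj b * a + pform w w = 0 := by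
    have h1 := hP.unitary (cv e) (cv e)
    rw [← hv, pform_cv_cv, he.isotropic, hdec, he.pform_combination hwU₀] at h1
    simpa using h1
  have ha1 : eval 0 a = 1 := by
    rw [← Polynomial.coeff_zero_eq_eval_zero, ha, coeff_zero_pform, hv0, evv_cv,
      he.form_sMat_self']
  have ha1' := eval_zero_pconj ha1
  have hane := ne_zero_of_eval ha1
  have hane' := ne_zero_of_eval ha1'
  have hb0 : b.coeff 0 = 0 := by
    rw [hb, coeff_zero_pform, hv0, evv_cv, he.isotropic]
  have hww0 : (pform w w).coeff 0 = 0 := by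
    rw [coeff_zero_pform, hw0, form_zero_left]
  -- The torus element turns v into a times e + w + āb e'; this c cancels the e'-component, and ⟨v,
  -- v⟩ = 0 makes it skew.
  set c : ℂ[X] := -(b * pconj a + C (1 / 2) * pform w w) with hcdef
  have hc : pconj c = -c := by
    simp only [hcdef, map_add, map_neg, map_mul, pconj_pform, pconj_pconj, pconj_C, map_div₀,
      map_one, map_ofNat]
    linear_combination -hnorm - pform w w * C_half_add
  have hc0 : c.coeff 0 = 0 := by
    simp [hcdef, hb0, hww0, Polynomial.mul_coeff_zero]
  have hT := good_transv (Γ := Γ) (α := α) hm hn hV₁ he.sMat.mem hwU hw0 hc hc0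
  have hTF : ∀ f ∈ hyp V, (transv (cv e') w c).mulVec (cv f) = (1 : ℂ[X]) • cv f := fun f hf => by
    rw [one_smul, transv_fixes (hwU f (hyp_mono le_sup_left hf))
      (form_eq_zero_symm (he.sMat.mem_perp f hf))]
  have hTt := IsTrivialOn.of_good hΓ hT (by simp) hTF
  have hA := good_torus' (Γ := Γ) (α := α) hq he ha1
  have hAt := isTrivialOn_torus (Γ := Γ) hΓ hq he.sMat ha1'
  have hB := good_torus' (Γ := Γ) (α := α) hq he.sMat hd'
  have hBt := isTrivialOn_torus (Γ := Γ) hΓ hq he hd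
  have hAA : torus e a * torus e' (pconj a) = (pconj a * a) • 1 := torus_mul_torus_inv he a
  have hBB : torus e' (pconj d) * torus e d = (d * pconj d) • 1 := by
    have := torus_mul_torus_inv he.sMat (pconj d)
    rwa [pconj_pconj, sMat_mulVec_sMat_mulVec] at this
  rw [pconj_pconj] at hB hAt
  refine Good.of_mul hA hAA (mul_ne_zero hane' hane) ?_
  refine good_of_transv_mul hm hn hV₁ he.sMat.mem hwU hw0 hc hc0 ?_
  refine Good.of_mul hB hBB (mul_ne_zero hdne hdne') ?_
  have htot := hBt.mul (hTt.mul (hAt.mul hP))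
  rw [one_mul] at htot
  refine ih htot ?_
  have t1 : (torus e' (pconj a)).mulVec v =
      a • ((pconj a * b) • cv e' + w + (1 : ℂ[X]) • cv ((sMat p q).mulVec e')) := by
    conv_lhs => rw [hdec]
    rw [torus_combination' he hw1 hw2, pconj_pconj, hse']
    module
  have t2 : (torus e d).mulVec (cv e) = (d * pconj d) • cv e := by
    have := torus_combination he (w := 0) (pform_zero_right _) (pform_zero_right _) d 1 0
    simpa using this
  have t3 : pconj a * b + pform w w + (c - C (1 / 2) * pform w w) * 1 = 0 := by
    rw [hcdef]
    linear_combination -pform w w * C_half_add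
  rw [← Matrix.mulVec_mulVec, ← Matrix.mulVec_mulVec, ← Matrix.mulVec_mulVec, ← hv, t1,
    Matrix.mulVec_smul, transv_combination he.sMat hwU hwU, t3, one_smul, sub_self, zero_smul,
    zero_add, zero_add, one_smul, hse', Matrix.mulVec_smul, t2]
  module

theorem good_rational_of_finrank (hΓ : Γ ≤ (negRealLoops p q).toSubmonoid)
    (hm : loopsOf (mFamily p q α) ⊆ (Γ : Set (Loop p q)))
    (hn : loopsOf (nFamily p q α) ⊆ (Γ : Set (Loop p q)))
    (hp : loopsOf (pFamily p q) ⊆ (Γ : Set (Loop p q)))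
    (hq : loopsOf (qFamily p q) ⊆ (Γ : Set (Loop p q))) :
    ∀ (m : ℕ) {V : Submodule ℂ (Vec p q)}, IsIsotropic V → p + q ≤ Module.finrank ℂ V + m →
      ∀ {P : PMat p q} {d : ℂ[X]}, IsTrivialOn V P d → Good Γ α P d := by
  intro m
  induction m with
  | zero =>
    intro V hV hdim P d hP
    by_cases hW : IsAnisotropic (perp (hyp V))
    · exact good_of_isAnisotropic hp hV hW _ le_rfl hP.unitary hP.eval_den hP.evm_num hP.fixes
    · simp only [IsAnisotropic, not_forall] at hW
      obtain ⟨u, hu, huu, hu0⟩ := hW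
      obtain ⟨e, -, he, -⟩ := exists_isNext hu huu hu0
      have h1 := he.finrank_lt hV
      have h2 := (V ⊔ Submodule.span ℂ {e} : Submodule ℂ (Vec p q)).finrank_le
      have h3 : Module.finrank ℂ (Vec p q) = p + q := by simp
      omega
  | succ m ih =>
    intro V hV hdim P d hP
    by_cases hW : IsAnisotropic (perp (hyp V))
    · exact good_of_isAnisotropic hp hV hW _ le_rfl hP.unitary hP.eval_den hP.evm_num hP.fixes
    · simp only [IsAnisotropic, not_forall] at hW
      obtain ⟨u, hu, huu, hu0⟩ := hW
      obtain ⟨e, -, he, -⟩ := exists_isNext hu huu hu0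
      have h1 := he.finrank_lt hV
      refine good_of_next hΓ hm hn hq hV he (fun hP hPe => ?_) hP
      refine good_of_fixes_isotropic' hΓ hm hn hq hV he (fun hP => ?_) hP hPe
      exact ih (he.isIsotropic hV) (by omega) hP

theorem good_rational (hΓ : Γ ≤ (negRealLoops p q).toSubmonoid)
    (hm : loopsOf (mFamily p q α) ⊆ (Γ : Set (Loop p q)))
    (hn : loopsOf (nFamily p q α) ⊆ (Γ : Set (Loop p q)))
    (hp : loopsOf (pFamily p q) ⊆ (Γ : Set (Loop p q)))
    (hq : loopsOf (qFamily p q) ⊆ (Γ : Set (Loop p q)))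
    {P : PMat p q} {d : ℂ[X]} (hP : IsUnitaryPair P d) (hd : eval 0 d = 1) (hP0 : evm 0 P = 1) :
    Good Γ α P d := by
  refine good_rational_of_finrank hΓ hm hn hp hq (p + q) (V := ⊥) ?_ (by omega)
    ⟨hP, hd, hP0, ?_⟩
  · rintro v rfl w rfl
    simp
  · intro f hf
    have : f = 0 := by simpa [hyp, sMap] using hf
    simp [this]

end RationalLoops

/-! ### Meromorphic functions on the Riemann sphere are rational -/

/-- Liouville's theorem is the case n = 0; passing to (f(z) - f(0))/z lowers the growth by one. -/
theorem exists_polynomial_of_tendsto : ∀ (n : ℕ) {f : ℂ → ℂ}, Differentiable ℂ f →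
    Tendsto (fun z => f z / z ^ n) (cocompact ℂ) (𝓝 0) → ∃ P : ℂ[X], ∀ z, f z = eval z P := by
  intro n
  induction n with
  | zero =>
    intro f hf h
    refine ⟨0, fun z => ?_⟩
    rw [Polynomial.eval_zero]
    exact hf.apply_eq_of_tendsto_cocompact z (by simpa using h)
  | succ n ih =>
    intro f hf h
    have hd : Differentiable ℂ (dslope f 0) := by
      rw [← differentiableOn_univ]
      exact (Complex.differentiableOn_dslope univ_mem).2 hf.differentiableOn
    have hz : Tendsto (fun z : ℂ => z⁻¹) (cocompact ℂ) (𝓝 0) := by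
      simpa using tendsto_inv_sub_cocompact 0
    obtain ⟨P, hP⟩ := ih hd (by
      have h2 := h.sub ((hz.pow (n + 1)).const_mul (f 0))
      rw [zero_pow n.succ_ne_zero, mul_zero, sub_zero] at h2
      refine h2.congr' ?_
      filter_upwards [(eventually_ne_cofinite (0 : ℂ)).filter_mono cocompact_le_cofinite] with z hz
      rw [dslope_of_ne _ hz, slope_def_field, sub_zero, inv_pow, ← div_eq_mul_inv, ← sub_div,
        div_div, pow_succ'])
    refine ⟨C (f 0) + X * P, fun z => ?_⟩
    have := sub_smul_dslope f 0 z
    rw [sub_zero, hP, smul_eq_mul] at this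
    simp [this]

theorem tendsto_inv_punctured : Tendsto (fun z : ℂ => z⁻¹) (cocompact ℂ) (𝓝[≠] 0) := by
  rw [← Metric.cobounded_eq_cocompact]
  exact tendsto_inv₀_cobounded'

theorem exists_polynomial_of_meromorphicAt {f : ℂ → ℂ} (hf : Differentiable ℂ f)
    (h : MeromorphicAt (fun w => f w⁻¹) 0) : ∃ P : ℂ[X], ∀ z, f z = eval z P := by
  obtain ⟨n, hn⟩ := h
  refine exists_polynomial_of_tendsto (n + 1) hf ?_
  have h1 := (hn.continuousAt.tendsto.mono_left nhdsWithin_le_nhds).comp tendsto_inv_punctured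
  have h2 := h1.mul (tendsto_inv_punctured.mono_right nhdsWithin_le_nhds)
  rw [mul_zero] at h2
  refine h2.congr fun z => ?_
  simp [div_eq_mul_inv, pow_succ]
  ring

theorem analyticAt_eval (P : ℂ[X]) (z : ℂ) : AnalyticAt ℂ (fun z => eval z P) z :=
  P.differentiable.analyticAt z

theorem meromorphicAt_eval_inv (P : ℂ[X]) : MeromorphicAt (fun w => eval w⁻¹ P) (0 : ℂ) := by
  induction P using Polynomial.induction_on' with
  | add f g hf hg => simpa using hf.fun_add hg
  | monomial n a =>
    simp only [Polynomial.eval_monomial]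
    exact (MeromorphicAt.const a 0).fun_mul (((MeromorphicAt.id 0).inv).fun_pow n)

/-- Compactness: a power of z - z₀ clears the pole near each z₀, and polynomials multiply over
finite unions. Recording that poles are roots of Q controls where f may have been redefined. -/
theorem exists_clearing_polynomial {f : ℂ → ℂ} (hf : ∀ z, MeromorphicAt f z) {K : Set ℂ}
    (hK : IsCompact K) : ∃ Q : ℂ[X], Q ≠ 0 ∧ ∀ z ∈ K, (eval z Q ≠ 0 → AnalyticAt ℂ f z) ∧
      0 ≤ meromorphicOrderAt (fun z => eval z Q * f z) z := by
  have aux : ∀ (Q R : ℂ[X]) (z : ℂ), 0 ≤ meromorphicOrderAt (fun z => eval z Q * f z) z →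
      0 ≤ meromorphicOrderAt (fun z => eval z (R * Q) * f z) z := fun Q R z h => by
    have h1 : (fun z => eval z (R * Q) * f z) = (fun z => eval z R) * fun z => eval z Q * f z := by
      ext z
      simp [mul_assoc]
    rw [h1, meromorphicOrderAt_mul (analyticAt_eval R z).meromorphicAt
      ((analyticAt_eval Q z).meromorphicAt.fun_mul (hf z))]
    exact add_nonneg (analyticAt_eval R z).meromorphicOrderAt_nonneg h
  refine hK.induction_on ?_ ?_ ?_ ?_
  · exact ⟨1, one_ne_zero, by simp⟩
  · rintro s t hst ⟨Q, hQ, h⟩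
    exact ⟨Q, hQ, fun z hz => h z (hst hz)⟩
  · rintro s t ⟨Q, hQ, hs⟩ ⟨R, hR, ht⟩
    refine ⟨R * Q, mul_ne_zero hR hQ, fun z hz => ?_⟩
    rw [Polynomial.eval_mul]
    rcases hz with hz | hz
    · exact ⟨fun h => (hs z hz).1 (right_ne_zero_of_mul h), aux Q R z (hs z hz).2⟩
    · refine ⟨fun h => (ht z hz).1 (left_ne_zero_of_mul h), ?_⟩
      rw [mul_comm R Q]
      exact aux R Q z (ht z hz).2
  · intro z₀ _
    obtain ⟨n, hn⟩ := id (hf z₀)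
    have h1 := eventually_nhdsWithin_iff.1 (hf z₀).eventually_analyticAt
    -- The exponent n + 1 makes the polynomial vanish at z₀ even if n = 0, since f might have a bad
    -- value there.
    refine ⟨{z | (z ≠ z₀ → AnalyticAt ℂ f z) ∧ AnalyticAt ℂ (fun z => (z - z₀) ^ n • f z) z},
      mem_nhdsWithin_of_mem_nhds (h1.and hn.eventually_analyticAt), (X - C z₀) ^ (n + 1),
      pow_ne_zero _ (Polynomial.X_sub_C_ne_zero z₀), fun z hz => ⟨fun h => hz.1 ?_, ?_⟩⟩
    · rintro rfl
      simp at h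
    · rw [pow_succ']
      refine aux _ _ z ?_
      have h2 : (fun z => eval z ((X - C z₀) ^ n) * f z) = fun z => (z - z₀) ^ n • f z := by
        ext z
        simp
      rw [h2]
      exact hz.2.meromorphicOrderAt_nonneg

/-- Near ∞ f is holomorphic, so the poles in ℂ lie in a compact set and a polynomial Q clears them.
The normal form of Qf is entire and meromorphic at ∞, hence a polynomial. -/
theorem exists_polynomials {f : ℂ → ℂ} (hf : ∀ z, MeromorphicAt f z)
    (h : MeromorphicAt (fun w => f w⁻¹) 0) :
    ∃ P Q : ℂ[X], Q ≠ 0 ∧ ∀ᶠ z in cofinite, eval z Q * f z = eval z P := by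
  have h1 : ∀ᶠ z in cocompact ℂ, AnalyticAt ℂ f z := by
    filter_upwards [tendsto_inv_punctured.eventually h.eventually_analyticAt,
      (eventually_ne_cofinite (0 : ℂ)).filter_mono cocompact_le_cofinite] with z hz hz0
    have := hz.comp (analyticAt_inv hz0)
    simpa [Function.comp_def] using this
  obtain ⟨K, hK, hKs⟩ := mem_cocompact.1 h1
  obtain ⟨Q, hQ, hQK⟩ := exists_clearing_polynomial hf hK
  have h2 : ∀ z, (eval z Q ≠ 0 → AnalyticAt ℂ f z) ∧
      0 ≤ meromorphicOrderAt (fun z => eval z Q * f z) z := fun z => by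
    by_cases hz : z ∈ K
    · exact hQK z hz
    · have h3 : AnalyticAt ℂ f z := hKs hz
      exact ⟨fun _ => h3, ((analyticAt_eval Q z).mul h3).meromorphicOrderAt_nonneg⟩
  set F : ℂ → ℂ := fun z => eval z Q * f z with hF
  have hFm : MeromorphicOn F Set.univ := fun z _ =>
    (analyticAt_eval Q z).meromorphicAt.fun_mul (hf z)
  set G := toMeromorphicNFOn F Set.univ with hG
  have hGF : ∀ z, G =ᶠ[𝓝[≠] z] F := fun z =>
    hFm.toMeromorphicNFOn_eq_self_on_nhdsNE (Set.mem_univ z)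
  have hGa : ∀ z, AnalyticAt ℂ G z := fun z => by
    rw [← (meromorphicNFOn_toMeromorphicNFOn F Set.univ
      (Set.mem_univ z)).meromorphicOrderAt_nonneg_iff_analyticAt,
      meromorphicOrderAt_congr (hGF z)]
    exact (h2 z).2
  have hGFe : ∀ z, AnalyticAt ℂ f z → G z = F z := fun z hz => by
    have hc : ContinuousAt F z := ((analyticAt_eval Q z).mul hz).continuousAt
    exact (((hGa z).continuousAt.eventuallyEq_nhds_iff_eventuallyEq_nhdsNE hc).1 (hGF z)).eq_of_nhds
  have hG0 : MeromorphicAt (fun w => G w⁻¹) 0 := by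
    refine ((meromorphicAt_eval_inv Q).fun_mul h).congr ?_
    have h3 : ∀ᶠ w : ℂ in 𝓝[≠] 0, AnalyticAt ℂ f w⁻¹ := by
      rw [← Metric.cobounded_eq_cocompact] at h1
      exact tendsto_inv₀_nhdsNE_zero.eventually h1
    filter_upwards [h3] with w hw using (hGFe _ hw).symm
  obtain ⟨P, hP⟩ := exists_polynomial_of_meromorphicAt
    (fun z => (hGa z).differentiableAt) hG0
  refine ⟨P, Q, hQ, ?_⟩
  have hfin : {z | Polynomial.IsRoot Q z}.Finite := Polynomial.finite_setOfPred_isRoot hQ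
  filter_upwards [hfin.compl_mem_cofinite] with z hz
  rw [← hP, hGFe z ((h2 z).1 hz)]

/-! ### Common denominators, and loops as quotients P/d. -/

section

variable {p q : ℕ}

theorem exists_polynomial_matrix {F : ℂ → Mat p q}
    (hF : ∀ i j, ∃ P Q : ℂ[X], Q ≠ 0 ∧ ∀ᶠ z in cofinite, eval z Q * F z i j = eval z P) :
    ∃ (P : PMat p q) (Q : ℂ[X]), Q ≠ 0 ∧ ∀ᶠ z in cofinite, eval z Q • F z = evm z P := by
  choose P Q hQ h using hF
  refine ⟨fun i j => (∏ k ∈ Finset.univ.erase (i, j), Q k.1 k.2) * P i j,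
    ∏ k : (Fin p ⊕ Fin q) × (Fin p ⊕ Fin q), Q k.1 k.2,
    Finset.prod_ne_zero_iff.2 fun k _ => hQ _ _, ?_⟩
  filter_upwards [eventually_all.2 fun i => eventually_all.2 fun j => h i j] with z hz
  ext i j
  rw [Matrix.smul_apply, ← Finset.prod_erase_mul _ _ (Finset.mem_univ (i, j)), smul_eq_mul,
    Polynomial.eval_mul, mul_assoc, hz]
  exact Polynomial.eval_mul.symm

/-- If F has a limit at a root of Q, then P vanishes there as well and the linear factor cancels;
the degree of Q drops. -/
theorem exists_reduced_polynomial_matrix {F : ℂ → Mat p q}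
    (hF : ∃ (P : PMat p q) (Q : ℂ[X]), Q ≠ 0 ∧ ∀ᶠ z in cofinite, eval z Q • F z = evm z P) :
    ∃ (P : PMat p q) (Q : ℂ[X]), Q ≠ 0 ∧ (∀ᶠ z in cofinite, eval z Q • F z = evm z P) ∧
      ∀ z L, Tendsto F (𝓝[≠] z) (𝓝 L) → eval z Q ≠ 0 := by
  obtain ⟨P, Q, hQ, h⟩ := hF
  induction hn : Q.natDegree using Nat.strong_induction_on generalizing P Q with
  | _ n ih =>
    by_cases hall : ∀ z L, Tendsto F (𝓝[≠] z) (𝓝 L) → eval z Q ≠ 0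
    · exact ⟨P, Q, hQ, h, hall⟩
    push Not at hall
    obtain ⟨z₀, L, hL, hz₀⟩ := hall
    have hP0 : evm z₀ P = 0 := by
      have h1 : Tendsto (fun z => evm z P) (𝓝[≠] z₀) (𝓝 (evm z₀ P)) :=
        tendsto_pi_nhds.2 fun i => tendsto_pi_nhds.2 fun j =>
          ((P i j).continuous.tendsto z₀).mono_left nhdsWithin_le_nhds
      have h2 := ((Q.continuous.tendsto z₀).mono_left (nhdsWithin_le_nhds (s := {z₀}ᶜ))).smul hL
      have h3 := tendsto_nhds_unique h1 (h2.congr' (h.filter_mono (nhdsNE_le_cofinite _)))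
      rw [h3, hz₀, zero_smul]
    obtain ⟨Q', rfl⟩ := Polynomial.dvd_iff_isRoot.2 hz₀
    have hP : ∀ i j, ∃ R, P i j = (X - C z₀) * R := fun i j =>
      Polynomial.dvd_iff_isRoot.2 (congrFun (congrFun hP0 i) j)
    choose P' hP' using hP
    have hQ' : Q' ≠ 0 := right_ne_zero_of_mul hQ
    refine ih Q'.natDegree ?_ P' Q' hQ' ?_ rfl
    · rw [← hn, Polynomial.natDegree_mul (Polynomial.X_sub_C_ne_zero z₀) hQ',
        Polynomial.natDegree_X_sub_C]
      omega
    · filter_upwards [h, eventually_ne_cofinite z₀] with z hz hne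
      ext i j
      have := congrFun (congrFun hz i) j
      simp only [evm, Matrix.map_apply, hP', Matrix.smul_apply, Polynomial.eval_mul,
        Polynomial.eval_sub, Polynomial.eval_X, Polynomial.eval_C, smul_eq_mul, mul_assoc] at this ⊢
      exact mul_left_cancel₀ (sub_ne_zero.2 hne) this

theorem exists_pairFun {g : Loop p q} (hg : g ∈ negRealLoops p q) (α : ℝ) :
    ∃ (P : PMat p q) (d : ℂ[X]), eval 0 d = 1 ∧
      (g : Germ (cofinite : Filter ℂ) (Mat p q)) = (pairFun α P d : Germ _ _) ∧
      ((∀ z, IsPole g z → z = α) → d = 1) := by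
  obtain ⟨f, hf, ⟨hm, hm'⟩, hneg, -⟩ := id hg
  set F : ℂ → Mat p q := fun w => f (α + w⁻¹) with hF
  have hrat : ∀ i j, ∃ P Q : ℂ[X], Q ≠ 0 ∧ ∀ᶠ z in cofinite, eval z Q * F z i j = eval z P := by
    refine fun i j => exists_polynomials (f := fun w => F w i j) (fun w => ?_) ?_
    · rcases eq_or_ne w 0 with rfl | hw
      -- Near w = 0 the point α + 1/w is near ∞, and w/(1 + αw) is its inverse, the coordinate at ∞.
      · have h1 : AnalyticAt ℂ (fun w : ℂ => w / (1 + α * w)) 0 := by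
          refine AnalyticAt.div (by fun_prop) (by fun_prop) (by simp)
        have h2 : MeromorphicAt (fun w : ℂ => f w⁻¹ i j) ((fun w : ℂ => w / (1 + α * w)) 0) := by
          simpa using hm' i j
        refine (h2.comp_analyticAt (g := fun w : ℂ => w / (1 + α * w)) h1).congr ?_
        filter_upwards [self_mem_nhdsWithin] with w hw
        have hw : w ≠ 0 := hw
        simp only [Function.comp, hF, inv_div]
        rw [add_div, mul_div_cancel_right₀ _ hw, one_div, add_comm]
      · exact (hm (α + w⁻¹) i j).comp_analyticAt (f := fun l => f l i j)
          (g := fun w : ℂ => (α : ℂ) + w⁻¹) (analyticAt_const.add (analyticAt_inv hw))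
    · have h1 : MeromorphicAt (fun l => f l i j) ((fun w : ℂ => (α : ℂ) + w) 0) := hm _ i j
      simpa [hF, Function.comp_def] using h1.comp_analyticAt (by fun_prop)
  obtain ⟨P, Q, hQ, hPQ, hred⟩ := exists_reduced_polynomial_matrix (exists_polynomial_matrix hrat)
  have hinv : Tendsto (fun w : ℂ => (α : ℂ) + w⁻¹) (𝓝[≠] 0) (cocompact ℂ) := by
    have h1 := tendsto_inv₀_nhdsNE_zero (α := ℂ)
    rw [Metric.cobounded_eq_cocompact] at h1
    exact (Homeomorph.addLeft (α : ℂ)).isClosedEmbedding.tendsto_cocompact.comp h1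
  -- w = 0 is λ = ∞, where the loop has the limit 1; dividing by Q(0) then normalizes the
  -- denominator.
  have hQ0 : eval 0 Q ≠ 0 := hred 0 1 ((show Tendsto f _ _ from hneg).comp hinv)
  have hi : Function.Injective fun l : ℂ => (l - α)⁻¹ := fun a b h => by
    simpa using h
  refine ⟨C (eval 0 Q)⁻¹ • P, C (eval 0 Q)⁻¹ * Q, by simp [hQ0], ?_, fun hpole => ?_⟩
  · rw [hf]
    refine Germ.coe_eq.2 ?_
    filter_upwards [hi.tendsto_cofinite.eventually hPQ, eventually_eval_ne_zero α hQ] with l h1 h2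
    rw [pairFun, evm_smul, ← h1, Polynomial.eval_mul, Polynomial.eval_C, smul_smul, smul_smul,
      hF]
    simp only [inv_inv, add_sub_cancel]
    rw [mul_assoc, inv_mul_cancel₀ (mul_ne_zero (inv_ne_zero hQ0) h2), one_smul]
  · have hroot : ∀ w, eval w Q ≠ 0 := fun w => by
      rcases eq_or_ne w 0 with rfl | hw
      · exact hQ0
      have hnp : ¬ IsPole g (α + w⁻¹) := fun h => hw (by simpa using hpole _ h)
      obtain ⟨f', hf', ha⟩ := not_not.1 hnp
      have hff' : ∀ᶠ l in cofinite, f' l = f l := Germ.coe_eq.1 (hf'.symm.trans hf)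
      refine hred w (f' (α + w⁻¹)) ?_
      have h1 : Tendsto (fun w : ℂ => (α : ℂ) + w⁻¹) (𝓝[≠] w) (𝓝 (α + w⁻¹)) :=
        ((tendsto_inv₀ hw).const_add _).mono_left nhdsWithin_le_nhds
      have h2 : Tendsto (fun w => f' (α + w⁻¹)) (𝓝[≠] w) (𝓝 (f' (α + w⁻¹))) :=
        tendsto_pi_nhds.2 fun i => tendsto_pi_nhds.2 fun j =>
          ((ha i j).continuousAt.tendsto).comp h1
      refine h2.congr' ?_
      have hi' : Function.Injective fun w : ℂ => (α : ℂ) + w⁻¹ := fun a b h => by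
        simpa using h
      exact (hi'.tendsto_cofinite.eventually hff').filter_mono (nhdsNE_le_cofinite _)
    have hQc : Q = C (eval 0 Q) := by
      refine (Polynomial.eq_C_of_degree_eq_zero ?_).trans
        (by rw [Polynomial.coeff_zero_eq_eval_zero])
      by_contra hdeg
      obtain ⟨w, hw⟩ := IsAlgClosed.exists_root Q hdeg
      exact hroot w hw
    rw [hQc, Polynomial.eval_C, ← map_mul, inv_mul_cancel₀ hQ0, map_one]

end

/-! ### Generators -/

section

variable {p q : ℕ}

theorem loopsOf_mono {S T : Set (ℂ → Mat p q)} (h : S ⊆ T) : loopsOf S ⊆ loopsOf T :=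
  fun _ ⟨f, hf, e⟩ => ⟨f, h hf, e⟩

theorem loopsOf_subset_negRealLoops {S : Set (ℂ → Mat p q)}
    (h : ∀ f ∈ S, ∃ g ∈ negRealLoops p q, g ∈ loopsOf {f}) :
    loopsOf S ⊆ (negRealLoops p q : Set (Loop p q)) := by
  rintro g ⟨f, hf, e⟩
  obtain ⟨g', hg', f', rfl, e'⟩ := h f hf
  rwa [Units.ext (e.trans e'.symm)]

theorem mem_of_good {Γ : Submonoid (Loop p q)} {α : ℝ} {P : PMat p q} {d : Polynomial ℂ}
    (h : Good Γ α P d) {g : Loop p q}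
    (hg : (g : Germ (cofinite : Filter ℂ) (Mat p q)) = (pairFun α P d : Germ _ _)) : g ∈ Γ := by
  obtain ⟨g', hg', e⟩ := h
  rwa [Units.ext (hg.trans e.symm)]

theorem eq_negRealLoops {Γ : Subgroup (Loop p q)} (α : ℝ) (hΓ : Γ ≤ negRealLoops p q)
    (hm : loopsOf (mFamily p q α) ⊆ (Γ : Set (Loop p q)))
    (hn : loopsOf (nFamily p q α) ⊆ (Γ : Set (Loop p q)))
    (hp : loopsOf (pFamily p q) ⊆ (Γ : Set (Loop p q)))
    (hq : loopsOf (qFamily p q) ⊆ (Γ : Set (Loop p q))) : Γ = negRealLoops p q := by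
  refine le_antisymm hΓ fun g hg => ?_
  obtain ⟨P, d, hd, he, -⟩ := exists_pairFun hg α
  have hd0 : d ≠ 0 := by
    rintro rfl
    simp at hd
  exact mem_of_good (Γ := Γ.toSubmonoid) (good_rational hΓ hm hn hp hq
    (IsUnitaryPair.of_loop hd0 hg he) hd (evm_zero_of_loop hd hg he)) he

theorem mem_of_forall_isSingularity {Γ : Submonoid (Loop p q)} {α : ℝ}
    (hΓ : Γ ≤ (negRealLoops p q).toSubmonoid)
    (hm : loopsOf (mFamily p q α) ⊆ (Γ : Set (Loop p q)))
    (hn : loopsOf (nFamily p q α) ⊆ (Γ : Set (Loop p q))) {g : Loop p q}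
    (hg : g ∈ negRealLoops p q) (hs : ∀ z : ℂ, IsSingularity g z → z = (α : ℂ)) : g ∈ Γ := by
  obtain ⟨P, d, hd, he, h1⟩ := exists_pairFun hg α
  obtain rfl := h1 fun z hz => hs z (Or.inl hz)
  exact mem_of_good (good_polynomial hΓ hm hn (IsUnitaryPair.of_loop one_ne_zero hg he)
    (evm_zero_of_loop hd hg he)) he

/-- For p = q a maximal isotropic V has V ⊕ sV = ℂⁿ, on which M vanishes; so the loop is trivial. -/
theorem loopsOf_nFamily_subset (hpq : p = q) (α : ℝ) (Γ : Submonoid (Loop p q)) :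
    loopsOf (nFamily p q α) ⊆ (Γ : Set (Loop p q)) := by
  rintro g ⟨f, ⟨k, V, M, -, hV, h0, -, rfl⟩, e⟩
  have hM : M = 0 := by
    have hc := (isCompl_hyp hV.1).codisjoint.eq_top
    rw [perp_hyp_eq_bot hpq hV.1 (isAnisotropic_of_maximal hV), sup_bot_eq] at hc
    refine Matrix.ext_of_mulVec_single fun i => ?_
    rw [Matrix.zero_mulVec]
    exact h0 _ (show _ ∈ hyp V from hc ▸ Submodule.mem_top)
  have hg : g = 1 := by
    refine Units.ext (e.trans (Germ.coe_eq.2 (Eventually.of_forall fun l => ?_)))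
    simp [nElt, hM, adj]
  rw [hg]
  exact Γ.one_mem

end

end UpqLoop

/-! ### The theorem, assembled from the polynomial and rational cases. -/

theorem mainTheorem3 (p q : ℕ) :
    -- the simple elements are negative rational loops satisfying the reality condition
    (∀ f ∈ UpqLoop.pFamily p q ∪ UpqLoop.qFamily p q ∪ (⋃ α : ℝ, UpqLoop.mFamily p q α) ∪
        (⋃ α : ℝ, UpqLoop.nFamily p q α),
      ∃ g ∈ UpqLoop.negRealLoops p q, g ∈ UpqLoop.loopsOf {f}) ∧
    -- the case `p = q`
    (p = q →
      Subgroup.closure (UpqLoop.loopsOf (UpqLoop.pFamily p q ∪ UpqLoop.qFamily p q ∪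
          ⋃ α : ℝ, UpqLoop.mFamily p q α)) = UpqLoop.negRealLoops p q ∧
      ∀ g ∈ UpqLoop.negRealLoops p q, ∀ α : ℝ,
        (∀ z : ℂ, UpqLoop.IsSingularity g z → z = (α : ℂ)) →
        g ∈ Submonoid.closure (UpqLoop.loopsOf (UpqLoop.mFamily p q α))) ∧
    -- the case `p ≠ q`
    (p ≠ q →
      Subgroup.closure (UpqLoop.loopsOf (UpqLoop.pFamily p q ∪ UpqLoop.qFamily p q ∪
          (⋃ α : ℝ, UpqLoop.mFamily p q α) ∪ ⋃ α : ℝ, UpqLoop.nFamily p q α)) =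
        UpqLoop.negRealLoops p q ∧
      ∀ g ∈ UpqLoop.negRealLoops p q, ∀ α : ℝ,
        (∀ z : ℂ, UpqLoop.IsSingularity g z → z = (α : ℂ)) →
        g ∈ Submonoid.closure (UpqLoop.loopsOf (UpqLoop.mFamily p q α ∪ UpqLoop.nFamily p q α))) := by
  open UpqLoop in
  have hall : ∀ f ∈ pFamily p q ∪ qFamily p q ∪ (⋃ α : ℝ, mFamily p q α) ∪
      (⋃ α : ℝ, nFamily p q α), ∃ g ∈ negRealLoops p q, g ∈ loopsOf {f} := by
    rintro f (((hf | hf) | hf) | hf)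
    · exact exists_mem_of_pFamily hf
    · exact exists_mem_of_qFamily hf
    · exact exists_mem_of_mFamily (Set.mem_iUnion.1 hf).choose_spec
    · exact exists_mem_of_nFamily (Set.mem_iUnion.1 hf).choose_spec
  open UpqLoop in
  refine ⟨hall, fun hpq => ⟨?_, fun g hg α hs => ?_⟩, fun _ => ⟨?_, fun g hg α hs => ?_⟩⟩
  -- Any real base point serves for the whole group, as z = 1/(λ - α) handles all poles at once; 0
  -- is chosen.
  · refine eq_negRealLoops 0 ((Subgroup.closure_le _).2 (loopsOf_subset_negRealLoops
      fun f hf => hall f (Set.mem_union_left _ hf))) ?_ (loopsOf_nFamily_subset hpq 0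
        (Subgroup.toSubmonoid _)) ?_ ?_ <;>
    refine (loopsOf_mono ?_).trans Subgroup.subset_closure
    · exact (Set.subset_iUnion _ _).trans Set.subset_union_right
    · exact Set.subset_union_left.trans Set.subset_union_left
    · exact Set.subset_union_right.trans Set.subset_union_left
  · exact mem_of_forall_isSingularity (Submonoid.closure_le.2 (loopsOf_subset_negRealLoops
      fun f hf => exists_mem_of_mFamily hf)) Submonoid.subset_closure
      (loopsOf_nFamily_subset hpq α _) hg hs
  · refine eq_negRealLoops 0 ((Subgroup.closure_le _).2 (loopsOf_subset_negRealLoops hall))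
      ?_ ?_ ?_ ?_ <;>
    refine (loopsOf_mono ?_).trans Subgroup.subset_closure
    · exact (Set.subset_iUnion _ _).trans (Set.subset_union_right.trans Set.subset_union_left)
    · exact (Set.subset_iUnion _ _).trans Set.subset_union_right
    · exact Set.subset_union_left.trans (Set.subset_union_left.trans Set.subset_union_left)
    · exact Set.subset_union_right.trans (Set.subset_union_left.trans Set.subset_union_left)
  · refine mem_of_forall_isSingularity (Submonoid.closure_le.2 (loopsOf_subset_negRealLoops ?_))
      ((loopsOf_mono Set.subset_union_left).trans Submonoid.subset_closure)
      ((loopsOf_mono Set.subset_union_right).trans Submonoid.subset_closure) hg hs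
    rintro f (hf | hf)
    · exact exists_mem_of_mFamily hf
    · exact exists_mem_of_nFamily hf
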